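/- Throughout everything is smooth. Let $n\ge 4$ and let $f\colon M^n\to\mathbb{R}^{n+m}$ be an isometric immersion of a Riemannian manifold, with second fundamental form $\alpha_f$ and shape operators $A_\eta$. It is Wintgen ideal if $s=H^2-s^\perp$ at every point, where $s$ is the normalized scalar curvature of $M$, $H=\|\mathcal H_f\|$ is the length of the normalized mean curvature vector, and $s^\perp=\|R^\perp\|/n(n-1)$ with $R^\perp$ the normal curvature tensor. It is a generic Wintgen ideal submanifold if moreover at every point there are an orthonormal tangent basis $e_1,\dots,e_n$, an orthonormal normal basis $\eta_1,\dots,\eta_m$ ($m\ge 3$) and numbers $\mu\ne0$, $\gamma_1,\gamma_2$ with $\gamma_1\gamma_2\neq0$ such that $$A_{\eta_1}=\begin{bmatrix}\mu&&\\&-\mu&\\&&0\end{bmatrix},\quad A_{\eta_2}=\begin{bmatrix}\gamma_1&\mu&\\ \mu&\gamma_1&\\&&\gamma_1 I_{n-2}\end{bmatrix},\quad A_{\eta_3}=\gamma_2 I_n,\quad A_{\eta_a}=0\ (a\ge4);$$ such bases are called adapted. Let $E=\{T: \alpha_f(T,X)=\langle T,X\rangle\mathcal H_f\ \text{for all } X\}$.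 For an immersed surface $g\colon L^2\to\mathbb{R}^{n+m}$ with the induced metric and a positive function $\tau$ on $L$ with $\|\nabla\tau\|<1$, let $\Lambda=\{(y,w): w\in N_gL(y),\ \|w\|=1\}$ be the unit normal bundle, $\Pi\colon\Lambda\to L$ its projection, $\mathcal V=\ker\Pi_*$, $$\Psi(y,w)=g(y)-\tau(y)\,N^\Psi(y,w),\qquad N^\Psi(y,w)=g_*\nabla\tau(y)+\sqrt{1-\|\nabla\tau(y)\|^2}\,w,$$ and let $\Lambda_0\subset\Lambda$ be the open set of points where $\Psi$ is an immersion, with the metric induced by $\Psi$ and with the shape operator $A^\Psi$ of $\Psi$ for the Gauss map $N^\Psi$, $\Psi_*A^\Psi V=-N^\Psi_*V$. **Direct statement.** Let $f\colon M^n\to\mathbb{R}^{n+m}$ be a generic Wintgen ideal submanifold. Every point of $M$ has an open neighbourhood $U$ with a surjective submersion $\pi\colon U\to L^2$ onto a connected surface such that $\ker\pi_*=E$, together with an immersion $g\colon L\to\mathbb{R}^{n+m}$ and a function $\tau\in C^\infty(L)$ such that $g\circ\pi=f+(1/H^2)\mathcal H_f$ and $\tau\circ\pi=\sigma:=1/H$.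 For every open $U\subset M$ with such data $(\pi,L,g,\tau)$ (in particular for $U=M$ if they exist globally), $\|\nabla\tau\|<1$ at every point of $L$, and there is a minimal isometric immersion $j\colon U\to\Lambda_0$ with $\Pi\circ j=\pi$ and $f|_U=\Psi\circ j$, whose relative nullity distribution is $E$, with $j_*E\subset\mathcal V$ and, for all adapted bases, $$\langle A^\Psi j_*e_i,j_*e_i\rangle=1/\sigma\ (i=1,2),\qquad \langle A^\Psi j_*e_1,j_*e_2\rangle=\mu\gamma_1\sigma .$$ **Converse.** Let $g\colon L^2\to\mathbb{R}^{n+m}$ be an immersed surface and $\tau\in C^\infty(L)$ a positive function with $\|\nabla\tau\|<1$. Let $j\colon M^n\to\Lambda_0$ be a minimal isometric immersion with relative nullity distribution $E$ such that $j_*E\subset\mathcal V$. Suppose that at each point there is an orthonormal basis $e_1,e_2$ of $E^\perp$ such that $\alpha_j(e_1,e_1)$ and $\alpha_j(e_1,e_2)$ are the semi-axes, of lengths $\kappa_1,\kappa_2>0$, of the (nondegenerate) curvature ellipse $\{\alpha_j(Z,Z): Z\in E^\perp,\ \|Z\|=1\}$, and that, with $\pi=\Pi\circ j$, $$\langle A^\Psi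 j_*e_i,j_*e_i\rangle=1/(\tau\circ\pi)\ (i=1,2),\qquad \langle A^\Psi j_*e_1,j_*e_2\rangle^2=\kappa_1^2-\kappa_2^2>0 .$$ Then $f=\Psi\circ j\colon M^n\to\mathbb{R}^{n+m}$ is a generic Wintgen ideal submanifold with mean curvature $H=1/(\tau\circ\pi)$. -/

import Mathlib

open scoped Manifold ContDiff
open Bundle

noncomputable section

namespace Wintgen

/-- The Euclidean space `ℝᵏ`. -/
abbrev Euc (k : ℕ) : Type := EuclideanSpace ℝ (Fin k)

/-- The differential `F_* : T_x X → ℝᴺ` (or `→ ℝ`) of a map into a vector space. -/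
def push {E : Type*} [NormedAddCommGroup E] [NormedSpace ℝ E] {H : Type*} [TopologicalSpace H]
    (I : ModelWithCorners ℝ E H) {X : Type*} [TopologicalSpace X] [ChartedSpace H X]
    {W : Type*} [NormedAddCommGroup W] [NormedSpace ℝ W] (F : X → W) (x : X) :
    TangentSpace I x →L[ℝ] W :=
  (NormedSpace.fromTangentSpace (𝕜 := ℝ) (F x)).toContinuousLinearMap ∘L
    mfderiv I 𝓘(ℝ, W) F x

/-- The vector representing the functional `ℓ` with respect to the bilinear form `B`
(unique when `B` is an inner product; `0` if there is none). -/
def rieszVector {V : Type*} [Zero V] (B : V → V → ℝ) (ℓ : V → ℝ) : V :=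
  open Classical in
  if h : ∃ a : V, ∀ w : V, B a w = ℓ w then h.choose else 0

/-! ### Extrinsic geometry of a map into Euclidean space -/

section Extrinsic

variable {k N : ℕ} {M : Type*} [TopologicalSpace M] [ChartedSpace (Euc k) M]

/-- Second derivative of `f` at `x` in the preferred chart at `x` (through which Mathlib
identifies `T_x M` with `ℝᵏ`). -/
def secondDeriv (f : M → Euc N) (x : M) (X Y : TangentSpace (𝓡 k) x) : Euc N :=
  fderiv ℝ (fderiv ℝ (f ∘ (extChartAt (𝓡 k) x).symm)) (extChartAt (𝓡 k) x x) X Y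

lemma secondDeriv_add_left (f : M → Euc N) (x : M) (X X' Y : TangentSpace (𝓡 k) x) :
    secondDeriv f x (X + X') Y = secondDeriv f x X Y + secondDeriv f x X' Y :=
  congrArg (fun A : Euc k →L[ℝ] Euc N => A (Y : Euc k)) (map_add (fderiv ℝ (fderiv ℝ
    (f ∘ (extChartAt (𝓡 k) x).symm)) (extChartAt (𝓡 k) x x)) (X : Euc k) (X' : Euc k))

lemma secondDeriv_smul_left (f : M → Euc N) (x : M) (c : ℝ) (X Y : TangentSpace (𝓡 k) x) :
    secondDeriv f x (c • X) Y = c • secondDeriv f x X Y :=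
  congrArg (fun A : Euc k →L[ℝ] Euc N => A (Y : Euc k)) (map_smul (fderiv ℝ (fderiv ℝ
    (f ∘ (extChartAt (𝓡 k) x).symm)) (extChartAt (𝓡 k) x x)) c (X : Euc k))

/-- The image `f_* T_x M`. -/
def tangentImage (k : ℕ) {N : ℕ} {M : Type*} [TopologicalSpace M] [ChartedSpace (Euc k) M] (f : M → Euc N) (x : M) : Submodule ℝ (Euc N) :=
  LinearMap.range (push (𝓡 k) f x).toLinearMap

/-- The normal space `N_f M(x)`. -/
def normalSpace (k : ℕ) {N : ℕ} {M : Type*} [TopologicalSpace M] [ChartedSpace (Euc k) M] (f : M → Euc N) (x : M) : Submodule ℝ (Euc N) :=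
  (tangentImage k f x)ᗮ

/-- The second fundamental form `α_f(X, Y)`, the normal component of the second derivative;
the shape operators are given by `⟨A_η X, Y⟩ = ⟨α_f(X, Y), η⟩`. -/
def sff (f : M → Euc N) (x : M) (X Y : TangentSpace (𝓡 k) x) : Euc N :=
  (normalSpace k f x).starProjection (secondDeriv f x X Y)

/-- For a map `F` between Euclidean spaces, orthogonal projection onto the normal space at `z`. -/
def normalProj (F : Euc k → Euc N) (z : Euc k) : Euc N →L[ℝ] Euc N :=
  ((LinearMap.range (fderiv ℝ F z).toLinearMap)ᗮ).starProjection

/-- The normal connection `∇^⊥_u ξ` of `F` in the constant coordinate direction `u`. -/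
def normalDeriv (F : Euc k → Euc N) (u : Euc k) (ξ : Euc k → Euc N) (z : Euc k) : Euc N :=
  normalProj F z (fderiv ℝ ξ z u)

/-- The normal curvature tensor
`R^⊥(X, Y)ξ = ∇^⊥_X ∇^⊥_Y ξ - ∇^⊥_Y ∇^⊥_X ξ - ∇^⊥_[X, Y] ξ` at `x`, computed in the preferred chart
with `X`, `Y` extended to coordinate fields and `ξ` extended by projecting to the
normal spaces. -/
def normalCurvature (f : M → Euc N) (x : M) (X Y : TangentSpace (𝓡 k) x) (ξ : Euc N) : Euc N :=
  let F : Euc k → Euc N := f ∘ (extChartAt (𝓡 k) x).symm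
  let z : Euc k := extChartAt (𝓡 k) x x
  let ν : Euc k → Euc N := fun z' => normalProj F z' ξ
  normalDeriv F X (normalDeriv F Y ν) z - normalDeriv F Y (normalDeriv F X ν) z

end Extrinsic

/-! ### Riemannian geometry -/

section Riemannian

variable {n N : ℕ} {M : Type*} [TopologicalSpace M] [ChartedSpace (Euc n) M]

instance (x : M) : FiniteDimensional ℝ (TangentSpace (𝓡 n) x) :=
  inferInstanceAs (FiniteDimensional ℝ (Euc n))

variable [RiemannianBundle (fun x : M => TangentSpace (𝓡 n) x)]

/-- An orthonormal basis of `T_x M`, used to write traces. -/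
def tangentBasis (n : ℕ) {M : Type*} [TopologicalSpace M]
    [ChartedSpace (Euc n) M] [RiemannianBundle (fun x : M => TangentSpace (𝓡 n) x)] (x : M) :
    OrthonormalBasis (Fin (Module.finrank ℝ (TangentSpace (𝓡 n) x))) ℝ (TangentSpace (𝓡 n) x) :=
  stdOrthonormalBasis ℝ (TangentSpace (𝓡 n) x)

/-- The coefficients of the metric, at the point with coordinates `z` in the preferred
chart at `x`. -/
def chartMetric (x : M) (z u v : Euc n) : ℝ :=
  inner ℝ (mfderiv 𝓘(ℝ, Euc n) (𝓡 n) (extChartAt (𝓡 n) x).symm z u)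
    (mfderiv 𝓘(ℝ, Euc n) (𝓡 n) (extChartAt (𝓡 n) x).symm z v)

/-- The Levi-Civita connection on coordinate fields, `Γ(u, v) = ∇_u v`, by the Koszul formula. -/
def christoffel (x : M) (z u v : Euc n) : Euc n :=
  rieszVector (chartMetric x z) fun w =>
    (fderiv ℝ (fun z' => chartMetric x z' v w) z u
      + fderiv ℝ (fun z' => chartMetric x z' u w) z v
      - fderiv ℝ (fun z' => chartMetric x z' u v) z w) / 2

/-- The curvature tensor `R(X, Y)Z = ∇_X ∇_Y Z - ∇_Y ∇_X Z - ∇_[X, Y] Z` of `M` at `x`. -/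
def curvature (x : M) (X Y Z : TangentSpace (𝓡 n) x) : TangentSpace (𝓡 n) x :=
  let z : Euc n := extChartAt (𝓡 n) x x
  let Γ : Euc n → Euc n → Euc n → Euc n := christoffel x
  let R : Euc n → Euc n → Euc n → Euc n := fun u v w =>
    fderiv ℝ (fun z' => Γ z' v w) z u - fderiv ℝ (fun z' => Γ z' u w) z v
      + Γ z u (Γ z v w) - Γ z v (Γ z u w)
  R X Y Z

/-- The normalized scalar curvature `s` of `M`. -/
def normalizedScalarCurvature (n : ℕ) {M : Type*} [TopologicalSpace M]
    [ChartedSpace (Euc n) M] [RiemannianBundle (fun x : M => TangentSpace (𝓡 n) x)] (x : M) : ℝ :=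
  (∑ i, ∑ j, inner ℝ (curvature x (tangentBasis n x i) (tangentBasis n x j) (tangentBasis n x j))
    (tangentBasis n x i)) / ((n : ℝ) * ((n : ℝ) - 1))

/-- The normal scalar curvature `s^⊥ = ‖R^⊥‖ / (n (n - 1))`. -/
def normalScalarCurvature (n : ℕ) {N : ℕ} {M : Type*} [TopologicalSpace M]
    [ChartedSpace (Euc n) M] [RiemannianBundle (fun x : M => TangentSpace (𝓡 n) x)] (f : M → Euc N) (x : M) : ℝ :=
  Real.sqrt (∑ i, ∑ j, ∑ a, ‖normalCurvature f x (tangentBasis n x i) (tangentBasis n x j)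
    (stdOrthonormalBasis ℝ (normalSpace n f x) a : Euc N)‖ ^ 2) / ((n : ℝ) * ((n : ℝ) - 1))

/-- The (normalized) mean curvature vector `ℋ_f`. -/
def meanCurvatureVector (n : ℕ) {N : ℕ} {M : Type*} [TopologicalSpace M]
    [ChartedSpace (Euc n) M] [RiemannianBundle (fun x : M => TangentSpace (𝓡 n) x)] (f : M → Euc N) (x : M) : Euc N :=
  (n : ℝ)⁻¹ • ∑ i, sff f x (tangentBasis n x i) (tangentBasis n x i)

/-- The mean curvature `H = ‖ℋ_f‖`. -/
def meanCurvature (n : ℕ) {N : ℕ} {M : Type*} [TopologicalSpace M]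
    [ChartedSpace (Euc n) M] [RiemannianBundle (fun x : M => TangentSpace (𝓡 n) x)] (f : M → Euc N) (x : M) : ℝ :=
  ‖meanCurvatureVector n f x‖

/-- The distribution `E = E_ℋ` of the mean curvature vector,
`E(x) = {T | α_f(T, X) = ⟨T, X⟩ ℋ_f for all X}`. -/
def meanCurvatureDistribution (f : M → Euc N) (x : M) : Set (TangentSpace (𝓡 n) x) :=
  {T | ∀ X : TangentSpace (𝓡 n) x, sff f x T X = (inner ℝ T X : ℝ) • meanCurvatureVector n f x}

/-- `f` is a smooth isometric immersion. -/
structure IsIsometricImmersion (n : ℕ) {N : ℕ} {M : Type*} [TopologicalSpace M]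
    [ChartedSpace (Euc n) M] [RiemannianBundle (fun x : M => TangentSpace (𝓡 n) x)] (f : M → Euc N) : Prop where
  smooth : ContMDiff (𝓡 n) 𝓘(ℝ, Euc N) ∞ f
  isometric : ∀ (x : M) (v w : TangentSpace (𝓡 n) x),
    (inner ℝ (push (𝓡 n) f x v) (push (𝓡 n) f x w) : ℝ) = inner ℝ v w

/-- `f` is Wintgen ideal: equality `s = H² - s^⊥` holds everywhere in the DDVV inequality. -/
structure IsWintgenIdeal (n : ℕ) {N : ℕ} {M : Type*} [TopologicalSpace M]
    [ChartedSpace (Euc n) M] [RiemannianBundle (fun x : M => TangentSpace (𝓡 n) x)] (f : M → Euc N) :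
    Prop extends IsIsometricImmersion n f where
  ddvv_eq : ∀ x : M, normalizedScalarCurvature n x =
    meanCurvature n f x ^ 2 - normalScalarCurvature n f x

/-- The orthonormal tangent frame `e₁, …, eₙ` and the orthonormal normal frame `η₁, …, ηₘ` at `x`
put the shape operators in the form
`A_{η₁} = diag(μ, -μ, 0)`, `A_{η₂} = [γ₁ μ; μ γ₁] ⊕ γ₁ I`, `A_{η₃} = γ₂ I`, and `A_{η_a} = 0` for
`a ≥ 4`. Indices start at `0` in the code. -/
structure IsAdaptedFrame {m : ℕ} (f : M → Euc (n + m)) (x : M)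
    (e : Fin n → TangentSpace (𝓡 n) x) (η : Fin m → Euc (n + m)) (μ γ₁ γ₂ : ℝ) : Prop where
  orthonormal_tangent : Orthonormal ℝ e
  orthonormal_normal : Orthonormal ℝ η
  mem_normal : ∀ a, η a ∈ normalSpace n f x
  shape_one : ∀ (a : Fin m) (i j : Fin n), (a : ℕ) = 0 →
    (inner ℝ (sff f x (e i) (e j)) (η a) : ℝ) =
      if (i : ℕ) = 0 ∧ (j : ℕ) = 0 then μ else if (i : ℕ) = 1 ∧ (j : ℕ) = 1 then -μ else 0
  shape_two : ∀ (a : Fin m) (i j : Fin n), (a : ℕ) = 1 →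
    (inner ℝ (sff f x (e i) (e j)) (η a) : ℝ) =
      if i = j then γ₁
      else if ((i : ℕ) = 0 ∧ (j : ℕ) = 1) ∨ ((i : ℕ) = 1 ∧ (j : ℕ) = 0) then μ else 0
  shape_three : ∀ (a : Fin m) (i j : Fin n), (a : ℕ) = 2 →
    (inner ℝ (sff f x (e i) (e j)) (η a) : ℝ) = if i = j then γ₂ else 0
  shape_rest : ∀ (a : Fin m) (i j : Fin n), 3 ≤ (a : ℕ) →
    (inner ℝ (sff f x (e i) (e j)) (η a) : ℝ) = 0

/-- `f` is a generic Wintgen ideal submanifold: `μ ≠ 0` and `γ₁ γ₂ ≠ 0` everywhere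
(`γ₂ ≠ 0` needs a third normal direction, so the codimension is at least three). -/
structure IsGenericWintgen {m : ℕ} (f : M → Euc (n + m)) :
    Prop extends IsWintgenIdeal n f where
  generic : ∀ x : M, 3 ≤ m ∧ ∃ (e : Fin n → TangentSpace (𝓡 n) x) (η : Fin m → Euc (n + m)) (μ γ₁ γ₂ : ℝ),
    IsAdaptedFrame f x e η μ γ₁ γ₂ ∧ μ ≠ 0 ∧ γ₁ * γ₂ ≠ 0

end Riemannian

/-! ### The conformal Gauss parametrization of a surface `g : L² → ℝᴺ` and a function `τ` -/

section ConformalGauss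

variable {N : ℕ} {L : Type*} [TopologicalSpace L] [ChartedSpace (Euc 2) L]

/-- The gradient `∇τ` for the metric induced by `g`. -/
def surfaceGradient (g : L → Euc N) (τ : L → ℝ) (y : L) : TangentSpace (𝓡 2) y :=
  rieszVector (fun a b => (inner ℝ (push (𝓡 2) g y a) (push (𝓡 2) g y b) : ℝ))
    (fun b => push (𝓡 2) τ y b)

/-- The vector `g_* ∇τ`; its norm is `‖∇τ‖`. -/
def pushGradient (g : L → Euc N) (τ : L → ℝ) (y : L) : Euc N :=
  push (𝓡 2) g y (surfaceGradient g τ y)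

/-- The field `N^Ψ(y, w) = g_* ∇τ(y) + √(1 - ‖∇τ(y)‖²) w`, which on the unit normal bundle is the
Gauss map of `Ψ`. -/
def gaussMap (g : L → Euc N) (τ : L → ℝ) (p : L × Euc N) : Euc N :=
  pushGradient g τ p.1 + Real.sqrt (1 - ‖pushGradient g τ p.1‖ ^ 2) • p.2

/-- The map `Ψ(y, w) = g(y) - τ(y) (g_* ∇τ(y) + √(1 - ‖∇τ(y)‖²) w)`. The formula is used on all of
`L × ℝᴺ`; only its restriction to the unit normal bundle matters. -/
def conformalGauss (g : L → Euc N) (τ : L → ℝ) (p : L × Euc N) : Euc N :=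
  g p.1 - τ p.1 • (pushGradient g τ p.1 + Real.sqrt (1 - ‖pushGradient g τ p.1‖ ^ 2) • p.2)

/-- The unit normal bundle `Λ` of `g`, as a submanifold of `L × ℝᴺ`. -/
def unitNormalBundle (g : L → Euc N) : Set (L × Euc N) :=
  {p | p.2 ∈ normalSpace 2 g p.1 ∧ ‖p.2‖ = 1}

/-- The linearized equations of `Λ` at `p = (y, w)` for a pair `(Z, w')`:
`⟨w', w⟩ = 0` and `⟨w', g_* X⟩ + ⟨w, D²g(Z, X)⟩ = 0` for all `X`. -/
def IsTangentPair (g : L → Euc N) (p : L × Euc N) (Z : TangentSpace (𝓡 2) p.1)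
    (w' : Euc N) : Prop :=
  (inner ℝ w' p.2 : ℝ) = 0 ∧ ∀ X : TangentSpace (𝓡 2) p.1,
    (inner ℝ w' (push (𝓡 2) g p.1 X) : ℝ) + inner ℝ p.2 (secondDeriv g p.1 Z X) = 0

lemma IsTangentPair.add {g : L → Euc N} {p : L × Euc N} {Z Z' : TangentSpace (𝓡 2) p.1}
    {w w' : Euc N} (h : IsTangentPair g p Z w) (h' : IsTangentPair g p Z' w') :
    IsTangentPair g p (Z + Z') (w + w') := by
  refine ⟨by rw [inner_add_left, h.1, h'.1, add_zero], fun X => ?_⟩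
  have h1 := h.2 X
  have h2 := h'.2 X
  rw [secondDeriv_add_left, inner_add_left, inner_add_right]
  linarith

lemma IsTangentPair.smul {g : L → Euc N} {p : L × Euc N} {Z : TangentSpace (𝓡 2) p.1}
    {w : Euc N} (c : ℝ) (h : IsTangentPair g p Z w) : IsTangentPair g p (c • Z) (c • w) := by
  refine ⟨by rw [real_inner_smul_left, h.1, mul_zero], fun X => ?_⟩
  rw [secondDeriv_smul_left, real_inner_smul_left, real_inner_smul_right, ← mul_add, h.2 X,
    mul_zero]

lemma IsTangentPair.zero (g : L → Euc N) (p : L × Euc N) :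
    IsTangentPair g p (0 : TangentSpace (𝓡 2) p.1) 0 := by
  refine ⟨inner_zero_left _, fun X => ?_⟩
  have h : secondDeriv g p.1 (0 : TangentSpace (𝓡 2) p.1) X = 0 := by
    simpa using secondDeriv_smul_left g p.1 0 (0 : TangentSpace (𝓡 2) p.1) X
  rw [h, inner_zero_left, inner_zero_right, add_zero]

/-- The tangent space of `Λ` at `p = (y, w) ∈ Λ`, inside `T_y L × ℝᴺ`. -/
def tangentUnitNormalBundle (g : L → Euc N) (p : L × Euc N) :
    Submodule ℝ (TangentSpace ((𝓡 2).prod 𝓘(ℝ, Euc N)) p) where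
  carrier := {V | IsTangentPair g p V.1 V.2}
  zero_mem' := IsTangentPair.zero g p
  add_mem' h h' := IsTangentPair.add h h'
  smul_mem' c _ h := IsTangentPair.smul c h

/-- The open set `Λ₀ ⊆ Λ` of regular points of `Ψ|_Λ`. -/
def regularSet (g : L → Euc N) (τ : L → ℝ) : Set (L × Euc N) :=
  {p | p ∈ unitNormalBundle g ∧ ∀ V ∈ tangentUnitNormalBundle g p,
    push ((𝓡 2).prod 𝓘(ℝ, Euc N)) (conformalGauss g τ) p V = 0 → V = 0}

/-- The image `Ψ_* T_p Λ`. -/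
def hypersurfaceTangent (g : L → Euc N) (τ : L → ℝ) (p : L × Euc N) : Submodule ℝ (Euc N) :=
  (tangentUnitNormalBundle g p).map
    (push ((𝓡 2).prod 𝓘(ℝ, Euc N)) (conformalGauss g τ) p).toLinearMap

/-- `⟨A^Ψ V, W⟩` in the metric induced by `Ψ`, where `A^Ψ` is the shape operator of `Ψ` for its Gauss
map: `Ψ_* A^Ψ V = -(N^Ψ)_* V`. -/
def shapeForm (g : L → Euc N) (τ : L → ℝ) (p : L × Euc N)
    (V W : TangentSpace ((𝓡 2).prod 𝓘(ℝ, Euc N)) p) : ℝ :=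
  -inner ℝ (push ((𝓡 2).prod 𝓘(ℝ, Euc N)) (gaussMap g τ) p V)
    (push ((𝓡 2).prod 𝓘(ℝ, Euc N)) (conformalGauss g τ) p W)

/-! ### Isometric immersions `j : M → Λ₀`, `Λ₀` with the metric induced by `Ψ` -/

variable {n : ℕ} {M : Type*} [TopologicalSpace M] [ChartedSpace (Euc n) M]

/-- The differential `j_*`. -/
def jStar (j : M → L × Euc N) (x : M) :
    TangentSpace (𝓡 n) x →L[ℝ] TangentSpace ((𝓡 2).prod 𝓘(ℝ, Euc N)) (j x) :=
  mfderiv (𝓡 n) ((𝓡 2).prod 𝓘(ℝ, Euc N)) j x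

/-- The second fundamental form `α_j` of `j : M → Λ₀`, more precisely `Ψ_* α_j(X, Y)`. The Levi-Civita
connection of the metric induced by `Ψ` is the component tangent to `Ψ` of the flat derivative,
and `α_j` is the component of `∇_X j_* Y` normal to `j_* T_x M`. -/
def sffInto (g : L → Euc N) (τ : L → ℝ) (j : M → L × Euc N) (x : M)
    (X Y : TangentSpace (𝓡 n) x) : Euc N :=
  (normalSpace n (conformalGauss g τ ∘ j) x).starProjection
    ((hypersurfaceTangent g τ (j x)).starProjection
      (secondDeriv (conformalGauss g τ ∘ j) x X Y))

/-- The relative nullity subspace of `j` at `x`, `{T | α_j(T, Y) = 0 for all Y}`. -/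
def relativeNullity (n : ℕ) {N : ℕ} {L : Type*} [TopologicalSpace L] [ChartedSpace (Euc 2) L]
    {M : Type*} [TopologicalSpace M] [ChartedSpace (Euc n) M]
    (g : L → Euc N) (τ : L → ℝ) (j : M → L × Euc N) (x : M) :
    Set (TangentSpace (𝓡 n) x) :=
  {T | ∀ Y : TangentSpace (𝓡 n) x, sffInto g τ j x T Y = 0}

variable [RiemannianBundle (fun x : M => TangentSpace (𝓡 n) x)]

/-- On the open set `U`, `j` is a smooth minimal isometric immersion into `Λ₀` whose
relative nullity is mapped by `j_*` into the vertical distribution of `Λ → L`. -/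
structure IsMinimalVerticalImmersion (n : ℕ) {N : ℕ} {L : Type*} [TopologicalSpace L]
    [ChartedSpace (Euc 2) L] {M : Type*} [TopologicalSpace M] [ChartedSpace (Euc n) M]
    [RiemannianBundle (fun x : M => TangentSpace (𝓡 n) x)] (g : L → Euc N) (τ : L → ℝ) (U : Set M)
    (j : M → L × Euc N) : Prop where
  smooth : ContMDiffOn (𝓡 n) ((𝓡 2).prod 𝓘(ℝ, Euc N)) ∞ j U
  mem_regular : ∀ x ∈ U, j x ∈ regularSet g τ
  isometric : ∀ x ∈ U, ∀ v w : TangentSpace (𝓡 n) x,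
    (inner ℝ (push ((𝓡 2).prod 𝓘(ℝ, Euc N)) (conformalGauss g τ) (j x) (jStar j x v))
      (push ((𝓡 2).prod 𝓘(ℝ, Euc N)) (conformalGauss g τ) (j x) (jStar j x w)) : ℝ) = inner ℝ v w
  minimal : ∀ x ∈ U, ∑ i, sffInto g τ j x (tangentBasis n x i) (tangentBasis n x i) = 0
  vertical : ∀ x ∈ U, ∀ T : TangentSpace (𝓡 n) x, T ∈ relativeNullity n g τ j x → (jStar j x T).1 = 0

/-- The curvature ellipse of `j` at `x`: the set of all `α_j(Z, Z)` with `Z` a unit vector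
orthogonal to the relative nullity. -/
def curvatureEllipse (n : ℕ) {N : ℕ} {L : Type*} [TopologicalSpace L] [ChartedSpace (Euc 2) L]
    {M : Type*} [TopologicalSpace M] [ChartedSpace (Euc n) M]
    [RiemannianBundle (fun x : M => TangentSpace (𝓡 n) x)] (g : L → Euc N) (τ : L → ℝ) (j : M → L × Euc N) (x : M) : Set (Euc N) :=
  {a | ∃ Z : TangentSpace (𝓡 n) x, ‖Z‖ = 1 ∧
    (∀ T : TangentSpace (𝓡 n) x, T ∈ relativeNullity n g τ j x → (inner ℝ T Z : ℝ) = 0) ∧ a = sffInto g τ j x Z Z}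

/-- `a` and `b` are the semi-axes of the (possibly degenerate) ellipse `S` centred at `0`. -/
def AreSemiAxes (S : Set (Euc N)) (a b : Euc N) : Prop :=
  (inner ℝ a b : ℝ) = 0 ∧ S = Set.range fun t : ℝ => Real.cos t • a + Real.sin t • b

/-- `e₁, e₂` is an orthonormal basis of the orthogonal complement of the relative nullity. -/
def IsConullityFrame (g : L → Euc N) (τ : L → ℝ) (j : M → L × Euc N) (x : M)
    (e₁ e₂ : TangentSpace (𝓡 n) x) : Prop :=
  ‖e₁‖ = 1 ∧ ‖e₂‖ = 1 ∧ (inner ℝ e₁ e₂ : ℝ) = 0 ∧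
    ∀ T : TangentSpace (𝓡 n) x,
      T ∈ relativeNullity n g τ j x ↔ (inner ℝ T e₁ : ℝ) = 0 ∧ (inner ℝ T e₂ : ℝ) = 0

end ConformalGauss

/-! ### The focal surface and the factorization -/

section Focal

variable {n m : ℕ} {M : Type*} [TopologicalSpace M] [ChartedSpace (Euc n) M]
  [RiemannianBundle (fun x : M => TangentSpace (𝓡 n) x)]
  {L : Type*} [TopologicalSpace L] [ChartedSpace (Euc 2) L]

/-- On the open set `U`, `pr : U → L` is a surjective submersion onto a surface whose fibres
are tangent to `E`, and `h = f + ℋ_f / H²` and `1 / H` descend to a smooth immersion `g`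
(the focal surface) and a smooth function `τ` on `L`. -/
structure IsFocalSurface (f : M → Euc (n + m)) (U : Set M) (pr : M → L) (g : L → Euc (n + m))
    (τ : L → ℝ) : Prop where
  smooth_proj : ContMDiffOn (𝓡 n) (𝓡 2) ∞ pr U
  surjective : pr '' U = Set.univ
  submersion : ∀ x ∈ U, Function.Surjective (mfderiv (𝓡 n) (𝓡 2) pr x)
  ker_proj : ∀ x ∈ U, ∀ T : TangentSpace (𝓡 n) x,
    mfderiv (𝓡 n) (𝓡 2) pr x T = 0 ↔ T ∈ meanCurvatureDistribution f x
  smooth_surface : ContMDiff (𝓡 2) 𝓘(ℝ, Euc (n + m)) ∞ g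
  immersion : ∀ y, Function.Injective (push (𝓡 2) g y)
  smooth_radius : ContMDiff (𝓡 2) 𝓘(ℝ, ℝ) ∞ τ
  focal : ∀ x ∈ U, g (pr x) = f x + (1 / meanCurvature n f x ^ 2) • meanCurvatureVector n f x
  radius : ∀ x ∈ U, τ (pr x) = 1 / meanCurvature n f x

/-- `‖∇τ‖ < 1`, and on `U` the map `f` factors as `f = Ψ ∘ j` with `j` over `pr` a minimal isometric
immersion into `Λ₀` whose relative nullity is `E`, with `j_* E ⊆ 𝒱` and
`⟨A^Ψ j_*eᵢ, j_*eᵢ⟩ = 1/σ` (`i = 1, 2`), `⟨A^Ψ j_*e₁, j_*e₂⟩ = μ γ₁ σ` in adapted frames, `σ = 1/H`. -/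
def FactorsThroughConformalGauss (f : M → Euc (n + m)) (U : Set M) (pr : M → L)
    (g : L → Euc (n + m)) (τ : L → ℝ) : Prop :=
  (∀ y, ‖pushGradient g τ y‖ < 1) ∧
  ∃ j : M → L × Euc (n + m), IsMinimalVerticalImmersion n g τ U j ∧
    ∀ x ∈ U, (j x).1 = pr x ∧ f x = conformalGauss g τ (j x) ∧
      relativeNullity n g τ j x = meanCurvatureDistribution f x ∧
      ∀ (e : Fin n → TangentSpace (𝓡 n) x) (η : Fin m → Euc (n + m)) (μ γ₁ γ₂ : ℝ),
        IsAdaptedFrame f x e η μ γ₁ γ₂ →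
        (∀ i : Fin n, (i : ℕ) < 2 →
          shapeForm g τ (j x) (jStar j x (e i)) (jStar j x (e i)) = 1 / τ (pr x)) ∧
        (∀ i k : Fin n, (i : ℕ) = 0 → (k : ℕ) = 1 →
          shapeForm g τ (j x) (jStar j x (e i)) (jStar j x (e k))
            = μ * γ₁ * τ (pr x))

end Focal

end Wintgen

end

/-!
The invariant meaning of the adapted frames is that `α_f = ⟨·, ·⟩ ℋ + β`, where the trace-free part
`β` lives on the plane spanned by `e₁, e₂` and satisfies `β(e₁, e₁) = -β(e₂, e₂) = μ η₁`,
`β(e₁, e₂) = μ η₂`: its curvature ellipse is a circle (`HasWintgenForm`). By the Gauss and Ricci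
equations this form gives equality in the DDVV inequality (`HasWintgenForm.ddvv_eq`).

*Direct statement.* The circularity of the ellipse gives
`‖β(X, Y)‖ ‖β(Z, Z)‖ = ‖β(X, Z)‖ ‖β(Y, Z)‖`. For constant `X, Y` which lie in `E` at a point, the
right-hand side vanishes to second order there, so the derivative of `β(X, Y)` is zero although `E`
itself varies. Codazzi's equation then shows that `ℋ` is parallel in the normal connection along
`E` (`inner_push_meanCurvatureVector`); it is applied to two orthogonal directions of `E`, whence
`n ≥ 4`. So the focal map `h = f + ℋ / H²` and the radius `1 / H` are constant along `E`, and the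
kernel of `h_*` is exactly `E` (`IsGenericWintgen.push_focalMap_eq_zero_iff`). The pair
`(h, 1 / H)` has constant rank two and therefore factors locally through a submersion onto the
plane (`exists_factorization_of_rank_two`, `IsGenericWintgen.exists_isFocalSurface`).

Given such a factorization `h = g ∘ π`, `1 / H = τ ∘ π`, the unit normal field `ℋ / H` of `f`
satisfies `⟨ℋ / H, h_* X⟩ = X(1 / H)`, because `h = f + (1 / H) (ℋ / H)`. The component of `ℋ / H`
tangent to the surface `g` is therefore `g_* ∇τ`. Its normal component is nonzero, so `‖∇τ‖ < 1`,
and equals `√(1 - ‖∇τ‖²) w` for a unit normal vector `w` of `g`. The lift `j = (π, w)` satisfies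
`Ψ ∘ j = f` and `N^Ψ ∘ j = ℋ / H`, so that `α_j` is the part of `α_f` orthogonal to `ℋ`. It is
trace-free, and its nullity is `E` because `ℋ` does not lie in the plane of `η₁, η₂`
(`IsFocalSurface.factorsThroughConformalGauss`).

*Converse.* For `f = Ψ ∘ j` the second fundamental form is `α_j` plus an `N^Ψ`-component given by
the shape operator of `Ψ`, which is `1 / τ` on vertical vectors. Hence `f` has mean curvature vector
`N^Ψ / τ`, and the curvature ellipse of its trace-free part has conjugate radii of lengths `κ₁` and
`√(κ₂² + ⟨A^Ψ j_* e₁, j_* e₂⟩²)`, which are orthogonal. By hypothesis these lengths agree, so the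
ellipse is a circle (`IsGaussData.exists_isAdaptedFrame_comp`, `IsGaussData.isGenericWintgen_comp`).
-/

noncomputable section

namespace Wintgen

/-! ### The pseudoinverse of an injective linear map -/

section PseudoInverse

variable {k N : ℕ}

/-- The Moore–Penrose inverse `(AᵀA)⁻¹Aᵀ` of an injective linear map `A`. -/
def pseudoInverse (A : Euc k →L[ℝ] Euc N) : Euc N →L[ℝ] Euc k :=
  (A.adjoint ∘L A).inverse ∘L A.adjoint

lemma isInvertible_adjoint_comp_self {A : Euc k →L[ℝ] Euc N} (hA : Function.Injective A) :
    (A.adjoint ∘L A).IsInvertible := by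
  have hinj : Function.Injective (A.adjoint ∘L A) := by
    rw [injective_iff_map_eq_zero]
    intro u hu
    have h : (inner ℝ (A u) (A u) : ℝ) = 0 := by
      rw [← ContinuousLinearMap.adjoint_inner_left]
      have : A.adjoint (A u) = 0 := hu
      rw [this, inner_zero_left]
    exact hA ((inner_self_eq_zero.1 h).trans (map_zero A).symm)
  let e := (LinearEquiv.ofInjectiveEndo (A.adjoint ∘L A).toLinearMap hinj).toContinuousLinearEquiv
  refine ⟨e, ?_⟩
  ext u i
  rfl

lemma pseudoInverse_apply_self {A : Euc k →L[ℝ] Euc N} (hA : Function.Injective A) (u : Euc k) :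
    pseudoInverse A (A u) = u :=
  (isInvertible_adjoint_comp_self hA).inverse_apply_eq.2 rfl

lemma inner_apply_pseudoInverse {A : Euc k →L[ℝ] Euc N} (hA : Function.Injective A) (ξ : Euc N)
    (u : Euc k) : (inner ℝ (A (pseudoInverse A ξ)) (A u) : ℝ) = inner ℝ ξ (A u) := by
  have h : (A.adjoint ∘L A) (pseudoInverse A ξ) = A.adjoint ξ :=
    (isInvertible_adjoint_comp_self hA).inverse_apply_eq.1 rfl |>.symm
  rw [← ContinuousLinearMap.adjoint_inner_left]
  have h' : A.adjoint (A (pseudoInverse A ξ)) = A.adjoint ξ := h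
  rw [h', ContinuousLinearMap.adjoint_inner_left]

/-- The projection onto the orthogonal complement of the range is `1 - A A⁺`. -/
lemma starProjection_range_orthogonal {A : Euc k →L[ℝ] Euc N} (hA : Function.Injective A)
    (ξ : Euc N) :
    (LinearMap.range A.toLinearMap)ᗮ.starProjection ξ = ξ - A (pseudoInverse A ξ) := by
  refine Submodule.eq_starProjection_of_mem_of_inner_eq_zero
    (K := (LinearMap.range A.toLinearMap)ᗮ) ?_ ?_
  · rintro _ ⟨u, rfl⟩
    have := inner_apply_pseudoInverse hA ξ u
    rw [real_inner_comm, ContinuousLinearMap.coe_coe, inner_sub_left, this, sub_self]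
  · intro w hw
    rw [sub_sub_cancel]
    exact hw _ ⟨_, rfl⟩

/-- The adjoint as a continuous linear map over `ℝ`. -/
def adjointL (k N : ℕ) : (Euc k →L[ℝ] Euc N) →L[ℝ] (Euc N →L[ℝ] Euc k) :=
  LinearMap.mkContinuous
    { toFun := fun A => A.adjoint
      map_add' := fun A B => map_add _ A B
      map_smul' := fun c A => by simp }
    1 (fun A => by simp)

lemma contDiffAt_pseudoInverse {X : Type*} [NormedAddCommGroup X] [NormedSpace ℝ X] {r : ℕ∞ω}
    {A : X → Euc k →L[ℝ] Euc N} {z : X} (hA : ContDiffAt ℝ r A z)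
    (hinj : Function.Injective (A z)) : ContDiffAt ℝ r (fun z => pseudoInverse (A z)) z := by
  have hadj : ContDiffAt ℝ r (fun z => (A z).adjoint) z :=
    (adjointL k N).contDiff.contDiffAt.comp z hA
  have hcomp : ContDiffAt ℝ r (fun z => (A z).adjoint ∘L A z) z := hadj.clm_comp hA
  have hinv := (isInvertible_adjoint_comp_self hinj).contDiffAt_map_inverse (n := r)
  exact (hinv.comp z hcomp).clm_comp hadj

lemma eventually_injective {X : Type*} [TopologicalSpace X]
    {A : X → Euc k →L[ℝ] Euc N} {z : X} (hA : ContinuousAt A z)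
    (hinj : Function.Injective (A z)) : ∀ᶠ z' in nhds z, Function.Injective (A z') :=
  hA.eventually (ContinuousLinearMap.isOpen_injective.mem_nhds hinj)

end PseudoInverse

/-! ### Derivatives in charts -/

section Charts

variable {k : ℕ} {X : Type*} [TopologicalSpace X] [ChartedSpace (Euc k) X]
  {W : Type*} [NormedAddCommGroup W] [NormedSpace ℝ W]

/-- The representative of a map in the preferred chart at `x₀`. -/
def chartRep {W : Type*} (x₀ : X) (f : X → W) : Euc k → W := f ∘ (extChartAt (𝓡 k) x₀).symm

/-- The differential of the preferred chart at `x₀`, at the point `x`. -/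
def chartDeriv (x₀ x : X) : TangentSpace (𝓡 k) x →L[ℝ] Euc k :=
  push (𝓡 k) (extChartAt (𝓡 k) x₀) x

lemma push_congr {E : Type*} [NormedAddCommGroup E] [NormedSpace ℝ E] {H : Type*}
    [TopologicalSpace H] {I : ModelWithCorners ℝ E H} {X : Type*} [TopologicalSpace X]
    [ChartedSpace H X] {f g : X → W} {x : X} (h : f =ᶠ[nhds x] g) (v : TangentSpace I x) :
    push I f x v = push I g x v := by
  have h1 : mfderiv I 𝓘(ℝ, W) f x = mfderiv I 𝓘(ℝ, W) g x := h.mfderiv_eq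
  exact congrArg (fun A : E →L[ℝ] W => A v) h1

lemma chartRep_eventuallyEq {W : Type*} {x₀ x : X} (f : X → W)
    (hx : x ∈ (extChartAt (𝓡 k) x₀).source) :
    f =ᶠ[nhds x] chartRep x₀ f ∘ extChartAt (𝓡 k) x₀ := by
  filter_upwards [(isOpen_extChartAt_source x₀).mem_nhds hx] with y hy
  exact congrArg f ((extChartAt (𝓡 k) x₀).left_inv hy).symm

lemma chartRep_apply {W : Type*} {x₀ x : X} (f : X → W) (hx : x ∈ (extChartAt (𝓡 k) x₀).source) :
    chartRep x₀ f (extChartAt (𝓡 k) x₀ x) = f x :=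
  (chartRep_eventuallyEq f hx).self_of_nhds.symm

variable [IsManifold (𝓡 k) ∞ X]

lemma contDiffAt_chartRep {x₀ : X} {f : X → W} {z : Euc k} (hz : z ∈ (extChartAt (𝓡 k) x₀).target)
    (hf : ContMDiffAt (𝓡 k) 𝓘(ℝ, W) ∞ f ((extChartAt (𝓡 k) x₀).symm z)) :
    ContDiffAt ℝ ∞ (chartRep x₀ f) z := by
  have h1 : ContMDiffAt 𝓘(ℝ, Euc k) (𝓡 k) ∞ (extChartAt (𝓡 k) x₀).symm z :=
    (contMDiffOn_extChartAt_symm x₀).contMDiffAt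
      ((isOpen_extChartAt_target x₀).mem_nhds hz)
  exact (hf.comp z h1).contDiffAt

lemma contMDiffAt_of_chartRep {x₀ x : X} {f : X → W} (hx : x ∈ (extChartAt (𝓡 k) x₀).source)
    (hf : ContDiffAt ℝ ∞ (chartRep x₀ f) (extChartAt (𝓡 k) x₀ x)) :
    ContMDiffAt (𝓡 k) 𝓘(ℝ, W) ∞ f x := by
  have h1 : ContMDiffAt (𝓡 k) 𝓘(ℝ, Euc k) ∞ (extChartAt (𝓡 k) x₀) x :=
    contMDiffAt_extChartAt' (by simpa using hx)
  exact (hf.contMDiffAt.comp x h1).congr_of_eventuallyEq (chartRep_eventuallyEq f hx)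

lemma push_eq_fderiv {x₀ x : X} {f : X → W} (hx : x ∈ (extChartAt (𝓡 k) x₀).source)
    (hf : ContMDiffAt (𝓡 k) 𝓘(ℝ, W) ∞ f x) (v : TangentSpace (𝓡 k) x) :
    push (𝓡 k) f x v =
      fderiv ℝ (chartRep x₀ f) (extChartAt (𝓡 k) x₀ x) (chartDeriv x₀ x v) := by
  rw [push_congr (chartRep_eventuallyEq f hx)]
  have hz := (extChartAt (𝓡 k) x₀).map_source hx
  have h1 : MDifferentiableAt 𝓘(ℝ, Euc k) 𝓘(ℝ, W) (chartRep x₀ f) (extChartAt (𝓡 k) x₀ x) := by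
    refine ((contDiffAt_chartRep hz ?_).differentiableAt (by simp)).mdifferentiableAt
    rwa [(extChartAt (𝓡 k) x₀).left_inv hx]
  have : IsManifold (𝓡 k) 1 X := IsManifold.of_le (n := ∞) (by simp)
  have h2 : MDifferentiableAt (𝓡 k) 𝓘(ℝ, Euc k) (extChartAt (𝓡 k) x₀) x :=
    mdifferentiableAt_extChartAt (by simpa using hx)
  have h3 := mfderiv_comp x h1 h2
  rw [mfderiv_eq_fderiv] at h3
  exact congrArg (fun A : Euc k →L[ℝ] W => A v) h3

lemma chartDeriv_self (x : X) (v : TangentSpace (𝓡 k) x) : chartDeriv x x v = v := by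
  have : IsManifold (𝓡 k) 1 X := IsManifold.of_le (n := ∞) (by simp)
  have h := mfderiv_extChartAt_self (I := 𝓡 k) (x := x)
  exact congrArg (fun A : Euc k →L[ℝ] Euc k => A v) h

lemma chartDeriv_bijective {x₀ x : X} (hx : x ∈ (extChartAt (𝓡 k) x₀).source) :
    Function.Bijective (chartDeriv (k := k) x₀ x) := by
  have : IsManifold (𝓡 k) 1 X := IsManifold.of_le (n := ∞) (by simp)
  obtain ⟨e, he⟩ := isInvertible_mfderiv_extChartAt (I := 𝓡 k) hx
  have h : ⇑(chartDeriv (k := k) x₀ x) = ⇑e := by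
    funext v
    exact congrArg (fun A : TangentSpace (𝓡 k) x →L[ℝ] Euc k => A v) he.symm
  rw [h]
  exact e.bijective

lemma fderiv_chartRep_injective {x₀ x : X} {f : X → W} (hf : ContMDiffAt (𝓡 k) 𝓘(ℝ, W) ∞ f x)
    (hinj : Function.Injective (push (𝓡 k) f x)) (hx : x ∈ (extChartAt (𝓡 k) x₀).source) :
    Function.Injective (fderiv ℝ (chartRep x₀ f) (extChartAt (𝓡 k) x₀ x)) := by
  rw [injective_iff_map_eq_zero]
  intro u hu
  obtain ⟨v, rfl⟩ := (chartDeriv_bijective (k := k) hx).2 u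
  rw [← push_eq_fderiv hx hf] at hu
  rw [hinj (hu.trans (map_zero _).symm), map_zero]

/-- The differential of the inverse chart, at the point with coordinates `z`. -/
lemma push_mfderiv_symm {x₀ : X} {f : X → W} {z : Euc k} (hz : z ∈ (extChartAt (𝓡 k) x₀).target)
    (hf : ContMDiffAt (𝓡 k) 𝓘(ℝ, W) ∞ f ((extChartAt (𝓡 k) x₀).symm z)) (u : Euc k) :
    push (𝓡 k) f ((extChartAt (𝓡 k) x₀).symm z)
      (mfderiv 𝓘(ℝ, Euc k) (𝓡 k) (extChartAt (𝓡 k) x₀).symm z u) =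
      fderiv ℝ (chartRep x₀ f) z u := by
  have h1 : ContMDiffAt 𝓘(ℝ, Euc k) (𝓡 k) ∞ (extChartAt (𝓡 k) x₀).symm z :=
    (contMDiffOn_extChartAt_symm x₀).contMDiffAt
      ((isOpen_extChartAt_target x₀).mem_nhds hz)
  have h3 := mfderiv_comp z (hf.mdifferentiableAt (by simp)) (h1.mdifferentiableAt (by simp))
  rw [← mfderiv_eq_fderiv]
  exact congrArg (fun A : Euc k →L[ℝ] W => A u) h3.symm

end Charts

/-! ### Calculus of immersed Euclidean domains -/

section LocalCalculus

variable {k N : ℕ} {W : Type*} [NormedAddCommGroup W] [NormedSpace ℝ W]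
  {Y : Type*} [NormedAddCommGroup Y] [NormedSpace ℝ Y]
  {Y' : Type*} [NormedAddCommGroup Y'] [NormedSpace ℝ Y']

lemma contDiffAt_fderiv {F : Y → W} {z : Y} (hF : ContDiffAt ℝ ∞ F z) :
    ContDiffAt ℝ ∞ (fderiv ℝ F) z :=
  hF.fderiv_right (m := ∞) (by simp)

lemma differentiableAt_of_smooth {F : Y → W} {z : Y} (hF : ContDiffAt ℝ ∞ F z) :
    DifferentiableAt ℝ F z :=
  hF.differentiableAt (by simp)

lemma eventually_differentiableAt {F : Y → W} {z : Y} (hF : ContDiffAt ℝ ∞ F z) :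
    ∀ᶠ z' in nhds z, DifferentiableAt ℝ F z' := by
  have h : ∀ᶠ z' in nhds z, ContDiffAt ℝ 1 F z' :=
    (hF.of_le (mod_cast le_top)).eventually (by simp)
  exact h.mono fun z' h => h.differentiableAt (by simp)

lemma hasFDerivAt_fderiv_apply {F : Y → W} {z : Y} (hF : ContDiffAt ℝ ∞ F z) {c : Y → Y}
    {c' : Y →L[ℝ] Y} (hc : HasFDerivAt c c' z) :
    HasFDerivAt (fun z' => fderiv ℝ F z' (c z'))
      (fderiv ℝ F z ∘L c' + (fderiv ℝ (fderiv ℝ F) z).flip (c z)) z :=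
  (differentiableAt_of_smooth (contDiffAt_fderiv hF)).hasFDerivAt.clm_apply hc

lemma fderiv_fderiv_apply_const {F : Y → W} {z : Y} (hF : ContDiffAt ℝ ∞ F z) (u v : Y) :
    fderiv ℝ (fun z' => fderiv ℝ F z' v) z u = fderiv ℝ (fderiv ℝ F) z u v := by
  rw [(hasFDerivAt_fderiv_apply hF (hasFDerivAt_const v z)).fderiv]
  simp

lemma fderiv_fderiv_symm {F : Y → W} {z : Y} (hF : ContDiffAt ℝ ∞ F z) (u v : Y) :
    fderiv ℝ (fderiv ℝ F) z u v = fderiv ℝ (fderiv ℝ F) z v u := by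
  have h2 : (2 : ℕ∞ω) ≤ ∞ := WithTop.coe_le_coe.2 (le_top : (2 : ℕ∞) ≤ ⊤)
  exact (hF.isSymmSndFDerivAt (by simpa using h2)).eq u v

/-- Second derivative of a composition. -/
lemma fderiv_fderiv_comp {G : Y' → W} {θ : Y → Y'} {z : Y}
    (hG : ContDiffAt ℝ ∞ G (θ z)) (hθ : ContDiffAt ℝ ∞ θ z) (u v : Y) :
    fderiv ℝ (fderiv ℝ (G ∘ θ)) z u v =
      fderiv ℝ (fderiv ℝ G) (θ z) (fderiv ℝ θ z u) (fderiv ℝ θ z v)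
        + fderiv ℝ G (θ z) (fderiv ℝ (fderiv ℝ θ) z u v) := by
  have hcomp := hG.comp z hθ
  rw [← fderiv_fderiv_apply_const hcomp]
  have h1 : (fun z' => fderiv ℝ (G ∘ θ) z' v) =ᶠ[nhds z]
      fun z' => (fderiv ℝ G (θ z')) (fderiv ℝ θ z' v) := by
    filter_upwards [hθ.continuousAt.eventually (eventually_differentiableAt hG),
      eventually_differentiableAt hθ] with z' h h'
    rw [fderiv_comp z' h h']
    rfl
  rw [h1.fderiv_eq]
  have hA : HasFDerivAt (fun z' => fderiv ℝ G (θ z')) _ z :=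
    (differentiableAt_of_smooth (contDiffAt_fderiv hG)).hasFDerivAt.comp z
      (differentiableAt_of_smooth hθ).hasFDerivAt
  have hB := hasFDerivAt_fderiv_apply hθ (hasFDerivAt_const v z)
  rw [(hA.clm_apply hB).fderiv]
  simp [add_comm]

/-- A vector field orthogonal to the image of `F'` satisfies the Weingarten equation. -/
lemma inner_fderiv_of_orthogonal {F : Euc k → Euc N} {z : Euc k} (hF : ContDiffAt ℝ ∞ F z)
    {ξ : Euc k → Euc N} (hξ : DifferentiableAt ℝ ξ z) (v : Euc k)
    (h : ∀ᶠ z' in nhds z, (inner ℝ (ξ z') (fderiv ℝ F z' v) : ℝ) = 0) (u : Euc k) :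
    (inner ℝ (fderiv ℝ ξ z u) (fderiv ℝ F z v) : ℝ) =
      - inner ℝ (ξ z) (fderiv ℝ (fderiv ℝ F) z u v) := by
  have h1 : (fun z' => (inner ℝ (ξ z') (fderiv ℝ F z' v) : ℝ)) =ᶠ[nhds z] fun _ => 0 := h
  have h2 := h1.fderiv_eq (𝕜 := ℝ)
  have h3 := hasFDerivAt_fderiv_apply hF (hasFDerivAt_const v z)
  have h4 := congrArg (fun A : Euc k →L[ℝ] ℝ => A u) h2
  simp only [fderiv_fun_const, Pi.zero_apply, zero_apply] at h4
  rw [fderiv_inner_apply ℝ hξ h3.differentiableAt, fderiv_fderiv_apply_const hF] at h4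
  linarith

/-- The second fundamental form of an immersion of a Euclidean domain. -/
def localSff (F : Euc k → Euc N) (z u v : Euc k) : Euc N :=
  normalProj F z (fderiv ℝ (fderiv ℝ F) z u v)

/-- The normalized mean curvature vector of an immersion of a Euclidean domain. The images
`F'⁺ εᵢ` of the standard basis of the ambient space serve in place of an orthonormal frame. -/
def localMean (F : Euc k → Euc N) (z : Euc k) : Euc N :=
  (k : ℝ)⁻¹ • ∑ i : Fin N, localSff F z
    (pseudoInverse (fderiv ℝ F z) (EuclideanSpace.basisFun (Fin N) ℝ i))
    (pseudoInverse (fderiv ℝ F z) (EuclideanSpace.basisFun (Fin N) ℝ i))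

lemma normalProj_apply {F : Euc k → Euc N} {z : Euc k} (hF : Function.Injective (fderiv ℝ F z))
    (ξ : Euc N) :
    normalProj F z ξ = ξ - fderiv ℝ F z (pseudoInverse (fderiv ℝ F z) ξ) :=
  starProjection_range_orthogonal hF ξ

lemma inner_normalProj_fderiv (F : Euc k → Euc N) (z : Euc k) (ξ : Euc N) (u : Euc k) :
    (inner ℝ (normalProj F z ξ) (fderiv ℝ F z u) : ℝ) = 0 := by
  rw [real_inner_comm]
  exact Submodule.starProjection_apply_mem (LinearMap.range (fderiv ℝ F z).toLinearMap)ᗮ ξ _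
      ⟨u, rfl⟩

/-- The projection onto the normal space is self-adjoint and fixes normal vectors. -/
lemma inner_normalProj_of_normal (F : Euc k → Euc N) (z : Euc k) (ξ : Euc N) {ζ : Euc N}
    (hζ : ∀ u, (inner ℝ ζ (fderiv ℝ F z u) : ℝ) = 0) :
    (inner ℝ (normalProj F z ξ) ζ : ℝ) = inner ℝ ξ ζ := by
  have h : ζ ∈ (LinearMap.range (fderiv ℝ F z).toLinearMap)ᗮ := by
    rintro _ ⟨u, rfl⟩
    rw [real_inner_comm]
    exact hζ u
  unfold normalProj
  rw [Submodule.inner_starProjection_left_eq_right,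
    Submodule.starProjection_eq_self_iff.2 h]

lemma contDiffAt_normalProj {F : Euc k → Euc N} {z : Euc k} (hF : ContDiffAt ℝ ∞ F z)
    (hinj : Function.Injective (fderiv ℝ F z)) {ξ : Euc k → Euc N} (hξ : ContDiffAt ℝ ∞ ξ z) :
    ContDiffAt ℝ ∞ (fun z' => normalProj F z' (ξ z')) z := by
  have hF' := contDiffAt_fderiv hF
  have h := contDiffAt_pseudoInverse hF' hinj
  refine (hξ.sub (hF'.clm_apply (h.clm_apply hξ))).congr_of_eventuallyEq ?_
  filter_upwards [eventually_injective hF'.continuousAt hinj] with z' hz'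
  exact normalProj_apply hz' _

lemma contDiffAt_localMean {F : Euc k → Euc N} {z : Euc k} (hF : ContDiffAt ℝ ∞ F z)
    (hinj : Function.Injective (fderiv ℝ F z)) : ContDiffAt ℝ ∞ (localMean F) z := by
  have hF' := contDiffAt_fderiv hF
  have hF'' := contDiffAt_fderiv hF'
  have h := contDiffAt_pseudoInverse hF' hinj
  refine (contDiffAt_const (c := (k : ℝ)⁻¹)).smul (ContDiffAt.sum fun i _ => contDiffAt_normalProj
      hF hinj ?_)
  have h1 := h.clm_apply
    (contDiffAt_const (c := EuclideanSpace.basisFun (Fin N) ℝ i))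
  exact (hF''.clm_apply h1).clm_apply h1

/-- Traces of a bilinear map: an orthonormal basis of `V` may be replaced by the image of an
orthonormal basis of `Z` under the adjoint of an isometry `V → Z`. -/
lemma sum_bilin_adjoint {ι κ V Z : Type*} [Fintype ι] [Fintype κ]
    [NormedAddCommGroup V] [InnerProductSpace ℝ V] [NormedAddCommGroup Z] [InnerProductSpace ℝ Z]
    {W : Type*} [AddCommGroup W] [Module ℝ W]
    (b : OrthonormalBasis ι ℝ V) (c : OrthonormalBasis κ ℝ Z) (A : V → Z) (a : Z → V)
    (ha : ∀ ξ v, (inner ℝ (a ξ) v : ℝ) = inner ℝ ξ (A v))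
    (hA : ∀ v w, (inner ℝ (A v) (A w) : ℝ) = inner ℝ v w) (β : V →ₗ[ℝ] V →ₗ[ℝ] W) :
    ∑ i, β (a (c i)) (a (c i)) = ∑ i, β (b i) (b i) := by
  classical
  have h1 : ∀ i, β (a (c i)) (a (c i)) =
      ∑ p, ∑ q, ((inner ℝ (A (b p)) (c i) : ℝ) * inner ℝ (c i) (A (b q))) • β (b p) (b q) := by
    intro i
    conv_lhs => rw [← b.sum_repr' (a (c i))]
    simp only [map_sum, map_smul, LinearMap.sum_apply, LinearMap.smul_apply, Finset.smul_sum,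
      smul_smul]
    rw [Finset.sum_comm]
    refine Finset.sum_congr rfl fun p _ => Finset.sum_congr rfl fun q _ => ?_
    rw [real_inner_comm (a (c i)) (b q), real_inner_comm (a (c i)) (b p), ha, ha,
      real_inner_comm (A (b p)), mul_comm]
  simp only [h1]
  rw [Finset.sum_comm]
  refine Finset.sum_congr rfl fun p _ => ?_
  rw [Finset.sum_comm, Finset.sum_eq_single p]
  · rw [← Finset.sum_smul, c.sum_inner_mul_inner, hA]
    simp
  · intro q _ hq
    rw [← Finset.sum_smul, c.sum_inner_mul_inner, hA, b.inner_eq_ite, if_neg hq.symm, zero_smul]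
  · simp

end LocalCalculus

/-! ### The second fundamental form and the mean curvature vector -/

section SecondFundamentalForm

variable {k N : ℕ} {X : Type*} [TopologicalSpace X] [ChartedSpace (Euc k) X]

lemma starProjection_congr {E : Type*} [NormedAddCommGroup E] [InnerProductSpace ℝ E]
    [FiniteDimensional ℝ E] {K K' : Submodule ℝ E} (h : K = K') (ξ : E) :
    K.starProjection ξ = K'.starProjection ξ := by
  subst h
  rfl

/-- The second derivative in the preferred chart as a bilinear map. -/
def secondDerivLin (f : X → Euc N) (x : X) :
    TangentSpace (𝓡 k) x →ₗ[ℝ] TangentSpace (𝓡 k) x →ₗ[ℝ] Euc N :=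
  LinearMap.mk₂ ℝ (secondDeriv f x) (secondDeriv_add_left f x) (secondDeriv_smul_left f x)
    (fun U V V' => map_add (fderiv ℝ (fderiv ℝ
      (f ∘ (extChartAt (𝓡 k) x).symm)) (extChartAt (𝓡 k) x x) (U : Euc k)) (V : Euc k) (V' : Euc k))
    (fun c U V => map_smul (fderiv ℝ (fderiv ℝ
      (f ∘ (extChartAt (𝓡 k) x).symm)) (extChartAt (𝓡 k) x x) (U : Euc k)) c (V : Euc k))

/-- The second fundamental form as a bilinear map. -/
def sffLin (f : X → Euc N) (x : X) :
    TangentSpace (𝓡 k) x →ₗ[ℝ] TangentSpace (𝓡 k) x →ₗ[ℝ] Euc N :=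
  (secondDerivLin f x).compr₂ (normalSpace k f x).starProjection.toLinearMap

lemma sffLin_apply (f : X → Euc N) (x : X) (U V : TangentSpace (𝓡 k) x) :
    sffLin f x U V = sff f x U V := rfl

lemma mem_normalSpace {f : X → Euc N} {x : X} {ξ : Euc N} :
    ξ ∈ normalSpace k f x ↔ ∀ v, (inner ℝ ξ (push (𝓡 k) f x v) : ℝ) = 0 := by
  constructor
  · intro h v
    rw [real_inner_comm]
    exact h _ ⟨v, rfl⟩
  · rintro h _ ⟨v, rfl⟩
    rw [real_inner_comm]
    exact h v

lemma sff_mem_normalSpace (f : X → Euc N) (x : X) (U V : TangentSpace (𝓡 k) x) :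
    sff f x U V ∈ normalSpace k f x :=
  Submodule.starProjection_apply_mem _ _

lemma inner_sff {f : X → Euc N} {x : X} (U V : TangentSpace (𝓡 k) x) {ζ : Euc N}
    (hζ : ζ ∈ normalSpace k f x) :
    (inner ℝ (sff f x U V) ζ : ℝ) = inner ℝ (secondDeriv f x U V) ζ := by
  unfold sff
  rw [Submodule.inner_starProjection_left_eq_right, Submodule.starProjection_eq_self_iff.2 hζ]

variable [IsManifold (𝓡 k) ∞ X]

/-- The second derivative in terms of the chart representative. The vectors are written as
`chartDeriv x x U`, which is `U` read in the model space. -/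
lemma secondDeriv_eq (f : X → Euc N) (x : X) (U V : TangentSpace (𝓡 k) x) :
    secondDeriv f x U V = fderiv ℝ (fderiv ℝ (chartRep x f)) (extChartAt (𝓡 k) x x)
      (chartDeriv x x U) (chartDeriv x x V) := by
  rw [chartDeriv_self, chartDeriv_self]
  rfl

lemma secondDeriv_symm {f : X → Euc N} {x : X} (hf : ContMDiffAt (𝓡 k) 𝓘(ℝ, Euc N) ∞ f x)
    (U V : TangentSpace (𝓡 k) x) : secondDeriv f x U V = secondDeriv f x V U := by
  have hF : ContDiffAt ℝ ∞ (chartRep x f) (extChartAt (𝓡 k) x x) := by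
    refine contDiffAt_chartRep (mem_extChartAt_target x) ?_
    rwa [extChartAt_to_inv]
  rw [secondDeriv_eq, secondDeriv_eq, fderiv_fderiv_symm hF]

lemma sff_symm {f : X → Euc N} {x : X} (hf : ContMDiffAt (𝓡 k) 𝓘(ℝ, Euc N) ∞ f x)
    (U V : TangentSpace (𝓡 k) x) : sff f x U V = sff f x V U := by
  unfold sff
  rw [secondDeriv_symm hf]

lemma contDiffAt_chartRep_apply {x₀ x : X} {W : Type*} [NormedAddCommGroup W] [NormedSpace ℝ W]
    {f : X → W} (hx : x ∈ (extChartAt (𝓡 k) x₀).source)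
    (hf : ContMDiffAt (𝓡 k) 𝓘(ℝ, W) ∞ f x) :
    ContDiffAt ℝ ∞ (chartRep x₀ f) (extChartAt (𝓡 k) x₀ x) := by
  refine contDiffAt_chartRep ((extChartAt (𝓡 k) x₀).map_source hx) ?_
  rwa [(extChartAt (𝓡 k) x₀).left_inv hx]

lemma tangentImage_eq {x₀ x : X} {f : X → Euc N} (hx : x ∈ (extChartAt (𝓡 k) x₀).source)
    (hf : ContMDiffAt (𝓡 k) 𝓘(ℝ, Euc N) ∞ f x) :
    tangentImage k f x =
      LinearMap.range (fderiv ℝ (chartRep x₀ f) (extChartAt (𝓡 k) x₀ x)).toLinearMap := by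
  ext ξ
  constructor
  · rintro ⟨v, rfl⟩
    exact ⟨chartDeriv x₀ x v, (push_eq_fderiv hx hf v).symm⟩
  · rintro ⟨u, rfl⟩
    obtain ⟨v, rfl⟩ := (chartDeriv_bijective (k := k) hx).2 u
    exact ⟨v, push_eq_fderiv hx hf v⟩

/-- The second fundamental form may be computed in any chart: a change of chart alters the second
derivative by a tangent vector. -/
lemma sff_eq_localSff {x₀ x : X} {f : X → Euc N} (hx : x ∈ (extChartAt (𝓡 k) x₀).source)
    (hf : ContMDiffAt (𝓡 k) 𝓘(ℝ, Euc N) ∞ f x) (U V : TangentSpace (𝓡 k) x) :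
    sff f x U V = localSff (chartRep x₀ f) (extChartAt (𝓡 k) x₀ x) (chartDeriv x₀ x U)
      (chartDeriv x₀ x V) := by
  have hφ : ContMDiffAt (𝓡 k) 𝓘(ℝ, Euc k) ∞ (extChartAt (𝓡 k) x₀) x :=
    contMDiffAt_extChartAt' (by simpa using hx)
  set θ : Euc k → Euc k := chartRep x (extChartAt (𝓡 k) x₀) with hθdef
  set z : Euc k := extChartAt (𝓡 k) x x with hz
  have hθz : θ z = extChartAt (𝓡 k) x₀ x := chartRep_apply _ (mem_extChartAt_source x)
  have hθ : ContDiffAt ℝ ∞ θ z := contDiffAt_chartRep_apply (mem_extChartAt_source x) hφ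
  have hF : ContDiffAt ℝ ∞ (chartRep x₀ f) (θ z) := by
    rw [hθz]
    exact contDiffAt_chartRep_apply hx hf
  have hcong : chartRep x f =ᶠ[nhds z] chartRep x₀ f ∘ θ := by
    have h1 : ContinuousAt (extChartAt (𝓡 k) x).symm z := continuousAt_extChartAt_symm x
    have h2 : (extChartAt (𝓡 k) x).symm z = x := extChartAt_to_inv x
    have h3 : ∀ᶠ y in nhds ((extChartAt (𝓡 k) x).symm z),
        f y = chartRep x₀ f (extChartAt (𝓡 k) x₀ y) := by
      rw [h2]
      exact chartRep_eventuallyEq f hx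
    exact h1.eventually h3
  have hD : ∀ u : TangentSpace (𝓡 k) x, chartDeriv x₀ x u = fderiv ℝ θ z (chartDeriv x x u) :=
    fun u => push_eq_fderiv (mem_extChartAt_source (I := 𝓡 k) x) hφ u
  have hsecond : secondDeriv f x U V =
      fderiv ℝ (fderiv ℝ (chartRep x₀ f)) (θ z) (chartDeriv x₀ x U) (chartDeriv x₀ x V)
        + fderiv ℝ (chartRep x₀ f) (θ z)
          (fderiv ℝ (fderiv ℝ θ) z (chartDeriv x x U) (chartDeriv x x V)) := by
    rw [hD, hD, ← fderiv_fderiv_comp hF hθ, secondDeriv_eq, hcong.fderiv.fderiv_eq]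
  have hproj : sff f x U V = normalProj (chartRep x₀ f) (extChartAt (𝓡 k) x₀ x)
      (secondDeriv f x U V) := by
    refine starProjection_congr ?_ _
    rw [normalSpace, tangentImage_eq hx hf]
  unfold localSff
  rw [hproj, hsecond, map_add, hθz]
  conv_rhs => rw [← add_zero (normalProj _ _ _)]
  congr 1
  unfold normalProj
  rw [Submodule.starProjection_apply_eq_zero_iff]
  rintro w hw
  rw [real_inner_comm]
  exact hw _ ⟨_, rfl⟩

/-- The Weingarten equation for a normal field `ξ`. -/
lemma inner_push_of_normal {x : X} {f ξ : X → Euc N} (hf : ContMDiffAt (𝓡 k) 𝓘(ℝ, Euc N) ∞ f x)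
    (hξ : ContMDiffAt (𝓡 k) 𝓘(ℝ, Euc N) ∞ ξ x)
    (h : ∀ᶠ y in nhds x, ContMDiffAt (𝓡 k) 𝓘(ℝ, Euc N) ∞ f y ∧ ξ y ∈ normalSpace k f y)
    (U V : TangentSpace (𝓡 k) x) :
    (inner ℝ (push (𝓡 k) ξ x U) (push (𝓡 k) f x V) : ℝ) = - inner ℝ (ξ x) (secondDeriv f x U V) :=
        by
  have hx := mem_extChartAt_source (I := 𝓡 k) x
  rw [push_eq_fderiv hx hξ, push_eq_fderiv hx hf, inner_fderiv_of_orthogonal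
      (contDiffAt_chartRep_apply hx hf)
      (differentiableAt_of_smooth (contDiffAt_chartRep_apply hx hξ)), chartRep_apply ξ hx,
    secondDeriv_eq]
  · have h1 : ContinuousAt (extChartAt (𝓡 k) x).symm (extChartAt (𝓡 k) x x) :=
      continuousAt_extChartAt_symm x
    rw [← extChartAt_to_inv (I := 𝓡 k) x] at h
    filter_upwards [h1.eventually h, extChartAt_target_mem_nhds (I := 𝓡 k) x] with z hz hz'
    have h2 := mem_normalSpace.1 hz.2
      (mfderiv 𝓘(ℝ, Euc k) (𝓡 k) (extChartAt (𝓡 k) x).symm z (chartDeriv x x V))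
    rw [push_mfderiv_symm hz' hz.1] at h2
    exact h2

end SecondFundamentalForm

section MeanCurvature

variable {n N : ℕ} {M : Type*} [TopologicalSpace M] [ChartedSpace (Euc n) M]
  [RiemannianBundle (fun x : M => TangentSpace (𝓡 n) x)]

lemma IsIsometricImmersion.push_injective {f : M → Euc N} (hf : IsIsometricImmersion n f) (x : M) :
    Function.Injective (push (𝓡 n) f x) := by
  rw [injective_iff_map_eq_zero]
  intro v hv
  have h := hf.isometric x v v
  rw [hv, inner_zero_left] at h
  exact inner_self_eq_zero.1 h.symm

lemma meanCurvatureVector_mem_normalSpace (f : M → Euc N) (x : M) :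
    meanCurvatureVector n f x ∈ normalSpace n f x :=
  Submodule.smul_mem _ _ (Submodule.sum_mem _ fun _ _ => sff_mem_normalSpace f x _ _)

variable [IsManifold (𝓡 n) ∞ M]

lemma IsIsometricImmersion.fderiv_injective {f : M → Euc N} (hf : IsIsometricImmersion n f)
    {x₀ x : M} (hx : x ∈ (extChartAt (𝓡 n) x₀).source) :
    Function.Injective (fderiv ℝ (chartRep x₀ f) (extChartAt (𝓡 n) x₀ x)) :=
  fderiv_chartRep_injective hf.smooth.contMDiffAt (hf.push_injective x) hx

lemma meanCurvatureVector_eq_localMean {f : M → Euc N} (hf : IsIsometricImmersion n f)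
    {x₀ x : M} (hx : x ∈ (extChartAt (𝓡 n) x₀).source) :
    meanCurvatureVector n f x = localMean (chartRep x₀ f) (extChartAt (𝓡 n) x₀ x) := by
  have hfx := hf.smooth.contMDiffAt (x := x)
  have hinj := hf.fderiv_injective hx
  set z := extChartAt (𝓡 n) x₀ x
  set A := fderiv ℝ (chartRep x₀ f) z
  have hsurj := (chartDeriv_bijective (k := n) hx).2
  choose s hs using hsurj
  unfold meanCurvatureVector localMean
  congr 1
  have h := sum_bilin_adjoint (tangentBasis n x) (EuclideanSpace.basisFun (Fin N) ℝ)
    (push (𝓡 n) f x) (fun ξ => s (pseudoInverse A ξ)) ?_ (hf.isometric x) (sffLin f x)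
  · simp only [sffLin_apply] at h
    rw [← h]
    refine Finset.sum_congr rfl fun i _ => ?_
    rw [sff_eq_localSff hx hfx, hs]
  · intro ξ v
    rw [← hf.isometric x, push_eq_fderiv hx hfx, push_eq_fderiv hx hfx, hs]
    exact inner_apply_pseudoInverse hinj _ _

lemma contMDiff_meanCurvatureVector {f : M → Euc N} (hf : IsIsometricImmersion n f) :
    ContMDiff (𝓡 n) 𝓘(ℝ, Euc N) ∞ (meanCurvatureVector n f) := by
  intro x
  have hx := mem_extChartAt_source (I := 𝓡 n) x
  have h1 := contDiffAt_localMean (contDiffAt_chartRep_apply hx hf.smooth.contMDiffAt)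
    (hf.fderiv_injective hx)
  refine contMDiffAt_of_chartRep hx (h1.congr_of_eventuallyEq ?_)
  filter_upwards [extChartAt_target_mem_nhds (I := 𝓡 n) x] with z hz
  have := meanCurvatureVector_eq_localMean hf ((extChartAt (𝓡 n) x).map_target hz)
  rw [(extChartAt (𝓡 n) x).right_inv hz] at this
  exact this

end MeanCurvature

/-! ### The Gauss and Ricci equations -/

section GaussRicci

variable {k N : ℕ}

lemma eq_of_inner_apply {A : Euc k →L[ℝ] Euc N} (hA : Function.Injective A) {a b : Euc k}
    (h : ∀ y, (inner ℝ (A a) (A y) : ℝ) = inner ℝ (A b) (A y)) : a = b := by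
  apply hA
  rw [← sub_eq_zero, ← inner_self_eq_zero (𝕜 := ℝ), inner_sub_left, ← map_sub, h, sub_self]

lemma localSff_eq {F : Euc k → Euc N} {z : Euc k} (hinj : Function.Injective (fderiv ℝ F z))
    (u v : Euc k) : localSff F z u v = fderiv ℝ (fderiv ℝ F) z u v -
      fderiv ℝ F z (pseudoInverse (fderiv ℝ F z) (fderiv ℝ (fderiv ℝ F) z u v)) :=
  normalProj_apply hinj _

lemma contDiffAt_fderiv_fderiv_apply {F : Euc k → Euc N} {z : Euc k} (hF : ContDiffAt ℝ ∞ F z)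
    (u v : Euc k) : ContDiffAt ℝ ∞ (fun z' => fderiv ℝ (fderiv ℝ F) z' u v) z :=
  ((contDiffAt_fderiv (contDiffAt_fderiv hF)).clm_apply contDiffAt_const).clm_apply
    contDiffAt_const

/-- Third derivatives are symmetric in the first two arguments. -/
lemma fderiv_fderiv_fderiv_symm {F : Euc k → Euc N} {z : Euc k} (hF : ContDiffAt ℝ ∞ F z)
    (u v w : Euc k) :
    fderiv ℝ (fun z' => fderiv ℝ (fderiv ℝ F) z' v w) z u =
      fderiv ℝ (fun z' => fderiv ℝ (fderiv ℝ F) z' u w) z v := by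
  have hF1 := contDiffAt_fderiv hF
  have hF2 := contDiffAt_fderiv hF1
  have key : ∀ a b : Euc k, fderiv ℝ (fun z' => fderiv ℝ (fderiv ℝ F) z' a w) z b =
      fderiv ℝ (fderiv ℝ (fderiv ℝ F)) z b a w := by
    intro a b
    have h := ((differentiableAt_of_smooth hF2).hasFDerivAt.clm_apply
      (hasFDerivAt_const a z)).clm_apply (hasFDerivAt_const w z)
    rw [h.fderiv]
    simp
  rw [key, key, fderiv_fderiv_symm hF1]

/-- The tangential component of `∇_u Γ(v, w)`: differentiate
`F' Γ(v, w) = D²F(v, w) - α(v, w)`. -/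
lemma inner_fderiv_christoffel {F : Euc k → Euc N} {z : Euc k} (hF : ContDiffAt ℝ ∞ F z)
    (hinj : Function.Injective (fderiv ℝ F z)) {Γ : Euc k → Euc k → Euc k → Euc k}
    (hΓ : ∀ᶠ z' in nhds z, ∀ u v, Γ z' u v =
      pseudoInverse (fderiv ℝ F z') (fderiv ℝ (fderiv ℝ F) z' u v)) (u v w y : Euc k) :
    (inner ℝ (fderiv ℝ F z (fderiv ℝ (fun z' => Γ z' v w) z u + Γ z u (Γ z v w)))
      (fderiv ℝ F z y) : ℝ) =
    inner ℝ (fderiv ℝ (fun z' => fderiv ℝ (fderiv ℝ F) z' v w) z u) (fderiv ℝ F z y)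
      + inner ℝ (localSff F z v w) (localSff F z u y) := by
  have hF1 := contDiffAt_fderiv hF
  have hinj' := eventually_injective hF1.continuousAt hinj
  have hS := contDiffAt_fderiv_fderiv_apply hF v w
  have hΓs : ContDiffAt ℝ ∞ (fun z' => Γ z' v w) z :=
    ((contDiffAt_pseudoInverse hF1 hinj).clm_apply hS).congr_of_eventuallyEq
      (hΓ.mono fun z' h => h v w)
  have hα : ContDiffAt ℝ ∞ (fun z' => localSff F z' v w) z := contDiffAt_normalProj hF hinj hS
  have hsum : (fun z' => fderiv ℝ F z' (Γ z' v w) + localSff F z' v w) =ᶠ[nhds z]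
      fun z' => fderiv ℝ (fderiv ℝ F) z' v w := by
    filter_upwards [hΓ, hinj'] with z' h1 h2
    rw [localSff_eq h2, h1]
    abel
  have h1 := hasFDerivAt_fderiv_apply hF (differentiableAt_of_smooth hΓs).hasFDerivAt
  have h2 := h1.add (differentiableAt_of_smooth hα).hasFDerivAt
  have h3 := h2.fderiv.symm.trans hsum.fderiv_eq
  have h4 := congrArg (fun A : Euc k →L[ℝ] Euc N => (inner ℝ (A u) (fderiv ℝ F z y) : ℝ)) h3
  simp only [add_apply, ContinuousLinearMap.comp_apply, ContinuousLinearMap.flip_apply,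
    inner_add_left] at h4
  have h5 := inner_fderiv_of_orthogonal hF (differentiableAt_of_smooth hα) y
    (Filter.Eventually.of_forall fun z' => inner_normalProj_fderiv F z' _ y) u
  have h6 : (inner ℝ (localSff F z v w) (localSff F z u y) : ℝ) =
      inner ℝ (localSff F z v w) (fderiv ℝ (fderiv ℝ F) z u y) := by
    rw [real_inner_comm]
    exact (inner_normalProj_of_normal F z _
      (fun u => inner_normalProj_fderiv F z _ u)).trans (real_inner_comm _ _)
  have h7 : (inner ℝ (fderiv ℝ F z (Γ z u (Γ z v w))) (fderiv ℝ F z y) : ℝ) =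
      inner ℝ (fderiv ℝ (fderiv ℝ F) z u (Γ z v w)) (fderiv ℝ F z y) := by
    rw [hΓ.self_of_nhds, inner_apply_pseudoInverse hinj]
  rw [map_add, inner_add_left, h7, h6]
  linarith

/-- The Ricci equation in a Euclidean domain; `a` and `b` are `A_ξ v` and `A_ξ u`. If `ν` extends
`ξ` to a normal field, then `∇^⊥_v ν = ν'(v) + F'(A_ν v)`, and the second derivatives of `ν`
cancel. -/
lemma inner_normalDeriv_comm {F : Euc k → Euc N} {z : Euc k} (hF : ContDiffAt ℝ ∞ F z)
    (hinj : Function.Injective (fderiv ℝ F z)) {ξ ζ : Euc N}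
    (hξ : ∀ u, (inner ℝ ξ (fderiv ℝ F z u) : ℝ) = 0)
    (hζ : ∀ u, (inner ℝ ζ (fderiv ℝ F z u) : ℝ) = 0) (u v a b : Euc k)
    (ha : ∀ y, (inner ℝ (fderiv ℝ F z a) (fderiv ℝ F z y) : ℝ) = inner ℝ (localSff F z v y) ξ)
    (hb : ∀ y, (inner ℝ (fderiv ℝ F z b) (fderiv ℝ F z y) : ℝ) = inner ℝ (localSff F z u y) ξ) :
    (inner ℝ (normalDeriv F u (normalDeriv F v fun z' => normalProj F z' ξ) z
      - normalDeriv F v (normalDeriv F u fun z' => normalProj F z' ξ) z) ζ : ℝ) =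
    inner ℝ (localSff F z u a - localSff F z v b) ζ := by
  have hF1 := contDiffAt_fderiv hF
  have hinj' := eventually_injective hF1.continuousAt hinj
  set ν : Euc k → Euc N := fun z' => normalProj F z' ξ with hν
  have hνs : ContDiffAt ℝ ∞ ν z := contDiffAt_normalProj hF hinj contDiffAt_const
  have hνz : ν z = ξ := by
    have h : ξ ∈ (LinearMap.range (fderiv ℝ F z).toLinearMap)ᗮ := by
      rintro _ ⟨u, rfl⟩
      rw [real_inner_comm]
      exact hξ u
    exact Submodule.starProjection_eq_self_iff.2 h
  have key : ∀ u v a : Euc k,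
      (∀ y, (inner ℝ (fderiv ℝ F z a) (fderiv ℝ F z y) : ℝ) = inner ℝ (localSff F z v y) ξ) →
      (inner ℝ (normalDeriv F u (normalDeriv F v ν) z) ζ : ℝ) =
        inner ℝ (fderiv ℝ (fderiv ℝ ν) z u v) ζ + inner ℝ (localSff F z u a) ζ := by
    intro u v a ha
    have hDν : ContDiffAt ℝ ∞ (fun z' => fderiv ℝ ν z' v) z :=
      (contDiffAt_fderiv hνs).clm_apply contDiffAt_const
    have hc : ContDiffAt ℝ ∞ (fun z' => pseudoInverse (fderiv ℝ F z') (fderiv ℝ ν z' v)) z :=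
      (contDiffAt_pseudoInverse hF1 hinj).clm_apply hDν
    have heq : normalDeriv F v ν =ᶠ[nhds z] fun z' => fderiv ℝ ν z' v -
        fderiv ℝ F z' (pseudoInverse (fderiv ℝ F z') (fderiv ℝ ν z' v)) := by
      filter_upwards [hinj'] with z' h
      exact normalProj_apply h _
    have hca : pseudoInverse (fderiv ℝ F z) (fderiv ℝ ν z v) = -a := by
      refine eq_of_inner_apply hinj fun y => ?_
      rw [map_neg, inner_neg_left, inner_apply_pseudoInverse hinj, ha,
        inner_fderiv_of_orthogonal hF (differentiableAt_of_smooth hνs) y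
        (Filter.Eventually.of_forall fun z' => inner_normalProj_fderiv F z' _ y), hνz, localSff,
        inner_normalProj_of_normal _ _ _ hξ, real_inner_comm]
    have h1 := hasFDerivAt_fderiv_apply hF (differentiableAt_of_smooth hc).hasFDerivAt
    have h2 := (differentiableAt_of_smooth hDν).hasFDerivAt.sub h1
    have h3 := heq.fderiv_eq.trans h2.fderiv
    have h4 := congrArg (fun A : Euc k →L[ℝ] Euc N => (inner ℝ (A u) ζ : ℝ)) h3
    simp only [add_apply, sub_apply, ContinuousLinearMap.comp_apply,
      ContinuousLinearMap.flip_apply, inner_add_left, inner_sub_left] at h4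
    rw [hca, map_neg, inner_neg_left, real_inner_comm ζ (fderiv ℝ F z _), hζ,
      fderiv_fderiv_apply_const hνs] at h4
    rw [localSff, inner_normalProj_of_normal _ _ _ hζ, normalDeriv,
      inner_normalProj_of_normal _ _ _ hζ, h4]
    ring
  rw [inner_sub_left, inner_sub_left, key u v a ha, key v u b hb, fderiv_fderiv_symm hνs]
  ring

end GaussRicci

lemma rieszVector_eq {V : Type*} [Zero V] {B : V → V → ℝ} {ℓ : V → ℝ} {a : V}
    (ha : ∀ w, B a w = ℓ w) (huniq : ∀ a', (∀ w, B a' w = ℓ w) → a' = a) :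
    rieszVector B ℓ = a := by
  have h : ∃ a : V, ∀ w : V, B a w = ℓ w := ⟨a, ha⟩
  unfold rieszVector
  rw [dif_pos h]
  exact huniq _ h.choose_spec

section GaussRicciManifold

variable {n N : ℕ} {M : Type*} [TopologicalSpace M] [ChartedSpace (Euc n) M]
  [RiemannianBundle (fun x : M => TangentSpace (𝓡 n) x)] [IsManifold (𝓡 n) ∞ M]

lemma chartMetric_eq {f : M → Euc N} (hf : IsIsometricImmersion n f) {x : M} {z : Euc n}
    (hz : z ∈ (extChartAt (𝓡 n) x).target) (u v : Euc n) :
    chartMetric x z u v =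
      inner ℝ (fderiv ℝ (chartRep x f) z u) (fderiv ℝ (chartRep x f) z v) := by
  rw [← push_mfderiv_symm hz hf.smooth.contMDiffAt, ← push_mfderiv_symm hz hf.smooth.contMDiffAt,
    hf.isometric]
  rfl

lemma IsIsometricImmersion.contDiffAt_rep {f : M → Euc N} (hf : IsIsometricImmersion n f) {x : M}
    {z : Euc n} (hz : z ∈ (extChartAt (𝓡 n) x).target) : ContDiffAt ℝ ∞ (chartRep x f) z :=
  contDiffAt_chartRep hz hf.smooth.contMDiffAt

lemma IsIsometricImmersion.fderiv_rep_injective {f : M → Euc N} (hf : IsIsometricImmersion n f)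
    {x : M} {z : Euc n} (hz : z ∈ (extChartAt (𝓡 n) x).target) :
    Function.Injective (fderiv ℝ (chartRep x f) z) := by
  have := hf.fderiv_injective ((extChartAt (𝓡 n) x).map_target hz)
  rwa [(extChartAt (𝓡 n) x).right_inv hz] at this

/-- The Christoffel symbols are the tangential component of the second derivative: evaluate the
Koszul formula for the metric induced by `f`. -/
lemma christoffel_eq {f : M → Euc N} (hf : IsIsometricImmersion n f) {x : M} {z : Euc n}
    (hz : z ∈ (extChartAt (𝓡 n) x).target) (u v : Euc n) :
    christoffel x z u v = pseudoInverse (fderiv ℝ (chartRep x f) z)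
      (fderiv ℝ (fderiv ℝ (chartRep x f)) z u v) := by
  have hF := hf.contDiffAt_rep hz
  have hinj := hf.fderiv_rep_injective hz
  have hder : ∀ p q r : Euc n, fderiv ℝ (fun z' => chartMetric x z' p q) z r =
      inner ℝ (fderiv ℝ (chartRep x f) z p) (fderiv ℝ (fderiv ℝ (chartRep x f)) z r q) +
      inner ℝ (fderiv ℝ (fderiv ℝ (chartRep x f)) z r p) (fderiv ℝ (chartRep x f) z q) := by
    intro p q r
    have h1 : (fun z' => chartMetric x z' p q) =ᶠ[nhds z] fun z' =>
        inner ℝ (fderiv ℝ (chartRep x f) z' p) (fderiv ℝ (chartRep x f) z' q) := by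
      filter_upwards [(isOpen_extChartAt_target x).mem_nhds hz] with z' hz'
      exact chartMetric_eq hf hz' p q
    rw [h1.fderiv_eq, fderiv_inner_apply ℝ
      (hasFDerivAt_fderiv_apply hF (hasFDerivAt_const p z)).differentiableAt
      (hasFDerivAt_fderiv_apply hF (hasFDerivAt_const q z)).differentiableAt,
      fderiv_fderiv_apply_const hF, fderiv_fderiv_apply_const hF]
  have hval : ∀ w, (fderiv ℝ (fun z' => chartMetric x z' v w) z u
      + fderiv ℝ (fun z' => chartMetric x z' u w) z v
      - fderiv ℝ (fun z' => chartMetric x z' u v) z w) / 2 =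
      inner ℝ (fderiv ℝ (fderiv ℝ (chartRep x f)) z u v) (fderiv ℝ (chartRep x f) z w) := by
    intro w
    rw [hder, hder, hder, fderiv_fderiv_symm hF v u, fderiv_fderiv_symm hF w u,
      fderiv_fderiv_symm hF w v, real_inner_comm (fderiv ℝ (chartRep x f) z v)]
    ring
  have hB : ∀ w, chartMetric x z (pseudoInverse (fderiv ℝ (chartRep x f) z)
      (fderiv ℝ (fderiv ℝ (chartRep x f)) z u v)) w =
      inner ℝ (fderiv ℝ (fderiv ℝ (chartRep x f)) z u v) (fderiv ℝ (chartRep x f) z w) := by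
    intro w
    rw [chartMetric_eq hf hz, inner_apply_pseudoInverse hinj]
  refine rieszVector_eq (fun w => (hB w).trans (hval w).symm) fun a' ha' => ?_
  refine eq_of_inner_apply hinj fun w => ?_
  rw [← chartMetric_eq hf hz, ← chartMetric_eq hf hz, ha', hval, hB]

/-- The curvature tensor read in the model space. -/
lemma chartDeriv_curvature (x : M) (X Y Z : TangentSpace (𝓡 n) x) :
    chartDeriv (k := n) x x (curvature x X Y Z) =
      (fderiv ℝ (fun z' => christoffel x z' (chartDeriv (k := n) x x Y) (chartDeriv (k := n) x x Z))
          (extChartAt (𝓡 n) x x) (chartDeriv (k := n) x x X)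
        + christoffel x (extChartAt (𝓡 n) x x) (chartDeriv (k := n) x x X)
          (christoffel x (extChartAt (𝓡 n) x x) (chartDeriv (k := n) x x Y)
              (chartDeriv (k := n) x x Z)))
      - (fderiv ℝ (fun z' => christoffel x z' (chartDeriv (k := n) x x X)
          (chartDeriv (k := n) x x Z))
          (extChartAt (𝓡 n) x x) (chartDeriv (k := n) x x Y)
        + christoffel x (extChartAt (𝓡 n) x x) (chartDeriv (k := n) x x Y)
          (christoffel x (extChartAt (𝓡 n) x x) (chartDeriv (k := n) x x X)
              (chartDeriv (k := n) x x Z))) := by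
  simp only [chartDeriv_self]
  rw [add_sub_add_comm, ← add_sub_assoc]
  rfl

/-- The Gauss equation. -/
lemma inner_curvature {f : M → Euc N} (hf : IsIsometricImmersion n f) (x : M)
    (X Y Z W : TangentSpace (𝓡 n) x) :
    (inner ℝ (curvature x X Y Z) W : ℝ) =
      inner ℝ (sff f x Y Z) (sff f x X W) - inner ℝ (sff f x X Z) (sff f x Y W) := by
  have hx := mem_extChartAt_source (I := 𝓡 n) x
  have hfx := hf.smooth.contMDiffAt (x := x)
  have hF := contDiffAt_chartRep_apply hx hfx
  have hinj := hf.fderiv_injective hx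
  have hΓ : ∀ᶠ z' in nhds (extChartAt (𝓡 n) x x), ∀ u v, christoffel x z' u v =
      pseudoInverse (fderiv ℝ (chartRep x f) z') (fderiv ℝ (fderiv ℝ (chartRep x f)) z' u v) := by
    filter_upwards [extChartAt_target_mem_nhds (I := 𝓡 n) x] with z' hz' u v
    exact christoffel_eq hf hz' u v
  rw [← hf.isometric, push_eq_fderiv hx hfx, push_eq_fderiv hx hfx, chartDeriv_curvature, map_sub,
    inner_sub_left, inner_fderiv_christoffel hF hinj hΓ, inner_fderiv_christoffel hF hinj hΓ,
    fderiv_fderiv_fderiv_symm hF]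
  simp only [sff_eq_localSff hx hfx]
  ring

/-- The Ricci equation; `A` and `B` are `A_ξ Y` and `A_ξ X`. -/
lemma normalCurvature_eq {f : M → Euc N} (hf : IsIsometricImmersion n f) (x : M)
    (X Y A B : TangentSpace (𝓡 n) x) {ξ : Euc N} (hξ : ξ ∈ normalSpace n f x)
    (hA : ∀ Z, (inner ℝ A Z : ℝ) = inner ℝ (sff f x Y Z) ξ)
    (hB : ∀ Z, (inner ℝ B Z : ℝ) = inner ℝ (sff f x X Z) ξ) :
    normalCurvature f x X Y ξ = sff f x X A - sff f x Y B := by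
  have hx := mem_extChartAt_source (I := 𝓡 n) x
  have hfx := hf.smooth.contMDiffAt (x := x)
  have hF := contDiffAt_chartRep_apply hx hfx
  have hinj := hf.fderiv_injective hx
  set F := chartRep (k := n) x f
  set z := extChartAt (𝓡 n) x x
  have hdef : normalCurvature f x X Y ξ =
      normalDeriv F (chartDeriv (k := n) x x X) (normalDeriv F (chartDeriv (k := n) x x Y)
        fun z' => normalProj F z' ξ) z
      - normalDeriv F (chartDeriv (k := n) x x Y) (normalDeriv F (chartDeriv (k := n) x x X)
        fun z' => normalProj F z' ξ) z := by
    simp only [chartDeriv_self]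
    rfl
  have hnormal : ∀ ζ : Euc N, ζ ∈ normalSpace n f x → ∀ u,
      (inner ℝ ζ (fderiv ℝ F z u) : ℝ) = 0 := by
    intro ζ hζ u
    obtain ⟨v, rfl⟩ := (chartDeriv_bijective (k := n) hx).2 u
    rw [← push_eq_fderiv hx hfx]
    exact mem_normalSpace.1 hζ v
  have hconv : ∀ P Q : TangentSpace (𝓡 n) x, (∀ Z, (inner ℝ P Z : ℝ) = inner ℝ (sff f x Q Z) ξ) →
      ∀ y, (inner ℝ (fderiv ℝ F z (chartDeriv (k := n) x x P)) (fderiv ℝ F z y) : ℝ) =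
        inner ℝ (localSff F z (chartDeriv (k := n) x x Q) y) ξ := by
    intro P Q h y
    obtain ⟨v, rfl⟩ := (chartDeriv_bijective (k := n) hx).2 y
    rw [← push_eq_fderiv hx hfx, ← push_eq_fderiv hx hfx, hf.isometric, h, sff_eq_localSff hx hfx]
  have hmem1 : normalCurvature f x X Y ξ ∈ normalSpace n f x := by
    rw [mem_normalSpace]
    intro v
    rw [hdef, push_eq_fderiv hx hfx, inner_sub_left, normalDeriv, normalDeriv,
      inner_normalProj_fderiv, inner_normalProj_fderiv, sub_zero]
  have hmem2 : sff f x X A - sff f x Y B ∈ normalSpace n f x :=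
    Submodule.sub_mem _ (sff_mem_normalSpace _ _ _ _) (sff_mem_normalSpace _ _ _ _)
  have hmem := Submodule.sub_mem _ hmem1 hmem2
  rw [← sub_eq_zero, ← inner_self_eq_zero (𝕜 := ℝ)]
  conv_lhs => rw [inner_sub_left]
  have h := inner_normalDeriv_comm hF hinj (hnormal ξ hξ) (hnormal _ hmem)
      (chartDeriv (k := n) x x X)
    (chartDeriv (k := n) x x Y) (chartDeriv (k := n) x x A) (chartDeriv (k := n) x x B)
        (hconv A Y hA) (hconv B X hB)
  rw [← hdef, ← sff_eq_localSff hx hfx, ← sff_eq_localSff hx hfx] at h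
  rw [h, sub_self]

end GaussRicciManifold

/-! ### Second fundamental forms with a circular curvature ellipse -/

lemma finrank_tangentSpace {n : ℕ} {M : Type*} [TopologicalSpace M] [ChartedSpace (Euc n) M]
    (x : M) : Module.finrank ℝ (TangentSpace (𝓡 n) x) = n :=
  finrank_euclideanSpace_fin (𝕜 := ℝ) (n := n)

section WintgenForm

variable {n N : ℕ} {M : Type*} [TopologicalSpace M] [ChartedSpace (Euc n) M]
  [RiemannianBundle (fun x : M => TangentSpace (𝓡 n) x)]

/-- The second fundamental form at `x` is `⟨X, Y⟩ ℋ` plus a trace-free form on the plane spanned by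
the orthonormal pair `e₁, e₂` whose curvature ellipse is a circle of radius `μ` in the plane of
the orthonormal normal pair `η₁, η₂`. -/
structure HasWintgenForm (f : M → Euc N) (x : M) (e₁ e₂ : TangentSpace (𝓡 n) x)
    (η₁ η₂ : Euc N) (μ : ℝ) : Prop where
  norm_e₁ : (inner ℝ e₁ e₁ : ℝ) = 1
  norm_e₂ : (inner ℝ e₂ e₂ : ℝ) = 1
  inner_e : (inner ℝ e₁ e₂ : ℝ) = 0
  norm_η₁ : (inner ℝ η₁ η₁ : ℝ) = 1
  norm_η₂ : (inner ℝ η₂ η₂ : ℝ) = 1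
  inner_η : (inner ℝ η₁ η₂ : ℝ) = 0
  mem_η₁ : η₁ ∈ normalSpace n f x
  mem_η₂ : η₂ ∈ normalSpace n f x
  sff_eq : ∀ X Y : TangentSpace (𝓡 n) x, sff f x X Y =
    (inner ℝ X Y : ℝ) • meanCurvatureVector n f x +
    μ • (((inner ℝ X e₁ : ℝ) * inner ℝ Y e₁ - (inner ℝ X e₂ : ℝ) * inner ℝ Y e₂) • η₁ +
      ((inner ℝ X e₁ : ℝ) * inner ℝ Y e₂ + (inner ℝ X e₂ : ℝ) * inner ℝ Y e₁) • η₂)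

variable {f : M → Euc N} {x : M} {e₁ e₂ : TangentSpace (𝓡 n) x} {η₁ η₂ : Euc N} {μ : ℝ}

lemma sum_sq_inner {ι V : Type*} [Fintype ι] [NormedAddCommGroup V] [InnerProductSpace ℝ V]
    (b : OrthonormalBasis ι ℝ V) (v w : V) :
    ∑ i, (inner ℝ (b i) v : ℝ) * inner ℝ (b i) w = inner ℝ v w := by
  rw [← b.sum_inner_mul_inner]
  exact Finset.sum_congr rfl fun i _ => by rw [real_inner_comm v]

lemma sum_sff_tangentBasis (hn : n ≠ 0) (f : M → Euc N) (x : M) :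
    ∑ i, sff f x (tangentBasis n x i) (tangentBasis n x i) = (n : ℝ) • meanCurvatureVector n f x :=
        by
  rw [meanCurvatureVector, smul_smul, mul_inv_cancel₀ (by exact_mod_cast hn), one_smul]

lemma sum_inner_tangentBasis (x : M) :
    ∑ i, (inner ℝ (tangentBasis n x i) (tangentBasis n x i) : ℝ) = n := by
  simp [finrank_tangentSpace]

/-- `‖α‖² = n H² + 4 μ²`. -/
lemma HasWintgenForm.sum_sq_sff (h : HasWintgenForm f x e₁ e₂ η₁ η₂ μ) :
    ∑ i, ∑ j, (inner ℝ (sff f x (tangentBasis n x i) (tangentBasis n x j))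
      (sff f x (tangentBasis n x i) (tangentBasis n x j)) : ℝ) =
      n * meanCurvature n f x ^ 2 + 4 * μ ^ 2 := by
  have hH : (inner ℝ (meanCurvatureVector n f x) (meanCurvatureVector n f x) : ℝ) =
    meanCurvature n f x ^ 2 := real_inner_self_eq_norm_sq _
  rw [← hH, ← sum_inner_tangentBasis x]
  have hsff := h.sff_eq
  set b := tangentBasis n x
  set ℋ := meanCurvatureVector n f x
  have h21 : (inner ℝ η₂ η₁ : ℝ) = 0 := by rw [real_inner_comm, h.inner_η]
  have hterm : ∀ i j, (inner ℝ (sff f x (b i) (b j)) (sff f x (b i) (b j)) : ℝ) =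
      inner ℝ ℋ ℋ * ((inner ℝ (b j) (b i) : ℝ) * inner ℝ (b j) (b i))
      + (2 * μ * (inner ℝ ℋ η₁ * inner ℝ (b i) e₁ + inner ℝ ℋ η₂ * inner ℝ (b i) e₂)) *
        ((inner ℝ (b j) (b i) : ℝ) * inner ℝ (b j) e₁)
      + (2 * μ * (inner ℝ ℋ η₂ * inner ℝ (b i) e₁ - inner ℝ ℋ η₁ * inner ℝ (b i) e₂)) *
        ((inner ℝ (b j) (b i) : ℝ) * inner ℝ (b j) e₂)
      + (μ ^ 2 * ((inner ℝ (b i) e₁ : ℝ) * inner ℝ (b i) e₁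
          + (inner ℝ (b i) e₂ : ℝ) * inner ℝ (b i) e₂)) *
        ((inner ℝ (b j) e₁ : ℝ) * inner ℝ (b j) e₁)
      + (μ ^ 2 * ((inner ℝ (b i) e₁ : ℝ) * inner ℝ (b i) e₁
          + (inner ℝ (b i) e₂ : ℝ) * inner ℝ (b i) e₂)) *
        ((inner ℝ (b j) e₂ : ℝ) * inner ℝ (b j) e₂) := by
    intro i j
    rw [hsff]
    simp only [inner_add_left, inner_add_right, real_inner_smul_left, real_inner_smul_right,
      h.norm_η₁, h.norm_η₂, h.inner_η, h21, real_inner_comm (b i) (b j), real_inner_comm ℋ η₁,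
      real_inner_comm ℋ η₂]
    ring
  have hterm' : ∀ i, ∑ j, (inner ℝ (sff f x (b i) (b j)) (sff f x (b i) (b j)) : ℝ) =
      inner ℝ ℋ ℋ * (inner ℝ (b i) (b i) : ℝ)
      + (2 * μ * inner ℝ ℋ η₁ + 2 * μ ^ 2) * ((inner ℝ (b i) e₁ : ℝ) * inner ℝ (b i) e₁)
      + (4 * μ * inner ℝ ℋ η₂) * ((inner ℝ (b i) e₁ : ℝ) * inner ℝ (b i) e₂)
      + (2 * μ ^ 2 - 2 * μ * inner ℝ ℋ η₁) * ((inner ℝ (b i) e₂ : ℝ) * inner ℝ (b i) e₂) := by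
    intro i
    simp only [hterm, Finset.sum_add_distrib, ← Finset.mul_sum, sum_sq_inner, h.norm_e₁, h.norm_e₂]
    ring
  simp only [hterm', Finset.sum_add_distrib, ← Finset.mul_sum, sum_sq_inner, h.norm_e₁, h.norm_e₂,
    h.inner_e]
  ring

variable [IsManifold (𝓡 n) ∞ M]

lemma HasWintgenForm.normalizedScalarCurvature_eq (hn : n ≠ 0) (hf : IsIsometricImmersion n f)
    (h : HasWintgenForm f x e₁ e₂ η₁ η₂ μ) :
    normalizedScalarCurvature n x =
      ((n : ℝ) * ((n : ℝ) - 1) * meanCurvature n f x ^ 2 - 4 * μ ^ 2) /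
      ((n : ℝ) * ((n : ℝ) - 1)) := by
  have hH : (inner ℝ (meanCurvatureVector n f x) (meanCurvatureVector n f x) : ℝ) =
    meanCurvature n f x ^ 2 := real_inner_self_eq_norm_sq _
  unfold normalizedScalarCurvature
  congr 1
  have h1 : ∀ i j, (inner ℝ (curvature x (tangentBasis n x i) (tangentBasis n x j)
      (tangentBasis n x j)) (tangentBasis n x i) : ℝ) =
      inner ℝ (sff f x (tangentBasis n x j) (tangentBasis n x j))
        (sff f x (tangentBasis n x i) (tangentBasis n x i))
      - inner ℝ (sff f x (tangentBasis n x i) (tangentBasis n x j))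
        (sff f x (tangentBasis n x i) (tangentBasis n x j)) := by
    intro i j
    rw [inner_curvature hf, sff_symm hf.smooth.contMDiffAt (tangentBasis n x j)
      (tangentBasis n x i)]
  have h2 : ∑ i, ∑ j, (inner ℝ (sff f x (tangentBasis n x j) (tangentBasis n x j))
      (sff f x (tangentBasis n x i) (tangentBasis n x i)) : ℝ) =
      (n : ℝ) * n * meanCurvature n f x ^ 2 := by
    simp only [← sum_inner]
    rw [← inner_sum, sum_sff_tangentBasis hn, real_inner_smul_left, real_inner_smul_right, hH]
    ring
  simp only [h1, Finset.sum_sub_distrib, h2, h.sum_sq_sff]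
  ring

/-- The normal curvature, from the Ricci equation. -/
lemma HasWintgenForm.normalCurvature_eq (hf : IsIsometricImmersion n f)
    (h : HasWintgenForm f x e₁ e₂ η₁ η₂ μ) (X Y : TangentSpace (𝓡 n) x) {ξ : Euc N}
    (hξ : ξ ∈ normalSpace n f x) :
    normalCurvature f x X Y ξ =
      (2 * μ ^ 2 * ((inner ℝ X e₁ : ℝ) * inner ℝ Y e₂ - (inner ℝ X e₂ : ℝ) * inner ℝ Y e₁)) •
        ((inner ℝ η₂ ξ : ℝ) • η₁ - (inner ℝ η₁ ξ : ℝ) • η₂) := by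
  have h12 : (inner ℝ e₂ e₁ : ℝ) = 0 := by rw [real_inner_comm, h.inner_e]
  -- The shape operator `A_ξ` applied to `Y`.
  set S : TangentSpace (𝓡 n) x → TangentSpace (𝓡 n) x := fun Y =>
    (inner ℝ (meanCurvatureVector n f x) ξ : ℝ) • Y
      + (μ * (inner ℝ η₁ ξ * inner ℝ Y e₁ + inner ℝ η₂ ξ * inner ℝ Y e₂)) • e₁
      + (μ * (inner ℝ η₂ ξ * inner ℝ Y e₁ - inner ℝ η₁ ξ * inner ℝ Y e₂)) • e₂ with hS
  have hA : ∀ Y Z, (inner ℝ (S Y) Z : ℝ) = inner ℝ (sff f x Y Z) ξ := by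
    intro Y Z
    rw [h.sff_eq, hS]
    simp only [inner_add_left, real_inner_smul_left, real_inner_comm Z e₁, real_inner_comm Z e₂]
    ring
  rw [Wintgen.normalCurvature_eq hf x X Y (S Y) (S X) hξ (hA Y) (hA X), h.sff_eq, h.sff_eq, hS]
  simp only [inner_add_left, inner_add_right, real_inner_smul_left, real_inner_smul_right,
    h.norm_e₁, h.norm_e₂, h.inner_e, h12, real_inner_comm X Y]
  module

lemma HasWintgenForm.normalScalarCurvature_eq (hf : IsIsometricImmersion n f)
    (h : HasWintgenForm f x e₁ e₂ η₁ η₂ μ) :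
    normalScalarCurvature n f x = 4 * μ ^ 2 / ((n : ℝ) * ((n : ℝ) - 1)) := by
  unfold normalScalarCurvature
  congr 1
  set b := tangentBasis n x
  set c := stdOrthonormalBasis ℝ (normalSpace n f x)
  have h21 : (inner ℝ η₂ η₁ : ℝ) = 0 := by rw [real_inner_comm, h.inner_η]
  have hterm : ∀ i j a, ‖normalCurvature f x (b i) (b j) (c a : Euc N)‖ ^ 2 =
      (2 * μ ^ 2 * ((inner ℝ (b i) e₁ : ℝ) * inner ℝ (b j) e₂
        - (inner ℝ (b i) e₂ : ℝ) * inner ℝ (b j) e₁)) ^ 2 *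
      ((inner ℝ (c a) (⟨η₁, h.mem_η₁⟩ : normalSpace n f x) : ℝ) *
          inner ℝ (c a) (⟨η₁, h.mem_η₁⟩ : normalSpace n f x)
        + (inner ℝ (c a) (⟨η₂, h.mem_η₂⟩ : normalSpace n f x) : ℝ) *
          inner ℝ (c a) (⟨η₂, h.mem_η₂⟩ : normalSpace n f x)) := by
    intro i j a
    rw [h.normalCurvature_eq hf _ _ (c a).2, ← real_inner_self_eq_norm_sq]
    simp only [inner_sub_left, inner_sub_right, real_inner_smul_left, real_inner_smul_right,
      h.norm_η₁, h.norm_η₂, h.inner_η, h21, Submodule.coe_inner, real_inner_comm (c a : Euc N)]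
    ring
  have hη₁ : (inner ℝ (⟨η₁, h.mem_η₁⟩ : normalSpace n f x) ⟨η₁, h.mem_η₁⟩ : ℝ) = 1 := h.norm_η₁
  have hη₂ : (inner ℝ (⟨η₂, h.mem_η₂⟩ : normalSpace n f x) ⟨η₂, h.mem_η₂⟩ : ℝ) = 1 := h.norm_η₂
  have hterm' : ∀ i j, ∑ a, ‖normalCurvature f x (b i) (b j) (c a : Euc N)‖ ^ 2 =
      (8 * μ ^ 4 * ((inner ℝ (b i) e₁ : ℝ) * inner ℝ (b i) e₁)) *
        ((inner ℝ (b j) e₂ : ℝ) * inner ℝ (b j) e₂)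
      + (8 * μ ^ 4 * ((inner ℝ (b i) e₂ : ℝ) * inner ℝ (b i) e₂)) *
        ((inner ℝ (b j) e₁ : ℝ) * inner ℝ (b j) e₁)
      - (16 * μ ^ 4 * ((inner ℝ (b i) e₁ : ℝ) * inner ℝ (b i) e₂)) *
        ((inner ℝ (b j) e₁ : ℝ) * inner ℝ (b j) e₂) := by
    intro i j
    simp only [hterm, ← Finset.mul_sum, Finset.sum_add_distrib, sum_sq_inner, hη₁, hη₂]
    ring
  simp only [hterm', Finset.sum_add_distrib, Finset.sum_sub_distrib, ← Finset.mul_sum,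
    sum_sq_inner, h.norm_e₁, h.norm_e₂, h.inner_e, mul_one, mul_zero, sub_zero]
  have : 8 * μ ^ 4 + 8 * μ ^ 4 = (4 * μ ^ 2) ^ 2 := by ring
  rw [this, Real.sqrt_sq (by positivity)]

/-- Equality holds in the DDVV inequality. -/
lemma HasWintgenForm.ddvv_eq (hn : 2 ≤ n) (hf : IsIsometricImmersion n f)
    (h : HasWintgenForm f x e₁ e₂ η₁ η₂ μ) :
    normalizedScalarCurvature n x = meanCurvature n f x ^ 2 - normalScalarCurvature n f x := by
  have hn' : (2 : ℝ) ≤ n := by exact_mod_cast hn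
  rw [h.normalizedScalarCurvature_eq (by omega) hf, h.normalScalarCurvature_eq hf]
  have h1 : (n : ℝ) ≠ 0 := by linarith
  have h2 : (n : ℝ) - 1 ≠ 0 := by linarith
  field_simp

end WintgenForm

/-! ### Differentials of vector-valued maps and the gradient on a surface -/

section PushCalculus

variable {E : Type*} [NormedAddCommGroup E] [NormedSpace ℝ E] {H : Type*} [TopologicalSpace H]
  {I : ModelWithCorners ℝ E H} {X : Type*} [TopologicalSpace X] [ChartedSpace H X]
  {E' : Type*} [NormedAddCommGroup E'] [NormedSpace ℝ E'] {H' : Type*} [TopologicalSpace H']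
  {I' : ModelWithCorners ℝ E' H'} {X' : Type*} [TopologicalSpace X'] [ChartedSpace H' X']
  {W : Type*} [NormedAddCommGroup W] [NormedSpace ℝ W]
  {W' : Type*} [NormedAddCommGroup W'] [NormedSpace ℝ W']

lemma push_add {f f' : X → W} {x : X} (hf : MDifferentiableAt I 𝓘(ℝ, W) f x)
    (hf' : MDifferentiableAt I 𝓘(ℝ, W) f' x) (v : TangentSpace I x) :
    push I (f + f') x v = push I f x v + push I f' x v :=
  congrArg (fun A : TangentSpace I x →L[ℝ] W => A v) (mvfderiv_add hf hf')

lemma push_sub {f f' : X → W} {x : X} (hf : MDifferentiableAt I 𝓘(ℝ, W) f x)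
    (hf' : MDifferentiableAt I 𝓘(ℝ, W) f' x) (v : TangentSpace I x) :
    push I (f - f') x v = push I f x v - push I f' x v :=
  congrArg (fun A : TangentSpace I x →L[ℝ] W => A v) (mvfderiv_sub hf hf')

lemma push_smul {a : X → ℝ} {f : X → W} {x : X} (ha : MDifferentiableAt I 𝓘(ℝ, ℝ) a x)
    (hf : MDifferentiableAt I 𝓘(ℝ, W) f x) (v : TangentSpace I x) :
    push I (fun x => a x • f x) x v = a x • push I f x v + push I a x v • f x :=
  congrArg (fun A : TangentSpace I x →L[ℝ] W => A v) (mvfderiv_smul ha hf)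

/-- The chain rule. -/
lemma push_comp {F : X' → W} {γ : X → X'} {x : X} (hF : MDifferentiableAt I' 𝓘(ℝ, W) F (γ x))
    (hγ : MDifferentiableAt I I' γ x) (v : TangentSpace I x) :
    push I (F ∘ γ) x v = push I' F (γ x) (mfderiv I I' γ x v) :=
  congrArg (fun A : E →L[ℝ] W => A v) (mfderiv_comp x hF hγ)

lemma push_vectorSpace (Φ : W → W') (w v : W) :
    push 𝓘(ℝ, W) Φ w v = fderiv ℝ Φ w v := by
  have : mfderiv 𝓘(ℝ, W) 𝓘(ℝ, W') Φ w = fderiv ℝ Φ w := mfderiv_eq_fderiv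
  exact congrArg (fun A : W →L[ℝ] W' => A v) this

lemma push_comp_fderiv {Φ : W → W'} {γ : X → W} {x : X} (hΦ : DifferentiableAt ℝ Φ (γ x))
    (hγ : MDifferentiableAt I 𝓘(ℝ, W) γ x) (v : TangentSpace I x) :
    push I (Φ ∘ γ) x v = fderiv ℝ Φ (γ x) (push I γ x v) := by
  rw [push_comp hΦ.mdifferentiableAt hγ]
  exact push_vectorSpace _ _ _

lemma push_prodMk {f : X → W} {f' : X → W'} {x : X} (hf : MDifferentiableAt I 𝓘(ℝ, W) f x)
    (hf' : MDifferentiableAt I 𝓘(ℝ, W') f' x) (v : TangentSpace I x) :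
    push I (fun x => (f x, f' x)) x v = (push I f x v, push I f' x v) := by
  have hpair : MDifferentiableAt I 𝓘(ℝ, W × W') (fun x => (f x, f' x)) x := hf.prodMk_space hf'
  have h1 := push_comp_fderiv (Φ := Prod.fst) differentiableAt_fst hpair v
  have h2 := push_comp_fderiv (Φ := Prod.snd) differentiableAt_snd hpair v
  rw [fderiv_fst] at h1
  rw [fderiv_snd] at h2
  exact Prod.ext h1.symm h2.symm

lemma push_inner {N : ℕ} {f f' : X → Euc N} {x : X} (hf : MDifferentiableAt I 𝓘(ℝ, Euc N) f x)
    (hf' : MDifferentiableAt I 𝓘(ℝ, Euc N) f' x) (v : TangentSpace I x) :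
    push I (fun x => (inner ℝ (f x) (f' x) : ℝ)) x v =
      inner ℝ (f x) (push I f' x v) + inner ℝ (push I f x v) (f' x) := by
  have h1 := push_comp_fderiv (Φ := fun q : Euc N × Euc N => (inner ℝ q.1 q.2 : ℝ))
    (γ := fun x => (f x, f' x)) (differentiableAt_fst.inner ℝ differentiableAt_snd)
    (hf.prodMk_space hf') v
  refine h1.trans ?_
  rw [push_prodMk hf hf', fderiv_inner_apply ℝ differentiableAt_fst differentiableAt_snd,
    fderiv_fst, fderiv_snd]
  rfl

lemma push_const (c : W) (x : X) (v : TangentSpace I x) : push I (fun _ => c) x v = 0 :=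
  congrArg (fun A : TangentSpace I x →L[ℝ] W => A v) (mvfderiv_const c)

end PushCalculus

section Gradient

variable {N : ℕ} {L : Type*} [TopologicalSpace L] [ChartedSpace (Euc 2) L]
  [IsManifold (𝓡 2) ∞ L]

/-- The vector `w` of `ℝᴺ` with `⟨w, ξ⟩ = τ'(G'⁺ ξ)`, which is the gradient of `τ` for the metric
induced by `G`, pushed forward by `G`. -/
def localPushGradient (G : Euc 2 → Euc N) (τ : Euc 2 → ℝ) (z : Euc 2) : Euc N :=
  ∑ i : Fin N, (fderiv ℝ τ z (pseudoInverse (fderiv ℝ G z) (EuclideanSpace.basisFun (Fin N) ℝ i))) •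
    EuclideanSpace.basisFun (Fin N) ℝ i

lemma inner_localPushGradient (G : Euc 2 → Euc N) (τ : Euc 2 → ℝ) (z : Euc 2) (ξ : Euc N) :
    (inner ℝ (localPushGradient G τ z) ξ : ℝ) = fderiv ℝ τ z (pseudoInverse (fderiv ℝ G z) ξ) := by
  conv_rhs => rw [← (EuclideanSpace.basisFun (Fin N) ℝ).sum_repr' ξ]
  simp only [localPushGradient, sum_inner, real_inner_smul_left, map_sum, map_smul, smul_eq_mul]
  exact Finset.sum_congr rfl fun i _ => mul_comm _ _

lemma apply_pseudoInverse_localPushGradient {G : Euc 2 → Euc N} {τ : Euc 2 → ℝ} {z : Euc 2}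
    (hA : Function.Injective (fderiv ℝ G z)) :
    fderiv ℝ G z (pseudoInverse (fderiv ℝ G z) (localPushGradient G τ z)) =
      localPushGradient G τ z := by
  set A := fderiv ℝ G z
  set v := localPushGradient G τ z
  refine ext_inner_right ℝ fun ξ => ?_
  have h1 := inner_localPushGradient G τ z
  have h2 : (inner ℝ (A (pseudoInverse A v)) (ξ - A (pseudoInverse A ξ)) : ℝ) = 0 := by
    rw [inner_sub_right, real_inner_comm, real_inner_comm (A (pseudoInverse A ξ)),
      inner_apply_pseudoInverse hA, sub_self]
  rw [inner_sub_right, sub_eq_zero] at h2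
  rw [h2, inner_apply_pseudoInverse hA, h1, h1, pseudoInverse_apply_self hA]

lemma contDiffAt_localPushGradient {G : Euc 2 → Euc N} {τ : Euc 2 → ℝ} {z : Euc 2}
    (hG : ContDiffAt ℝ ∞ G z) (hinj : Function.Injective (fderiv ℝ G z))
    (hτ : ContDiffAt ℝ ∞ τ z) : ContDiffAt ℝ ∞ (localPushGradient G τ) z := by
  refine ContDiffAt.sum fun i _ => ContDiffAt.fun_smul ?_ contDiffAt_const
  exact (contDiffAt_fderiv hτ).clm_apply
    ((contDiffAt_pseudoInverse (contDiffAt_fderiv hG) hinj).clm_apply contDiffAt_const)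

variable {g : L → Euc N} {τ : L → ℝ}

/-- The representative vector of `localPushGradient` in `T_y L`. -/
lemma exists_gradient (hg : ContMDiff (𝓡 2) 𝓘(ℝ, Euc N) ∞ g)
    (hinj : ∀ y, Function.Injective (push (𝓡 2) g y)) (hτ : ContMDiff (𝓡 2) 𝓘(ℝ, ℝ) ∞ τ)
    {y₀ y : L} (hy : y ∈ (extChartAt (𝓡 2) y₀).source) :
    pushGradient g τ y =
      localPushGradient (chartRep y₀ g) (chartRep y₀ τ) (extChartAt (𝓡 2) y₀ y) ∧
    ∀ b, (inner ℝ (pushGradient g τ y) (push (𝓡 2) g y b) : ℝ) = push (𝓡 2) τ y b := by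
  have hA := fderiv_chartRep_injective hg.contMDiffAt (hinj y) hy
  set A := fderiv ℝ (chartRep y₀ g) (extChartAt (𝓡 2) y₀ y) with hAdef
  set v := localPushGradient (chartRep y₀ g) (chartRep y₀ τ) (extChartAt (𝓡 2) y₀ y) with hv
  have hpg : ∀ b, push (𝓡 2) g y b = A (chartDeriv (k := 2) y₀ y b) :=
      push_eq_fderiv hy hg.contMDiffAt
  have hpτ : ∀ b, push (𝓡 2) τ y b = (inner ℝ v (A (chartDeriv (k := 2) y₀ y b)) : ℝ) := by
    intro b
    rw [inner_localPushGradient, pseudoInverse_apply_self hA]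
    exact push_eq_fderiv hy hτ.contMDiffAt b
  obtain ⟨a, ha⟩ := (chartDeriv_bijective (k := 2) hy).2 (pseudoInverse A v)
  have hAv : A (pseudoInverse A v) = v := apply_pseudoInverse_localPushGradient hA
  have hgrad : surfaceGradient g τ y = a := by
    refine rieszVector_eq (fun w => ?_) fun a' ha' => ?_
    · rw [hpg, hpg, ha, hAv, hpτ]
    · apply (chartDeriv_bijective (k := 2) hy).1
      refine eq_of_inner_apply hA fun u => ?_
      obtain ⟨b, rfl⟩ := (chartDeriv_bijective (k := 2) hy).2 u
      rw [← hpg a', ← hpg b, ha', ha, hAv, hpτ, hpg]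
  have hpush : pushGradient g τ y = v := by
    rw [pushGradient, hgrad, hpg, ha, hAv]
  exact ⟨hpush, fun b => by rw [hpush, hpg, hpτ]⟩

lemma inner_pushGradient (hg : ContMDiff (𝓡 2) 𝓘(ℝ, Euc N) ∞ g)
    (hinj : ∀ y, Function.Injective (push (𝓡 2) g y)) (hτ : ContMDiff (𝓡 2) 𝓘(ℝ, ℝ) ∞ τ)
    (y : L) (b : TangentSpace (𝓡 2) y) :
    (inner ℝ (pushGradient g τ y) (push (𝓡 2) g y b) : ℝ) = push (𝓡 2) τ y b :=
  (exists_gradient hg hinj hτ (mem_extChartAt_source y)).2 b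

lemma contMDiff_pushGradient (hg : ContMDiff (𝓡 2) 𝓘(ℝ, Euc N) ∞ g)
    (hinj : ∀ y, Function.Injective (push (𝓡 2) g y)) (hτ : ContMDiff (𝓡 2) 𝓘(ℝ, ℝ) ∞ τ) :
    ContMDiff (𝓡 2) 𝓘(ℝ, Euc N) ∞ (pushGradient g τ) := by
  intro y
  have hy := mem_extChartAt_source (I := 𝓡 2) y
  have h1 := contDiffAt_localPushGradient (contDiffAt_chartRep_apply hy hg.contMDiffAt)
    (fderiv_chartRep_injective hg.contMDiffAt (hinj y) hy)
    (contDiffAt_chartRep_apply hy hτ.contMDiffAt)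
  refine contMDiffAt_of_chartRep hy (h1.congr_of_eventuallyEq ?_)
  filter_upwards [extChartAt_target_mem_nhds (I := 𝓡 2) y] with z hz
  have := (exists_gradient hg hinj hτ ((extChartAt (𝓡 2) y).map_target hz)).1
  rw [(extChartAt (𝓡 2) y).right_inv hz] at this
  exact this

end Gradient

/-! ### The Gauss map of the conformal Gauss parametrization -/

section GaussData

variable {N : ℕ} {L : Type*} [TopologicalSpace L] [ChartedSpace (Euc 2) L]

/-- An immersed surface `g` with a positive function `τ` such that `‖∇τ‖ < 1`. -/
structure IsGaussData (g : L → Euc N) (τ : L → ℝ) : Prop where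
  smooth_surface : ContMDiff (𝓡 2) 𝓘(ℝ, Euc N) ∞ g
  immersion : ∀ y, Function.Injective (push (𝓡 2) g y)
  smooth_radius : ContMDiff (𝓡 2) 𝓘(ℝ, ℝ) ∞ τ
  radius_pos : ∀ y, 0 < τ y
  norm_gradient_lt : ∀ y, ‖pushGradient g τ y‖ < 1

/-- The function `(a, w) ↦ a + √(1 - ‖a‖²) w`, through which `gaussMap` factors. -/
def sphereLift (q : Euc N × Euc N) : Euc N := q.1 + Real.sqrt (1 - ‖q.1‖ ^ 2) • q.2

lemma one_sub_norm_sq_pos {a : Euc N} (ha : ‖a‖ < 1) : 0 < 1 - ‖a‖ ^ 2 := by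
  nlinarith [norm_nonneg a]

lemma contDiffAt_sqrt_one_sub {a : Euc N} (ha : ‖a‖ < 1) :
    ContDiffAt ℝ ∞ (fun a : Euc N => Real.sqrt (1 - ‖a‖ ^ 2)) a :=
  (contDiffAt_const.sub (contDiff_norm_sq ℝ).contDiffAt).sqrt (one_sub_norm_sq_pos ha).ne'

lemma contDiffAt_sphereLift {q : Euc N × Euc N} (hq : ‖q.1‖ < 1) :
    ContDiffAt ℝ ∞ sphereLift q := by
  have h := (contDiffAt_sqrt_one_sub hq).comp q contDiffAt_fst
  exact contDiffAt_fst.add (h.smul contDiffAt_snd)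

lemma fderiv_sphereLift {q : Euc N × Euc N} (hq : ‖q.1‖ < 1) (d : Euc N × Euc N) :
    fderiv ℝ sphereLift q d = d.1 + Real.sqrt (1 - ‖q.1‖ ^ 2) • d.2
      - ((inner ℝ q.1 d.1 : ℝ) / Real.sqrt (1 - ‖q.1‖ ^ 2)) • q.2 := by
  have h1 : HasFDerivAt (fun q : Euc N × Euc N => q.1)
      (ContinuousLinearMap.fst ℝ (Euc N) (Euc N)) q :=
    hasFDerivAt_fst
  have h2 := ((h1.norm_sq.const_sub 1).sqrt (one_sub_norm_sq_pos hq).ne').smul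
    (hasFDerivAt_snd (𝕜 := ℝ) (p := q))
  have h3 := h1.add h2
  have h4 : HasFDerivAt (sphereLift (N := N)) _ q := h3
  rw [h4.fderiv]
  have h6 : ∀ c r : ℝ, r⁻¹ * 2⁻¹ * (2 * c) = c / r := fun c r => by ring
  simp [sub_eq_add_neg, h6, add_assoc]

/-- The component of a tangent vector of `L × ℝᴺ` along `L`. -/
def tangentFst (p : L × Euc N) :
    TangentSpace ((𝓡 2).prod 𝓘(ℝ, Euc N)) p →L[ℝ] TangentSpace (𝓡 2) p.1 :=
  ContinuousLinearMap.fst ℝ (TangentSpace (𝓡 2) p.1) (Euc N)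

/-- The component of a tangent vector of `L × ℝᴺ` along `ℝᴺ`. -/
def tangentSnd (p : L × Euc N) : TangentSpace ((𝓡 2).prod 𝓘(ℝ, Euc N)) p →L[ℝ] Euc N :=
  ContinuousLinearMap.snd ℝ (TangentSpace (𝓡 2) p.1) (Euc N)

lemma mem_tangentUnitNormalBundle {g : L → Euc N} {p : L × Euc N}
    {V : TangentSpace ((𝓡 2).prod 𝓘(ℝ, Euc N)) p} :
    V ∈ tangentUnitNormalBundle g p ↔ IsTangentPair g p (tangentFst p V) (tangentSnd p V) := Iff.rfl

/-- The map `(y, w) ↦ (g_* ∇τ(y), w)`. -/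
def gradientPair (g : L → Euc N) (τ : L → ℝ) (p : L × Euc N) : Euc N × Euc N :=
  (pushGradient g τ p.1, p.2)

lemma gaussMap_eq (g : L → Euc N) (τ : L → ℝ) :
    gaussMap g τ = sphereLift ∘ gradientPair g τ := rfl

lemma conformalGauss_eq (g : L → Euc N) (τ : L → ℝ) :
    conformalGauss g τ = (g ∘ Prod.fst) - fun p => (τ ∘ Prod.fst) p • gaussMap g τ p := rfl

lemma contMDiff_comp_fst {W : Type*} [NormedAddCommGroup W] [NormedSpace ℝ W] {F : L → W}
    (hF : ContMDiff (𝓡 2) 𝓘(ℝ, W) ∞ F) :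
    ContMDiff ((𝓡 2).prod 𝓘(ℝ, Euc N)) 𝓘(ℝ, W) ∞ (F ∘ (Prod.fst : L × Euc N → L)) :=
  hF.comp contMDiff_fst

lemma push_comp_fst_of_mdifferentiableAt {W : Type*} [NormedAddCommGroup W] [NormedSpace ℝ W]
    {F : L → W} {p : L × Euc N} (hF : MDifferentiableAt (𝓡 2) 𝓘(ℝ, W) F p.1)
    (V : TangentSpace ((𝓡 2).prod 𝓘(ℝ, Euc N)) p) :
    push ((𝓡 2).prod 𝓘(ℝ, Euc N)) (F ∘ Prod.fst) p V = push (𝓡 2) F p.1 (tangentFst p V) := by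
  rw [push_comp hF mdifferentiableAt_fst, mfderiv_fst]
  rfl

lemma push_comp_fst {W : Type*} [NormedAddCommGroup W] [NormedSpace ℝ W] {F : L → W}
    (hF : ContMDiff (𝓡 2) 𝓘(ℝ, W) ∞ F) (p : L × Euc N)
    (V : TangentSpace ((𝓡 2).prod 𝓘(ℝ, Euc N)) p) :
    push ((𝓡 2).prod 𝓘(ℝ, Euc N)) (F ∘ Prod.fst) p V = push (𝓡 2) F p.1 (tangentFst p V) :=
  push_comp_fst_of_mdifferentiableAt (hF.mdifferentiable (by simp) _) V

lemma push_snd (p : L × Euc N) (V : TangentSpace ((𝓡 2).prod 𝓘(ℝ, Euc N)) p) :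
    push ((𝓡 2).prod 𝓘(ℝ, Euc N)) (Prod.snd : L × Euc N → Euc N) p V = tangentSnd p V := by
  unfold push
  rw [mfderiv_snd]
  rfl

lemma inner_gradient_normal {g : L → Euc N} {τ : L → ℝ} {p : L × Euc N}
    (hp : p ∈ unitNormalBundle g) : (inner ℝ (pushGradient g τ p.1) p.2 : ℝ) = 0 := by
  rw [real_inner_comm]
  exact mem_normalSpace.1 hp.1 _

/-- `N^Ψ` has unit length on the unit normal bundle. -/
lemma IsGaussData.inner_gaussMap_self {g : L → Euc N} {τ : L → ℝ} (h : IsGaussData g τ)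
    {p : L × Euc N}
    (hp : p ∈ unitNormalBundle g) : (inner ℝ (gaussMap g τ p) (gaussMap g τ p) : ℝ) = 1 := by
  have h1 := inner_gradient_normal (τ := τ) hp
  have h2 : (inner ℝ p.2 (pushGradient g τ p.1) : ℝ) = 0 := by rw [real_inner_comm, h1]
  have h3 := Real.mul_self_sqrt (one_sub_norm_sq_pos (h.norm_gradient_lt p.1)).le
  have h4 : (inner ℝ p.2 p.2 : ℝ) = 1 := by rw [real_inner_self_eq_norm_sq, hp.2, one_pow]
  simp only [gaussMap, inner_add_left, inner_add_right, real_inner_smul_left,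
    real_inner_smul_right, h1, h2, h4, real_inner_self_eq_norm_sq (pushGradient g τ p.1)]
  linarith

variable [IsManifold (𝓡 2) ∞ L] {g : L → Euc N} {τ : L → ℝ}

lemma IsGaussData.contMDiff_gradient (h : IsGaussData g τ) :
    ContMDiff (𝓡 2) 𝓘(ℝ, Euc N) ∞ (pushGradient g τ) :=
  contMDiff_pushGradient h.smooth_surface h.immersion h.smooth_radius

lemma IsGaussData.contMDiff_pair (h : IsGaussData g τ) :
    ContMDiff ((𝓡 2).prod 𝓘(ℝ, Euc N)) 𝓘(ℝ, Euc N × Euc N) ∞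
      (gradientPair g τ) :=
  (contMDiff_comp_fst h.contMDiff_gradient).prodMk_space contMDiff_snd

lemma contMDiffAt_comp_vectorSpace {E H X W W' : Type*} [NormedAddCommGroup E] [NormedSpace ℝ E]
    [TopologicalSpace H] {I : ModelWithCorners ℝ E H} [TopologicalSpace X] [ChartedSpace H X]
    [NormedAddCommGroup W] [NormedSpace ℝ W] [NormedAddCommGroup W'] [NormedSpace ℝ W']
    {Φ : W → W'} {γ : X → W} {x : X} (hΦ : ContDiffAt ℝ ∞ Φ (γ x))
    (hγ : ContMDiffAt I 𝓘(ℝ, W) ∞ γ x) : ContMDiffAt I 𝓘(ℝ, W') ∞ (Φ ∘ γ) x :=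
  hΦ.contMDiffAt.comp x hγ

lemma IsGaussData.contMDiff_gaussMap (h : IsGaussData g τ) :
    ContMDiff ((𝓡 2).prod 𝓘(ℝ, Euc N)) 𝓘(ℝ, Euc N) ∞ (gaussMap g τ) := by
  intro p
  rw [gaussMap_eq]
  exact contMDiffAt_comp_vectorSpace (contDiffAt_sphereLift (h.norm_gradient_lt p.1))
    (h.contMDiff_pair p)

lemma IsGaussData.contMDiff_conformalGauss (h : IsGaussData g τ) :
    ContMDiff ((𝓡 2).prod 𝓘(ℝ, Euc N)) 𝓘(ℝ, Euc N) ∞ (conformalGauss g τ) :=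
  (contMDiff_comp_fst h.smooth_surface).sub
    ((contMDiff_comp_fst h.smooth_radius).smul h.contMDiff_gaussMap)

lemma IsGaussData.push_gaussMap (h : IsGaussData g τ) (p : L × Euc N)
    (V : TangentSpace ((𝓡 2).prod 𝓘(ℝ, Euc N)) p) :
    push ((𝓡 2).prod 𝓘(ℝ, Euc N)) (gaussMap g τ) p V =
      push (𝓡 2) (pushGradient g τ) p.1 (tangentFst p V)
      + Real.sqrt (1 - ‖pushGradient g τ p.1‖ ^ 2) • tangentSnd p V
      - ((inner ℝ (pushGradient g τ p.1) (push (𝓡 2) (pushGradient g τ) p.1 (tangentFst p V)) : ℝ)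
          / Real.sqrt (1 - ‖pushGradient g τ p.1‖ ^ 2)) • p.2 := by
  have h0 : DifferentiableAt ℝ sphereLift (gradientPair g τ p) :=
    differentiableAt_of_smooth (contDiffAt_sphereLift (h.norm_gradient_lt p.1))
  have h0' := push_comp_fderiv h0 (h.contMDiff_pair.mdifferentiable (by simp) p) V
  rw [← gaussMap_eq, fderiv_sphereLift (q := gradientPair g τ p) (h.norm_gradient_lt p.1)] at h0'
  rw [h0']
  have h1 := push_prodMk ((contMDiff_comp_fst h.contMDiff_gradient).mdifferentiable (by simp) p)
    (mdifferentiableAt_snd (I := 𝓡 2) (I' := 𝓘(ℝ, Euc N)) (x := p)) V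
  have h2 : push ((𝓡 2).prod 𝓘(ℝ, Euc N)) (gradientPair g τ) p V =
      (push (𝓡 2) (pushGradient g τ) p.1 (tangentFst p V), tangentSnd p V) := by
    refine h1.trans ?_
    rw [push_comp_fst h.contMDiff_gradient, push_snd]
  rw [h2]
  rfl

lemma IsGaussData.push_conformalGauss (h : IsGaussData g τ) (p : L × Euc N)
    (V : TangentSpace ((𝓡 2).prod 𝓘(ℝ, Euc N)) p) :
    push ((𝓡 2).prod 𝓘(ℝ, Euc N)) (conformalGauss g τ) p V =
      push (𝓡 2) g p.1 (tangentFst p V) - (τ p.1 • push ((𝓡 2).prod 𝓘(ℝ, Euc N)) (gaussMap g τ) p V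
        + push (𝓡 2) τ p.1 (tangentFst p V) • gaussMap g τ p) := by
  have hτ := (contMDiff_comp_fst (N := N) h.smooth_radius).mdifferentiable (by simp) p
  have hN := h.contMDiff_gaussMap.mdifferentiable (by simp) p
  have hτN : MDifferentiableAt ((𝓡 2).prod 𝓘(ℝ, Euc N)) 𝓘(ℝ, Euc N)
      (fun p => (τ ∘ Prod.fst) p • gaussMap g τ p) p := hτ.smul hN
  rw [conformalGauss_eq, push_sub ((contMDiff_comp_fst h.smooth_surface).mdifferentiable (by simp)
      p)
    hτN, push_smul hτ hN, push_comp_fst h.smooth_surface, push_comp_fst h.smooth_radius]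
  rfl

/-- Differentiating `⟨w, ∇τ⟩ = 0` along the unit normal bundle. -/
lemma IsGaussData.inner_push_gradient (h : IsGaussData g τ) {p : L × Euc N}
    (hp : p ∈ unitNormalBundle g) {V : TangentSpace ((𝓡 2).prod 𝓘(ℝ, Euc N)) p}
    (hV : V ∈ tangentUnitNormalBundle g p) :
    (inner ℝ p.2 (push (𝓡 2) (pushGradient g τ) p.1 (tangentFst p V)) : ℝ)
      + inner ℝ (tangentSnd p V) (pushGradient g τ p.1) = 0 := by
  have hy := mem_extChartAt_source (I := 𝓡 2) p.1
  set y := p.1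
  set z := extChartAt (𝓡 2) y y
  set G := chartRep (k := 2) y g
  set t := chartRep (k := 2) y τ
  have hG := contDiffAt_chartRep_apply hy (h.smooth_surface.contMDiffAt (x := y))
  have ht := contDiffAt_chartRep_apply hy (h.smooth_radius.contMDiffAt (x := y))
  have hA := fderiv_chartRep_injective h.smooth_surface.contMDiffAt (h.immersion y) hy
  have hν := contDiffAt_localPushGradient hG hA ht
  have hc : ContDiffAt ℝ ∞ (fun z' => pseudoInverse (fderiv ℝ G z') (localPushGradient G t z')) z :=
    (contDiffAt_pseudoInverse (contDiffAt_fderiv hG) hA).clm_apply hν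
  have hloc : chartRep (k := 2) y (pushGradient g τ) =ᶠ[nhds z] localPushGradient G t := by
    filter_upwards [extChartAt_target_mem_nhds (I := 𝓡 2) y] with z' hz'
    have := (exists_gradient h.smooth_surface h.immersion h.smooth_radius
      ((extChartAt (𝓡 2) y).map_target hz')).1
    rw [(extChartAt (𝓡 2) y).right_inv hz'] at this
    exact this
  have heq : localPushGradient G t =ᶠ[nhds z] fun z' =>
      fderiv ℝ G z' (pseudoInverse (fderiv ℝ G z') (localPushGradient G t z')) := by
    filter_upwards [eventually_injective (contDiffAt_fderiv hG).continuousAt hA] with z' hz'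
    exact (apply_pseudoInverse_localPushGradient hz').symm
  obtain ⟨X, hX⟩ := (chartDeriv_bijective (k := 2) hy).2
    (pseudoInverse (fderiv ℝ G z) (localPushGradient G t z))
  -- In coordinates `g_* ∇τ = G'(c)` for a field `c`, with derivative `G'(c'(u)) + D²G(u, c)`.
  have hder : push (𝓡 2) (pushGradient g τ) y (tangentFst p V) =
      fderiv ℝ G z (fderiv ℝ (fun z' => pseudoInverse (fderiv ℝ G z') (localPushGradient G t z')) z
        (chartDeriv (k := 2) y y (tangentFst p V))) + secondDeriv g y (tangentFst p V) X := by
    rw [push_eq_fderiv hy h.contMDiff_gradient.contMDiffAt, (hloc.trans heq).fderiv_eq,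
      (hasFDerivAt_fderiv_apply hG (differentiableAt_of_smooth hc).hasFDerivAt).fderiv,
      secondDeriv_eq, hX]
    rfl
  have hpush : pushGradient g τ y = push (𝓡 2) g y X := by
    rw [push_eq_fderiv hy h.smooth_surface.contMDiffAt, hX]
    exact (chartRep_apply _ hy).symm.trans (hloc.trans heq).self_of_nhds
  have h2 := (mem_tangentUnitNormalBundle.1 hV).2 X
  have h3 : ∀ u, (inner ℝ p.2 (fderiv ℝ G z u) : ℝ) = 0 := by
    intro u
    obtain ⟨b, rfl⟩ := (chartDeriv_bijective (k := 2) hy).2 u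
    rw [← push_eq_fderiv hy h.smooth_surface.contMDiffAt]
    exact mem_normalSpace.1 hp.1 b
  rw [hder, hpush, inner_add_right, h3]
  linarith

lemma IsGaussData.inner_gaussMap_push_gaussMap (h : IsGaussData g τ) {p : L × Euc N}
    (hp : p ∈ unitNormalBundle g) {V : TangentSpace ((𝓡 2).prod 𝓘(ℝ, Euc N)) p}
    (hV : V ∈ tangentUnitNormalBundle g p) :
    (inner ℝ (gaussMap g τ p) (push ((𝓡 2).prod 𝓘(ℝ, Euc N)) (gaussMap g τ) p V) : ℝ) = 0 := by
  have h1 := inner_gradient_normal (τ := τ) hp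
  have h2 : (inner ℝ p.2 p.2 : ℝ) = 1 := by rw [real_inner_self_eq_norm_sq, hp.2, one_pow]
  have h3 := h.inner_push_gradient hp hV
  have h4 : (inner ℝ p.2 (tangentSnd p V) : ℝ) = 0 := by
    rw [real_inner_comm]
    exact hV.1
  have h5 : Real.sqrt (1 - ‖pushGradient g τ p.1‖ ^ 2) ≠ 0 :=
    (Real.sqrt_pos.2 (one_sub_norm_sq_pos (h.norm_gradient_lt p.1))).ne'
  rw [real_inner_comm (pushGradient g τ p.1) (tangentSnd p V)] at h3
  rw [h.push_gaussMap]
  simp only [gaussMap, inner_add_left, inner_add_right, inner_sub_right, real_inner_smul_left,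
    real_inner_smul_right, h1, h2, h4]
  field_simp
  linear_combination (Real.sqrt (1 - ‖pushGradient g τ p.1‖ ^ 2)) ^ 2 * h3

/-- `N^Ψ` is normal to `Ψ`. -/
lemma IsGaussData.inner_gaussMap_push_conformalGauss (h : IsGaussData g τ) {p : L × Euc N}
    (hp : p ∈ unitNormalBundle g) {V : TangentSpace ((𝓡 2).prod 𝓘(ℝ, Euc N)) p}
    (hV : V ∈ tangentUnitNormalBundle g p) :
    (inner ℝ (gaussMap g τ p)
      (push ((𝓡 2).prod 𝓘(ℝ, Euc N)) (conformalGauss g τ) p V) : ℝ) = 0 := by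
  have h1 : (inner ℝ p.2 (push (𝓡 2) g p.1 (tangentFst p V)) : ℝ) = 0 :=
      mem_normalSpace.1 hp.1 (tangentFst p V)
  have h2 : (inner ℝ (gaussMap g τ p) (push (𝓡 2) g p.1 (tangentFst p V)) : ℝ) =
      push (𝓡 2) τ p.1 (tangentFst p V) := by
    rw [gaussMap, inner_add_left, real_inner_smul_left, h1,
      inner_pushGradient h.smooth_surface h.immersion h.smooth_radius]
    ring
  rw [h.push_conformalGauss, inner_sub_right, inner_add_right, real_inner_smul_right,
    real_inner_smul_right, h.inner_gaussMap_push_gaussMap hp hV, h.inner_gaussMap_self hp, h2]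
  ring

end GaussData

/-! ### Immersions into the unit normal bundle -/

section UnitNormalBundle

variable {N : ℕ} {L : Type*} [TopologicalSpace L] [ChartedSpace (Euc 2) L]
  {n : ℕ} {M : Type*} [TopologicalSpace M] [ChartedSpace (Euc n) M]

lemma push_comp_jStar {j : M → L × Euc N} {x : M} {W : Type*} [NormedAddCommGroup W]
    [NormedSpace ℝ W] {F : L × Euc N → W}
    (hF : ContMDiff ((𝓡 2).prod 𝓘(ℝ, Euc N)) 𝓘(ℝ, W) ∞ F)
    (hj : ContMDiffAt (𝓡 n) ((𝓡 2).prod 𝓘(ℝ, Euc N)) ∞ j x) (v : TangentSpace (𝓡 n) x) :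
    push (𝓡 n) (F ∘ j) x v = push ((𝓡 2).prod 𝓘(ℝ, Euc N)) F (j x) (jStar j x v) :=
  push_comp (hF.mdifferentiable (by simp) _) (hj.mdifferentiableAt (by simp)) v

/-- Three linear equations cut out the tangent space of `Λ` inside a space of dimension `N + 2`.
Only this bound is needed, so their independence plays no role. -/
lemma le_finrank_tangentUnitNormalBundle (g : L → Euc N) (p : L × Euc N) :
    N ≤ Module.finrank ℝ (tangentUnitNormalBundle g p) + 1 := by
  have hfin : FiniteDimensional ℝ (TangentSpace ((𝓡 2).prod 𝓘(ℝ, Euc N)) p) :=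
    inferInstanceAs (FiniteDimensional ℝ (Euc 2 × Euc N))
  have hdim : Module.finrank ℝ (TangentSpace ((𝓡 2).prod 𝓘(ℝ, Euc N)) p) = 2 + N := by
    have : Module.finrank ℝ (Euc 2 × Euc N) = 2 + N := by
      rw [Module.finrank_prod, finrank_euclideanSpace_fin, finrank_euclideanSpace_fin]
    exact this
  -- The equations `⟨w', g_* X⟩ + ⟨w, D²g(Z, X)⟩ = 0`, as a map into the dual of `T_y L`.
  let B : TangentSpace ((𝓡 2).prod 𝓘(ℝ, Euc N)) p →ₗ[ℝ] Module.Dual ℝ (TangentSpace (𝓡 2) p.1) :=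
    LinearMap.mk₂ ℝ (fun V X => (inner ℝ (tangentSnd p V) (push (𝓡 2) g p.1 X) : ℝ)
        + inner ℝ p.2 (secondDerivLin g p.1 (tangentFst p V) X))
      (fun V V' X => by
        simp only [map_add, inner_add_left, inner_add_right, LinearMap.add_apply]
        ring)
      (fun c V X => by
        simp only [map_smul, real_inner_smul_left, real_inner_smul_right, LinearMap.smul_apply,
          smul_eq_mul]
        ring)
      (fun V X X' => by
        simp only [map_add, inner_add_right]
        ring)
      (fun c V X => by
        simp only [map_smul, real_inner_smul_right, smul_eq_mul]
        ring)
  let T := LinearMap.prod ((innerSL ℝ p.2).toLinearMap ∘ₗ (tangentSnd p).toLinearMap) B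
  have hker : LinearMap.ker T ≤ tangentUnitNormalBundle g p := by
    intro V hV
    have h : T V = 0 := hV
    have h1 : (inner ℝ p.2 (tangentSnd p V) : ℝ) = 0 := congrArg Prod.fst h
    have h2 : B V = 0 := congrArg Prod.snd h
    refine mem_tangentUnitNormalBundle.2 ⟨by rw [real_inner_comm, h1], fun X => ?_⟩
    exact congrArg (fun A : Module.Dual ℝ (TangentSpace (𝓡 2) p.1) => A X) h2
  have h1 := LinearMap.finrank_range_add_finrank_ker T
  have h2 : Module.finrank ℝ (LinearMap.range T) ≤ 3 := by
    refine (Submodule.finrank_le _).trans ?_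
    rw [Module.finrank_prod, Subspace.dual_finrank_eq, finrank_tangentSpace, Module.finrank_self]
  have h3 := Submodule.finrank_mono hker
  omega

variable [IsManifold (𝓡 2) ∞ L] {g : L → Euc N} {τ : L → ℝ}

/-- At regular points the image of the tangent space under `Ψ` is the orthogonal complement of
`N^Ψ`. -/
lemma IsGaussData.hypersurfaceTangent_eq (h : IsGaussData g τ) {p : L × Euc N}
    (hp : p ∈ regularSet g τ) :
    hypersurfaceTangent g τ p = (Submodule.span ℝ {gaussMap g τ p})ᗮ := by
  have hfin : FiniteDimensional ℝ (TangentSpace ((𝓡 2).prod 𝓘(ℝ, Euc N)) p) :=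
    inferInstanceAs (FiniteDimensional ℝ (Euc 2 × Euc N))
  have hne : gaussMap g τ p ≠ 0 := by
    intro h0
    have := inner_gaussMap_self h hp.1
    rw [h0, inner_zero_left] at this
    exact zero_ne_one this
  apply Submodule.eq_of_le_of_finrank_le
  · rintro _ ⟨V, hV, rfl⟩
    rw [Submodule.mem_orthogonal_singleton_iff_inner_right]
    exact h.inner_gaussMap_push_conformalGauss hp.1 hV
  · set A := (push ((𝓡 2).prod 𝓘(ℝ, Euc N)) (conformalGauss g τ) p).toLinearMap
    have h1 : Module.finrank ℝ (hypersurfaceTangent g τ p) =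
        Module.finrank ℝ (tangentUnitNormalBundle g p) := by
      unfold hypersurfaceTangent
      rw [← LinearMap.range_domRestrict]
      refine LinearMap.finrank_range_of_inj ?_
      rw [injective_iff_map_eq_zero]
      rintro ⟨V, hV⟩ h0
      exact Subtype.ext (hp.2 V hV h0)
    have h2 := le_finrank_tangentUnitNormalBundle g p
    have h3 := Submodule.finrank_add_finrank_orthogonal (Submodule.span ℝ {gaussMap g τ p})
    rw [finrank_span_singleton hne, finrank_euclideanSpace_fin] at h3
    omega

variable {j : M → L × Euc N} {x : M}

/-- A map `j = (π, w)` into the unit normal bundle has its differential in the tangent spaces: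
differentiate `⟨w, w⟩ = 1` and `⟨w, g_* X⟩ = 0` for coordinate fields `X`. -/
lemma jStar_mem (hg : ContMDiff (𝓡 2) 𝓘(ℝ, Euc N) ∞ g)
    (hj : ContMDiffAt (𝓡 n) ((𝓡 2).prod 𝓘(ℝ, Euc N)) ∞ j x)
    (hmem : ∀ᶠ x' in nhds x, j x' ∈ unitNormalBundle g) (v : TangentSpace (𝓡 n) x) :
    jStar j x v ∈ tangentUnitNormalBundle g (j x) := by
  have hjd : MDifferentiableAt (𝓡 n) ((𝓡 2).prod 𝓘(ℝ, Euc N)) j x := hj.mdifferentiableAt (by simp)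
  have hw : MDifferentiableAt (𝓡 n) 𝓘(ℝ, Euc N) (Prod.snd ∘ j) x :=
    mdifferentiableAt_snd.comp x hjd
  have hw' : push (𝓡 n) (Prod.snd ∘ j) x v = tangentSnd (j x) (jStar j x v) := by
    rw [push_comp mdifferentiableAt_snd hjd, push_snd]
    rfl
  rw [mem_tangentUnitNormalBundle]
  refine ⟨?_, ?_⟩
  · have h1 : (fun x' => (inner ℝ ((Prod.snd ∘ j) x') ((Prod.snd ∘ j) x') : ℝ)) =ᶠ[nhds x]
        fun _ => 1 := by
      filter_upwards [hmem] with x' hx'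
      rw [real_inner_self_eq_norm_sq, Function.comp_apply, hx'.2, one_pow]
    have h2 := push_congr h1 v
    rw [push_inner hw hw, push_const, hw', real_inner_comm] at h2
    have h3 : (inner ℝ (tangentSnd (j x) (jStar j x v)) ((Prod.snd ∘ j) x) : ℝ) = 0 := by linarith
    exact h3
  · set y := (j x).1
    intro X
    have hy := mem_extChartAt_source (I := 𝓡 2) y
    have hG := contDiffAt_chartRep_apply hy (hg.contMDiffAt (x := y))
    set c := chartDeriv (k := 2) y y X
    set z := extChartAt (𝓡 2) y y
    have hφ : MDifferentiableAt (𝓡 2) 𝓘(ℝ, Euc 2) (extChartAt (𝓡 2) y) (j x).1 :=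
      (contMDiffAt_extChartAt (n := ∞)).mdifferentiableAt (by simp)
    have hφfst : MDifferentiableAt ((𝓡 2).prod 𝓘(ℝ, Euc N)) 𝓘(ℝ, Euc 2)
        (extChartAt (𝓡 2) y ∘ Prod.fst) (j x) :=
      MDifferentiableAt.comp (j x) hφ mdifferentiableAt_fst
    have hγ : MDifferentiableAt (𝓡 n) 𝓘(ℝ, Euc 2) ((extChartAt (𝓡 2) y ∘ Prod.fst) ∘ j) x :=
      MDifferentiableAt.comp x hφfst hjd
    have hγ' : push (𝓡 n) ((extChartAt (𝓡 2) y ∘ Prod.fst) ∘ j) x v =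
        chartDeriv (k := 2) y y (tangentFst (j x) (jStar j x v)) := by
      rw [push_comp hφfst hjd, push_comp_fst_of_mdifferentiableAt hφ]
      rfl
    have hD := hasFDerivAt_fderiv_apply hG (hasFDerivAt_const c z)
    have hDd : DifferentiableAt ℝ (fun z' => fderiv ℝ (chartRep y g) z' c)
      (((extChartAt (𝓡 2) y ∘ Prod.fst) ∘ j) x) := hD.differentiableAt
    have hE : MDifferentiableAt (𝓡 n) 𝓘(ℝ, Euc N) ((fun z' => fderiv ℝ (chartRep y g) z' c) ∘
        ((extChartAt (𝓡 2) y ∘ Prod.fst) ∘ j)) x := hDd.mdifferentiableAt.comp x hγ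
    have hE' : push (𝓡 n) ((fun z' => fderiv ℝ (chartRep y g) z' c) ∘
        ((extChartAt (𝓡 2) y ∘ Prod.fst) ∘ j)) x v =
        secondDeriv g y (tangentFst (j x) (jStar j x v)) X := by
      rw [push_comp_fderiv hDd hγ, hγ', secondDeriv_eq]
      exact fderiv_fderiv_apply_const hG _ _
    have h1 : (fun x' => (inner ℝ ((Prod.snd ∘ j) x') (((fun z' => fderiv ℝ (chartRep y g) z' c) ∘
        ((extChartAt (𝓡 2) y ∘ Prod.fst) ∘ j)) x') : ℝ)) =ᶠ[nhds x] fun _ => 0 := by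
      have hcont : ContinuousAt (fun x' => (j x').1) x :=
        continuousAt_fst.comp (f := j) (x := x) hj.continuousAt
      filter_upwards [hmem, hcont.eventually (extChartAt_source_mem_nhds (I := 𝓡 2) y)]
        with x' hx' hx''
      obtain ⟨b, hb⟩ := (chartDeriv_bijective (k := 2) hx'').2 c
      have h := mem_normalSpace.1 hx'.1 b
      rw [push_eq_fderiv hx'' hg.contMDiffAt, hb] at h
      exact h
    have h2 := push_congr h1 v
    rw [push_inner hw hE, push_const, hw', hE'] at h2
    have h3 : ((fun z' => fderiv ℝ (chartRep y g) z' c) ∘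
        ((extChartAt (𝓡 2) y ∘ Prod.fst) ∘ j)) x = push (𝓡 2) g y X :=
      (push_eq_fderiv hy hg.contMDiffAt X).symm
    rw [h3] at h2
    rw [add_comm]
    exact h2

lemma IsGaussData.gaussMap_mem_normalSpace (h : IsGaussData g τ)
    (hj : ContMDiffAt (𝓡 n) ((𝓡 2).prod 𝓘(ℝ, Euc N)) ∞ j x)
    (hmem : ∀ᶠ x' in nhds x, j x' ∈ unitNormalBundle g) :
    gaussMap g τ (j x) ∈ normalSpace n (conformalGauss g τ ∘ j) x := by
  rw [mem_normalSpace]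
  intro v
  rw [push_comp_jStar h.contMDiff_conformalGauss hj]
  exact h.inner_gaussMap_push_conformalGauss hmem.self_of_nhds
      (jStar_mem h.smooth_surface hj hmem v)

/-- `α_j` is the part of `α_{Ψ ∘ j}` orthogonal to `N^Ψ`. -/
lemma IsGaussData.sffInto_eq (h : IsGaussData g τ)
    (hj : ContMDiffAt (𝓡 n) ((𝓡 2).prod 𝓘(ℝ, Euc N)) ∞ j x)
    (hmem : ∀ᶠ x' in nhds x, j x' ∈ unitNormalBundle g) (hreg : j x ∈ regularSet g τ)
    (X Y : TangentSpace (𝓡 n) x) :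
    sffInto g τ j x X Y = sff (conformalGauss g τ ∘ j) x X Y
      - (inner ℝ (gaussMap g τ (j x)) (sff (conformalGauss g τ ∘ j) x X Y) : ℝ) •
        gaussMap g τ (j x) := by
  have hN := h.gaussMap_mem_normalSpace hj hmem
  have h1 := inner_gaussMap_self h hreg.1
  unfold sffInto
  rw [starProjection_congr (h.hypersurfaceTangent_eq hreg)]
  set ν := gaussMap g τ (j x)
  have h2 : (Submodule.span ℝ {ν})ᗮ.starProjection (secondDeriv (conformalGauss g τ ∘ j) x X Y) =
      secondDeriv (conformalGauss g τ ∘ j) x X Y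
        - (inner ℝ ν (secondDeriv (conformalGauss g τ ∘ j) x X Y) : ℝ) • ν := by
    refine Submodule.eq_starProjection_of_mem_of_inner_eq_zero
      (K := (Submodule.span ℝ {ν})ᗮ) ?_ ?_
    · rw [Submodule.mem_orthogonal_singleton_iff_inner_right, inner_sub_right,
        real_inner_smul_right, h1, mul_one, sub_self]
    · intro w hw
      rw [Submodule.mem_orthogonal_singleton_iff_inner_right] at hw
      rw [sub_sub_cancel, real_inner_smul_left, hw, mul_zero]
  rw [h2, map_sub, map_smul, Submodule.starProjection_eq_self_iff.2 hN, real_inner_comm,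
    ← inner_sff X Y hN, real_inner_comm]
  rfl

variable [IsManifold (𝓡 n) ∞ M]

/-- The shape operator of `Ψ` along `j` is the `N^Ψ`-component of `α_{Ψ ∘ j}`. -/
lemma IsGaussData.shapeForm_eq (h : IsGaussData g τ)
    (hj : ∀ᶠ x' in nhds x, ContMDiffAt (𝓡 n) ((𝓡 2).prod 𝓘(ℝ, Euc N)) ∞ j x')
    (hmem : ∀ᶠ x' in nhds x, j x' ∈ unitNormalBundle g) (X Y : TangentSpace (𝓡 n) x) :
    shapeForm g τ (j x) (jStar j x X) (jStar j x Y) =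
      inner ℝ (gaussMap g τ (j x)) (sff (conformalGauss g τ ∘ j) x X Y) := by
  have hjx := hj.self_of_nhds
  have hN := h.gaussMap_mem_normalSpace hjx hmem
  unfold shapeForm
  rw [← push_comp_jStar h.contMDiff_gaussMap hjx, ← push_comp_jStar h.contMDiff_conformalGauss hjx,
    inner_push_of_normal ((h.contMDiff_conformalGauss _).comp x hjx)
      ((h.contMDiff_gaussMap _).comp x hjx), neg_neg, Function.comp_apply, real_inner_comm,
      ← inner_sff X Y hN, real_inner_comm]
  filter_upwards [hj, hmem.eventually_nhds] with x' h1 h2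
  exact ⟨(h.contMDiff_conformalGauss _).comp x' h1, h.gaussMap_mem_normalSpace h1 h2⟩

/-- On vertical vectors `V`, `Ψ_* V = -τ N^Ψ_* V`. -/
lemma IsGaussData.push_of_vertical (h : IsGaussData g τ) {p : L × Euc N}
    {V : TangentSpace ((𝓡 2).prod 𝓘(ℝ, Euc N)) p} (hV : tangentFst p V = 0) :
    push ((𝓡 2).prod 𝓘(ℝ, Euc N)) (gaussMap g τ) p V =
        Real.sqrt (1 - ‖pushGradient g τ p.1‖ ^ 2) • tangentSnd p V ∧
      push ((𝓡 2).prod 𝓘(ℝ, Euc N)) (conformalGauss g τ) p V =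
        -(τ p.1 • push ((𝓡 2).prod 𝓘(ℝ, Euc N)) (gaussMap g τ) p V) := by
  refine ⟨?_, ?_⟩
  · rw [h.push_gaussMap, hV, map_zero, inner_zero_right, zero_div, zero_smul, sub_zero, zero_add]
  · rw [h.push_conformalGauss, hV, map_zero, map_zero, zero_smul, add_zero, zero_sub]

end UnitNormalBundle

/-! ### Adapted frames -/

section AdaptedFrames

/-- Expansion of a symmetric bilinear map whose kernel contains the orthogonal complement of
`e₁, e₂`. -/
lemma bilin_eq_of_kernel {V W : Type*} [NormedAddCommGroup V] [InnerProductSpace ℝ V]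
    [AddCommGroup W] [Module ℝ W] (β : V →ₗ[ℝ] V →ₗ[ℝ] W) (hβ : ∀ X Y, β X Y = β Y X) {e₁ e₂ : V}
    (h1 : (inner ℝ e₁ e₁ : ℝ) = 1) (h2 : (inner ℝ e₂ e₂ : ℝ) = 1) (h12 : (inner ℝ e₁ e₂ : ℝ) = 0)
    (hker : ∀ T, (inner ℝ T e₁ : ℝ) = 0 → (inner ℝ T e₂ : ℝ) = 0 → ∀ Y, β T Y = 0) (X Y : V) :
    β X Y = ((inner ℝ X e₁ : ℝ) * inner ℝ Y e₁) • β e₁ e₁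
      + ((inner ℝ X e₁ : ℝ) * inner ℝ Y e₂ + (inner ℝ X e₂ : ℝ) * inner ℝ Y e₁) • β e₁ e₂
      + ((inner ℝ X e₂ : ℝ) * inner ℝ Y e₂) • β e₂ e₂ := by
  have h21 : (inner ℝ e₂ e₁ : ℝ) = 0 := by rw [real_inner_comm, h12]
  have key : ∀ X Z, β X Z = (inner ℝ X e₁ : ℝ) • β e₁ Z + (inner ℝ X e₂ : ℝ) • β e₂ Z := by
    intro X Z
    have h := hker (X - (inner ℝ X e₁ : ℝ) • e₁ - (inner ℝ X e₂ : ℝ) • e₂)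
      (by simp only [inner_sub_left, real_inner_smul_left, h1, h21]; ring)
      (by simp only [inner_sub_left, real_inner_smul_left, h2, h12]; ring) Z
    simp only [map_sub, map_smul, LinearMap.sub_apply, LinearMap.smul_apply] at h
    rw [sub_sub, sub_eq_zero] at h
    exact h
  rw [key X Y, hβ e₁ Y, hβ e₂ Y, key Y e₁, key Y e₂, hβ e₂ e₁]
  module

variable {n m : ℕ} {M : Type*} [TopologicalSpace M] [ChartedSpace (Euc n) M]

lemma finrank_normalSpace {f : M → Euc (n + m)} {x : M}
    (hinj : Function.Injective (push (𝓡 n) f x)) :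
    Module.finrank ℝ (normalSpace n f x) = m := by
  have h1 := Submodule.finrank_add_finrank_orthogonal (tangentImage n f x)
  have h2 : Module.finrank ℝ (tangentImage n f x) = n :=
    (LinearMap.finrank_range_of_inj hinj).trans (finrank_tangentSpace x)
  rw [h2, finrank_euclideanSpace_fin] at h1
  exact Nat.add_left_cancel h1

/-- An orthonormal family of `m` normal vectors spans the normal space. -/
lemma eq_zero_of_inner_normalFrame {f : M → Euc (n + m)} {x : M}
    (hinj : Function.Injective (push (𝓡 n) f x)) {η : Fin m → Euc (n + m)} (hη : Orthonormal ℝ η)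
    (hmem : ∀ a, η a ∈ normalSpace n f x) {ζ : Euc (n + m)} (hζ : ζ ∈ normalSpace n f x)
    (h : ∀ a, (inner ℝ ζ (η a) : ℝ) = 0) : ζ = 0 := by
  have hle : Submodule.span ℝ (Set.range η) ≤ normalSpace n f x := by
    rw [Submodule.span_le]
    rintro _ ⟨a, rfl⟩
    exact hmem a
  have heq := Submodule.eq_of_le_of_finrank_le hle (by
    rw [finrank_normalSpace hinj, finrank_span_eq_card hη.linearIndependent, Fintype.card_fin])
  rw [← heq] at hζ
  have horth : ∀ w ∈ Submodule.span ℝ (Set.range η), (inner ℝ ζ w : ℝ) = 0 := by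
    intro w hw
    induction hw using Submodule.span_induction with
    | mem w hw => obtain ⟨a, rfl⟩ := hw; exact h a
    | zero => exact inner_zero_right _
    | add v w _ _ hv hw => rw [inner_add_right, hv, hw, add_zero]
    | smul c w _ hw => rw [real_inner_smul_right, hw, mul_zero]
  exact inner_self_eq_zero.1 (horth ζ hζ)

variable [RiemannianBundle (fun x : M => TangentSpace (𝓡 n) x)]

variable {f : M → Euc (n + m)} {x : M} {e₁ e₂ : TangentSpace (𝓡 n) x} {η₁ η₂ : Euc (n + m)} {μ : ℝ}

/-- A form `⟨X, Y⟩ ℋ₀ + (trace-free)` of the second fundamental form identifies `ℋ₀` as the mean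
curvature vector. -/
lemma meanCurvatureVector_eq_of_sff (hn : n ≠ 0) {ℋ₀ : Euc (n + m)}
    (h1 : (inner ℝ e₁ e₁ : ℝ) = 1) (h2 : (inner ℝ e₂ e₂ : ℝ) = 1) (h12 : (inner ℝ e₁ e₂ : ℝ) = 0)
    (h : ∀ X Y : TangentSpace (𝓡 n) x, sff f x X Y = (inner ℝ X Y : ℝ) • ℋ₀ +
      μ • (((inner ℝ X e₁ : ℝ) * inner ℝ Y e₁ - (inner ℝ X e₂ : ℝ) * inner ℝ Y e₂) • η₁ +
      ((inner ℝ X e₁ : ℝ) * inner ℝ Y e₂ + (inner ℝ X e₂ : ℝ) * inner ℝ Y e₁) • η₂)) :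
    meanCurvatureVector n f x = ℋ₀ := by
  have hsum := sum_sff_tangentBasis hn f x
  have hn' : (n : ℝ) ≠ 0 := by exact_mod_cast hn
  simp only [h, Finset.sum_add_distrib, ← Finset.smul_sum, ← Finset.sum_smul,
    Finset.sum_sub_distrib, sum_sq_inner, sum_inner_tangentBasis, h1, h2, h12,
    real_inner_comm e₁ e₂] at hsum
  have h3 : (n : ℝ) • meanCurvatureVector n f x = (n : ℝ) • ℋ₀ := by
    rw [← hsum]
    module
  exact smul_right_injective _ hn' h3

/-- The second fundamental form in an adapted frame. -/
lemma IsAdaptedFrame.hasWintgenForm (hn : 2 ≤ n) (hm : 3 ≤ m) {e : Fin n → TangentSpace (𝓡 n) x}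
    {η : Fin m → Euc (n + m)} {γ₁ γ₂ : ℝ} (hinj : Function.Injective (push (𝓡 n) f x))
    (h : IsAdaptedFrame f x e η μ γ₁ γ₂) :
    HasWintgenForm f x (e ⟨0, by omega⟩) (e ⟨1, by omega⟩) (η ⟨0, by omega⟩) (η ⟨1, by omega⟩) μ ∧
      meanCurvatureVector n f x = γ₁ • η ⟨1, by omega⟩ + γ₂ • η ⟨2, by omega⟩ := by
  have he := orthonormal_iff_ite.1 h.orthonormal_tangent
  have hη := orthonormal_iff_ite.1 h.orthonormal_normal
  have : Nonempty (Fin n) := ⟨⟨0, by omega⟩⟩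
  let b := basisOfOrthonormalOfCardEqFinrank h.orthonormal_tangent
    (by rw [finrank_tangentSpace, Fintype.card_fin])
  have hb : ∀ i, b i = e i := fun i => by simp [b]
  set i₀ : Fin n := ⟨0, by omega⟩
  set i₁ : Fin n := ⟨1, by omega⟩
  set a₀ : Fin m := ⟨0, by omega⟩
  set a₁ : Fin m := ⟨1, by omega⟩
  set a₂ : Fin m := ⟨2, by omega⟩
  -- The right-hand side of the expansion, as a bilinear map.
  let R : TangentSpace (𝓡 n) x →ₗ[ℝ] TangentSpace (𝓡 n) x →ₗ[ℝ] Euc (n + m) :=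
    LinearMap.mk₂ ℝ (fun X Y => (inner ℝ X Y : ℝ) • (γ₁ • η a₁ + γ₂ • η a₂) +
      μ • (((inner ℝ X (e i₀) : ℝ) * inner ℝ Y (e i₀) - (inner ℝ X (e i₁) : ℝ) * inner ℝ Y (e i₁)) •
        η a₀ + ((inner ℝ X (e i₀) : ℝ) * inner ℝ Y (e i₁) +
          (inner ℝ X (e i₁) : ℝ) * inner ℝ Y (e i₀)) • η a₁))
      (fun X X' Y => by simp only [inner_add_left]; module)
      (fun c X Y => by simp only [real_inner_smul_left]; module)
      (fun X Y Y' => by simp only [inner_add_left, inner_add_right]; module)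
      (fun c X Y => by simp only [real_inner_smul_left, real_inner_smul_right]; module)
  have hR : ∀ X Y, R X Y ∈ normalSpace n f x := fun X Y =>
    Submodule.add_mem _ (Submodule.smul_mem _ _ (Submodule.add_mem _
      (Submodule.smul_mem _ _ (h.mem_normal _)) (Submodule.smul_mem _ _ (h.mem_normal _))))
      (Submodule.smul_mem _ _ (Submodule.add_mem _
      (Submodule.smul_mem _ _ (h.mem_normal _)) (Submodule.smul_mem _ _ (h.mem_normal _))))
  have heq : sffLin f x = R := by
    refine b.ext fun i => b.ext fun k => ?_
    rw [hb, hb, ← sub_eq_zero]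
    refine eq_zero_of_inner_normalFrame hinj h.orthonormal_normal h.mem_normal
      (Submodule.sub_mem _ (sff_mem_normalSpace f x _ _) (hR _ _)) fun a => ?_
    have hRa : (inner ℝ (R (e i) (e k)) (η a) : ℝ) = (if i = k then 1 else 0) *
        (γ₁ * (if a₁ = a then 1 else 0) + γ₂ * (if a₂ = a then 1 else 0)) +
        μ * (((if i = i₀ then 1 else 0) * (if k = i₀ then 1 else 0)
          - (if i = i₁ then 1 else 0) * (if k = i₁ then 1 else 0)) * (if a₀ = a then 1 else 0)
          + ((if i = i₀ then 1 else 0) * (if k = i₁ then 1 else 0)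
          + (if i = i₁ then 1 else 0) * (if k = i₀ then 1 else 0)) * (if a₁ = a then 1 else 0)) :=
              by
      simp only [R, LinearMap.mk₂_apply, inner_add_left, real_inner_smul_left, he, hη]
    rw [inner_sub_left, hRa, sub_eq_zero, sffLin_apply]
    have e0 : ∀ l : Fin n, l = i₀ ↔ (l : ℕ) = 0 := fun l => Fin.ext_iff
    have e1 : ∀ l : Fin n, l = i₁ ↔ (l : ℕ) = 1 := fun l => Fin.ext_iff
    have h0 : a₀ = a ↔ (a : ℕ) = 0 := by rw [Fin.ext_iff]; exact eq_comm
    have h1 : a₁ = a ↔ (a : ℕ) = 1 := by rw [Fin.ext_iff]; exact eq_comm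
    have h2 : a₂ = a ↔ (a : ℕ) = 2 := by rw [Fin.ext_iff]; exact eq_comm
    simp only [e0, e1, h0, h1, h2]
    obtain ha | ha | ha | ha : (a : ℕ) = 0 ∨ (a : ℕ) = 1 ∨ (a : ℕ) = 2 ∨ 3 ≤ (a : ℕ) := by omega
    · rw [h.shape_one a i k ha]
      by_cases p1 : (i : ℕ) = 0 <;> by_cases p2 : (k : ℕ) = 0 <;> by_cases p3 : (i : ℕ) = 1 <;>
        by_cases p4 : (k : ℕ) = 1 <;> first | omega | simp [ha, p1, p2, p3, p4]
    · rw [h.shape_two a i k ha]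
      by_cases p1 : (i : ℕ) = 0 <;> by_cases p2 : (k : ℕ) = 0 <;> by_cases p3 : (i : ℕ) = 1 <;>
        by_cases p4 : (k : ℕ) = 1 <;> first | omega | simp [ha, p1, p2, p3, p4, Fin.ext_iff]
    · rw [h.shape_three a i k ha]
      simp [ha]
    · rw [h.shape_rest a i k ha]
      simp [show ¬ (a : ℕ) = 0 by omega, show ¬ (a : ℕ) = 1 by omega, show ¬ (a : ℕ) = 2 by omega]
  have hsff : ∀ X Y, sff f x X Y = R X Y := fun X Y => by rw [← heq, sffLin_apply]
  have h01 : i₀ ≠ i₁ := by simp [i₀, i₁]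
  have ha01 : a₀ ≠ a₁ := by simp [a₀, a₁]
  have hH : meanCurvatureVector n f x = γ₁ • η a₁ + γ₂ • η a₂ :=
    meanCurvatureVector_eq_of_sff (μ := μ) (by omega) (by rw [he, if_pos rfl])
        (by rw [he, if_pos rfl])
      (by rw [he, if_neg h01]) hsff
  refine ⟨⟨by rw [he, if_pos rfl], by rw [he, if_pos rfl], by rw [he, if_neg h01],
    by rw [hη, if_pos rfl], by rw [hη, if_pos rfl], by rw [hη, if_neg ha01], h.mem_normal _,
        h.mem_normal _, fun X Y => ?_⟩, hH⟩
  rw [hH]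
  exact hsff X Y

/-- An orthonormal pair completes to an orthonormal frame. -/
lemma exists_orthonormal_extension {V : Type*} [NormedAddCommGroup V] [InnerProductSpace ℝ V]
    [FiniteDimensional ℝ V] {d k : ℕ} (hd : Module.finrank ℝ V = d) {v : Fin k → V}
    (hv : Orthonormal ℝ v) :
    ∃ (hk : k ≤ d) (b : OrthonormalBasis (Fin d) ℝ V), ∀ i, b (Fin.castLE hk i) = v i := by
  have hk : k ≤ d := by
    rw [← hd]
    simpa using hv.linearIndependent.fintype_card_le_finrank
  let v' : Fin d → V := fun i => if h : (i : ℕ) < k then v ⟨i, h⟩ else 0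
  have hv' : Orthonormal ℝ (Set.domRestrict {i : Fin d | (i : ℕ) < k} v') := by
    have : Set.domRestrict {i : Fin d | (i : ℕ) < k} v' =
        v ∘ fun i : {i : Fin d | (i : ℕ) < k} => (⟨i, i.2⟩ : Fin k) := by
      funext i
      have hi : ((i : Fin d) : ℕ) < k := i.2
      simp [v', hi]
    rw [this]
    exact hv.comp _ fun i j hij => Subtype.ext (Fin.ext (congrArg (fun l : Fin k => (l : ℕ)) hij))
  obtain ⟨b, hb⟩ := hv'.exists_orthonormalBasis_extension_of_card_eq (by rw [hd, Fintype.card_fin])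
  refine ⟨hk, b, fun i => ?_⟩
  rw [hb _ (by simp)]
  simp [v']

lemma orthonormal_pair {V : Type*} [NormedAddCommGroup V] [InnerProductSpace ℝ V] {a b : V}
    (ha : (inner ℝ a a : ℝ) = 1) (hb : (inner ℝ b b : ℝ) = 1) (hab : (inner ℝ a b : ℝ) = 0) :
    Orthonormal ℝ ![a, b] := by
  have hba : (inner ℝ b a : ℝ) = 0 := by rw [real_inner_comm, hab]
  rw [orthonormal_iff_ite]
  intro i j
  fin_cases i <;> fin_cases j
  exacts [ha, hab, hba, hb]

lemma orthonormal_triple {V : Type*} [NormedAddCommGroup V] [InnerProductSpace ℝ V] {a b c : V}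
    (ha : (inner ℝ a a : ℝ) = 1) (hb : (inner ℝ b b : ℝ) = 1) (hc : (inner ℝ c c : ℝ) = 1)
    (hab : (inner ℝ a b : ℝ) = 0) (hac : (inner ℝ a c : ℝ) = 0) (hbc : (inner ℝ b c : ℝ) = 0) :
    Orthonormal ℝ ![a, b, c] := by
  have hba : (inner ℝ b a : ℝ) = 0 := by rw [real_inner_comm, hab]
  have hca : (inner ℝ c a : ℝ) = 0 := by rw [real_inner_comm, hac]
  have hcb : (inner ℝ c b : ℝ) = 0 := by rw [real_inner_comm, hbc]
  rw [orthonormal_iff_ite]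
  intro i j
  fin_cases i <;> fin_cases j
  exacts [ha, hab, hac, hba, hb, hbc, hca, hcb, hc]

/-- A second fundamental form of Wintgen type whose mean curvature vector lies in the span of
`η₂` and a third normal direction admits adapted frames. -/
lemma HasWintgenForm.exists_isAdaptedFrame (hinj : Function.Injective (push (𝓡 n) f x))
    (h : HasWintgenForm f x e₁ e₂ η₁ η₂ μ) {η₃ : Euc (n + m)} {γ₁ γ₂ : ℝ}
    (h3 : (inner ℝ η₃ η₃ : ℝ) = 1) (h13 : (inner ℝ η₁ η₃ : ℝ) = 0) (h23 : (inner ℝ η₂ η₃ : ℝ) = 0)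
    (hη₃ : η₃ ∈ normalSpace n f x) (hH : meanCurvatureVector n f x = γ₁ • η₂ + γ₂ • η₃) :
    3 ≤ m ∧ ∃ (e : Fin n → TangentSpace (𝓡 n) x) (η : Fin m → Euc (n + m)),
      IsAdaptedFrame f x e η μ γ₁ γ₂ := by
  have hve := orthonormal_pair h.norm_e₁ h.norm_e₂ h.inner_e
  have hvη : Orthonormal ℝ
      ![(⟨η₁, h.mem_η₁⟩ : normalSpace n f x), ⟨η₂, h.mem_η₂⟩, ⟨η₃, hη₃⟩] :=
    orthonormal_triple h.norm_η₁ h.norm_η₂ h3 h.inner_η h13 h23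
  have hd : Module.finrank ℝ (TangentSpace (𝓡 n) x) = n := finrank_tangentSpace x
  have hext := exists_orthonormal_extension (V := TangentSpace (𝓡 n) x) hd hve
  obtain ⟨hn, e, he⟩ := hext
  have hext' := exists_orthonormal_extension (V := normalSpace n f x) (finrank_normalSpace hinj) hvη
  obtain ⟨hm, η, hη⟩ := hext'
  have heo := orthonormal_iff_ite.1 e.orthonormal
  have hηo : ∀ a b, (inner ℝ (η a : Euc (n + m)) (η b : Euc (n + m)) : ℝ) =
      if a = b then 1 else 0 :=
    orthonormal_iff_ite.1 η.orthonormal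
  have he0 : e₁ = e (Fin.castLE hn 0) := (he 0).symm
  have he1 : e₂ = e (Fin.castLE hn 1) := (he 1).symm
  have hη0 : η₁ = η (Fin.castLE hm 0) := (congrArg Subtype.val (hη 0)).symm
  have hη1 : η₂ = η (Fin.castLE hm 1) := (congrArg Subtype.val (hη 1)).symm
  have hη2 : η₃ = η (Fin.castLE hm 2) := (congrArg Subtype.val (hη 2)).symm
  have key : ∀ (a : Fin m) (i k : Fin n), (inner ℝ (sff f x (e i) (e k)) (η a : Euc (n + m)) : ℝ) =
      (if i = k then 1 else 0) *
        (γ₁ * (if (a : ℕ) = 1 then 1 else 0) + γ₂ * (if (a : ℕ) = 2 then 1 else 0)) +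
        μ * (((if (i : ℕ) = 0 then 1 else 0) * (if (k : ℕ) = 0 then 1 else 0)
          - (if (i : ℕ) = 1 then 1 else 0) * (if (k : ℕ) = 1 then 1 else 0)) *
            (if (a : ℕ) = 0 then 1 else 0)
          + ((if (i : ℕ) = 0 then 1 else 0) * (if (k : ℕ) = 1 then 1 else 0)
          + (if (i : ℕ) = 1 then 1 else 0) * (if (k : ℕ) = 0 then 1 else 0)) *
            (if (a : ℕ) = 1 then 1 else 0)) := by
    intro a i k
    rw [h.sff_eq, hH, he0, he1, hη0, hη1, hη2]
    have c0 : ∀ l : Fin n, l = Fin.castLE hn 0 ↔ (l : ℕ) = 0 := fun l => Fin.ext_iff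
    have c1 : ∀ l : Fin n, l = Fin.castLE hn 1 ↔ (l : ℕ) = 1 := fun l => Fin.ext_iff
    have d0 : Fin.castLE hm 0 = a ↔ (a : ℕ) = 0 := by rw [Fin.ext_iff]; exact eq_comm
    have d1 : Fin.castLE hm 1 = a ↔ (a : ℕ) = 1 := by rw [Fin.ext_iff]; exact eq_comm
    have d2 : Fin.castLE hm 2 = a ↔ (a : ℕ) = 2 := by rw [Fin.ext_iff]; exact eq_comm
    simp only [inner_add_left, real_inner_smul_left, heo, hηo, c0, c1, d0, d1, d2]
  refine ⟨hm, fun i => e i, fun a => η a, e.orthonormal, ?_, fun a => (η a).2, ?_, ?_, ?_, ?_⟩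
  · exact orthonormal_iff_ite.2 hηo
  · intro a i k ha
    rw [key]
    by_cases p1 : (i : ℕ) = 0 <;> by_cases p2 : (k : ℕ) = 0 <;> by_cases p3 : (i : ℕ) = 1 <;>
      by_cases p4 : (k : ℕ) = 1 <;> first | omega | simp [ha, p1, p2, p3, p4]
  · intro a i k ha
    rw [key]
    by_cases p1 : (i : ℕ) = 0 <;> by_cases p2 : (k : ℕ) = 0 <;> by_cases p3 : (i : ℕ) = 1 <;>
      by_cases p4 : (k : ℕ) = 1 <;> first | omega | simp [ha, p1, p2, p3, p4, Fin.ext_iff]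
  · intro a i k ha
    rw [key]
    simp [ha]
  · intro a i k ha
    rw [key]
    simp [show ¬ (a : ℕ) = 0 by omega, show ¬ (a : ℕ) = 1 by omega, show ¬ (a : ℕ) = 2 by omega]

end AdaptedFrames

/-! ### Composing a minimal immersion with the conformal Gauss parametrization -/

section Converse

variable {n m : ℕ} {M : Type*} [TopologicalSpace M] [ChartedSpace (Euc n) M]
  [RiemannianBundle (fun x : M => TangentSpace (𝓡 n) x)]
  {L : Type*} [TopologicalSpace L] [ChartedSpace (Euc 2) L] [IsManifold (𝓡 2) ∞ L]
  {g : L → Euc (n + m)} {τ : L → ℝ} {j : M → L × Euc (n + m)}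

lemma IsGaussData.isIsometricImmersion_comp (h : IsGaussData g τ)
    (hj : IsMinimalVerticalImmersion n g τ Set.univ j) :
    IsIsometricImmersion n (conformalGauss g τ ∘ j) := by
  have hjs : ContMDiff (𝓡 n) ((𝓡 2).prod 𝓘(ℝ, Euc (n + m))) ∞ j := contMDiffOn_univ.1 hj.smooth
  refine ⟨h.contMDiff_conformalGauss.comp hjs, fun x v w => ?_⟩
  rw [push_comp_jStar h.contMDiff_conformalGauss (hjs x),
    push_comp_jStar h.contMDiff_conformalGauss (hjs x)]
  exact hj.isometric x (Set.mem_univ x) v w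

variable [IsManifold (𝓡 n) ∞ M]

/-- Along the relative nullity the second fundamental form of `Ψ ∘ j` is umbilical with factor
`N^Ψ / τ`, because `Ψ_* = -τ N^Ψ_*` on vertical vectors. -/
lemma IsGaussData.sff_comp_of_relativeNullity (h : IsGaussData g τ)
    (hj : IsMinimalVerticalImmersion n g τ Set.univ j) {x : M} {T : TangentSpace (𝓡 n) x}
    (hT : T ∈ relativeNullity n g τ j x) (Y : TangentSpace (𝓡 n) x) :
    sff (conformalGauss g τ ∘ j) x T Y =
      ((inner ℝ T Y : ℝ) * (τ (j x).1)⁻¹) • gaussMap g τ (j x) := by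
  have hjs : ContMDiff (𝓡 n) ((𝓡 2).prod 𝓘(ℝ, Euc (n + m))) ∞ j := contMDiffOn_univ.1 hj.smooth
  have hmem : ∀ᶠ x' in nhds x, j x' ∈ unitNormalBundle g :=
    Filter.Eventually.of_forall fun x' => (hj.mem_regular x' (Set.mem_univ x')).1
  have h1 := hT Y
  rw [h.sffInto_eq (hjs x) hmem (hj.mem_regular x (Set.mem_univ x)), sub_eq_zero] at h1
  have h2 := h.shapeForm_eq (Filter.Eventually.of_forall fun x' => hjs x') hmem T Y
  have hV : tangentFst (j x) (jStar j x T) = 0 := hj.vertical x (Set.mem_univ x) T hT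
  have h3 := (h.push_of_vertical hV).2
  have ht := h.radius_pos (j x).1
  have h4 : push ((𝓡 2).prod 𝓘(ℝ, Euc (n + m))) (gaussMap g τ) (j x) (jStar j x T) =
      -((τ (j x).1)⁻¹ • push ((𝓡 2).prod 𝓘(ℝ, Euc (n + m))) (conformalGauss g τ) (j x)
        (jStar j x T)) := by
    rw [h3, smul_neg, neg_neg, smul_smul, inv_mul_cancel₀ ht.ne', one_smul]
  unfold shapeForm at h2
  rw [h4, inner_neg_left, neg_neg, real_inner_smul_left, hj.isometric x (Set.mem_univ x)] at h2
  rw [h1, ← h2, mul_comm]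

/-- A minimal immersion `j` into `Λ₀` with curvature ellipse of semi-axes `a ⊥ b` and
`⟨A^Ψ j_* e₁, j_* e₂⟩² = ‖a‖² - ‖b‖²` yields a circular curvature ellipse for `Ψ ∘ j`. The normal
frame is obtained from `a`, `b` and `N^Ψ` by a rotation in the plane of `b` and `N^Ψ`. -/
lemma IsGaussData.exists_isAdaptedFrame_comp (hn : n ≠ 0) (h : IsGaussData g τ)
    (hj : IsMinimalVerticalImmersion n g τ Set.univ j) {x : M} {e₁ e₂ : TangentSpace (𝓡 n) x}
    (hfr : IsConullityFrame g τ j x e₁ e₂)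
    (hab : (inner ℝ (sffInto g τ j x e₁ e₁) (sffInto g τ j x e₁ e₂) : ℝ) = 0)
    (ha0 : sffInto g τ j x e₁ e₁ ≠ 0) (hb0 : sffInto g τ j x e₁ e₂ ≠ 0)
    (h11 : shapeForm g τ (j x) (jStar j x e₁) (jStar j x e₁) = 1 / τ (j x).1)
    (h22 : shapeForm g τ (j x) (jStar j x e₂) (jStar j x e₂) = 1 / τ (j x).1)
    (h12 : shapeForm g τ (j x) (jStar j x e₁) (jStar j x e₂) ^ 2
      = ‖sffInto g τ j x e₁ e₁‖ ^ 2 - ‖sffInto g τ j x e₁ e₂‖ ^ 2)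
    (hpos : 0 < ‖sffInto g τ j x e₁ e₁‖ ^ 2 - ‖sffInto g τ j x e₁ e₂‖ ^ 2) :
    meanCurvatureVector n (conformalGauss g τ ∘ j) x = (τ (j x).1)⁻¹ • gaussMap g τ (j x) ∧
    ∃ (η₁ η₂ η₃ : Euc (n + m)) (μ γ₁ γ₂ : ℝ),
      HasWintgenForm (conformalGauss g τ ∘ j) x e₁ e₂ η₁ η₂ μ ∧
      (inner ℝ η₃ η₃ : ℝ) = 1 ∧ (inner ℝ η₁ η₃ : ℝ) = 0 ∧ (inner ℝ η₂ η₃ : ℝ) = 0 ∧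
      η₃ ∈ normalSpace n (conformalGauss g τ ∘ j) x ∧
      meanCurvatureVector n (conformalGauss g τ ∘ j) x = γ₁ • η₂ + γ₂ • η₃ ∧
      μ ≠ 0 ∧ γ₁ * γ₂ ≠ 0 := by
  have hjs : ContMDiff (𝓡 n) ((𝓡 2).prod 𝓘(ℝ, Euc (n + m))) ∞ j := contMDiffOn_univ.1 hj.smooth
  have hmem : ∀ᶠ x' in nhds x, j x' ∈ unitNormalBundle g :=
    Filter.Eventually.of_forall fun x' => (hj.mem_regular x' (Set.mem_univ x')).1
  have hreg := hj.mem_regular x (Set.mem_univ x)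
  have hs := h.sffInto_eq (hjs x) hmem hreg
  have hsh := h.shapeForm_eq (Filter.Eventually.of_forall fun x' => hjs x') hmem
  have hN := h.gaussMap_mem_normalSpace (hjs x) hmem
  have hνν := inner_gaussMap_self h hreg.1
  have ht := h.radius_pos (j x).1
  have hker := fun T => h.sff_comp_of_relativeNullity hj (x := x) (T := T)
  have hf := h.isIsometricImmersion_comp hj
  have hmin := hj.minimal x (Set.mem_univ x)
  rw [hsh] at h11 h22 h12
  obtain ⟨hn1, hn2, he12, hnull⟩ := hfr
  have he1 : (inner ℝ e₁ e₁ : ℝ) = 1 := by rw [real_inner_self_eq_norm_sq, hn1, one_pow]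
  have he2 : (inner ℝ e₂ e₂ : ℝ) = 1 := by rw [real_inner_self_eq_norm_sq, hn2, one_pow]
  set f := conformalGauss g τ ∘ j
  set ν := gaussMap g τ (j x)
  set t := τ (j x).1
  have hsm : ∀ X Y, sffInto g τ j x X Y ∈ normalSpace n f x := fun X Y => by
    rw [hs]
    exact Submodule.sub_mem _ (sff_mem_normalSpace f x X Y) (Submodule.smul_mem _ _ hN)
  have hνs : ∀ X Y, (inner ℝ ν (sffInto g τ j x X Y) : ℝ) = 0 := fun X Y => by
    rw [hs, inner_sub_right, real_inner_smul_right, hνν, mul_one, sub_self]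
  -- The difference between the second fundamental form and its umbilical part `⟨X, Y⟩ ν / t`.
  let γ : TangentSpace (𝓡 n) x →ₗ[ℝ] TangentSpace (𝓡 n) x →ₗ[ℝ] Euc (n + m) :=
    sffLin f x - LinearMap.mk₂ ℝ (fun X Y => ((inner ℝ X Y : ℝ) * t⁻¹) • ν)
      (fun X X' Y => by rw [inner_add_left]; module)
      (fun c X Y => by rw [real_inner_smul_left]; module)
      (fun X Y Y' => by rw [inner_add_right]; module)
      (fun c X Y => by rw [real_inner_smul_right]; module)
  have hγ : ∀ X Y, γ X Y = sff f x X Y - ((inner ℝ X Y : ℝ) * t⁻¹) • ν := fun X Y => rfl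
  have hexp := bilin_eq_of_kernel γ (fun X Y => by
      rw [hγ, hγ, sff_symm hf.smooth.contMDiffAt, real_inner_comm]) he1 he2 he12
    (fun T h1 h2 Y => by rw [hγ, hker T ((hnull T).2 ⟨h1, h2⟩) Y, sub_self])
  have hsγ : ∀ X Y, sffInto g τ j x X Y = γ X Y - (inner ℝ ν (γ X Y) : ℝ) • ν := fun X Y => by
    rw [hs, hγ, inner_sub_right, real_inner_smul_right, hνν]
    module
  set a := sffInto g τ j x e₁ e₁
  set b := sffInto g τ j x e₁ e₂
  set θ : ℝ := inner ℝ ν (sff f x e₁ e₂)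
  have hγ11 : γ e₁ e₁ = a := by
    rw [hγ, he1, show a = _ from hs e₁ e₁, h11, one_mul, one_div]
  have hγ12 : γ e₁ e₂ = b + θ • ν := by
    rw [hγ, he12, show b = _ from hs e₁ e₂, zero_mul, zero_smul, sub_zero, sub_add_cancel]
  have hγ22' : γ e₂ e₂ = sffInto g τ j x e₂ e₂ := by
    rw [hγ, he2, hs e₂ e₂, h22, one_mul, one_div]
  -- Minimality of `j`: the trace of `α_j` is `α_j(e₁, e₁) + α_j(e₂, e₂)`.
  have hγ22 : γ e₂ e₂ = -a := by
    have hsum : ∑ i, γ (tangentBasis n x i) (tangentBasis n x i) = γ e₁ e₁ + γ e₂ e₂ := by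
      simp only [hexp (tangentBasis n x _) (tangentBasis n x _), Finset.sum_add_distrib,
        ← Finset.sum_smul, sum_sq_inner, he1, he2, he12, real_inner_comm e₁ e₂]
      module
    simp only [hsγ, Finset.sum_sub_distrib, ← Finset.sum_smul, ← inner_sum] at hmin
    rw [hsum, hγ11, hγ22', inner_add_right, hνs, hνs, add_zero, zero_smul, sub_zero] at hmin
    rw [hγ22']
    exact eq_neg_of_add_eq_zero_right hmin
  have hκ1 : 0 < ‖a‖ := norm_pos_iff.2 ha0
  have hκ2 : 0 < ‖b‖ := norm_pos_iff.2 hb0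
  have hθ : θ ≠ 0 := by
    intro h0
    rw [h0] at h12
    rw [← h12] at hpos
    norm_num at hpos
  have haa : (inner ℝ a a : ℝ) = ‖a‖ ^ 2 := real_inner_self_eq_norm_sq a
  have hbb : (inner ℝ b b : ℝ) = ‖b‖ ^ 2 := real_inner_self_eq_norm_sq b
  have hνa : (inner ℝ ν a : ℝ) = 0 := hνs e₁ e₁
  have hνb : (inner ℝ ν b : ℝ) = 0 := hνs e₁ e₂
  have haν : (inner ℝ a ν : ℝ) = 0 := by rw [real_inner_comm, hνa]
  have hbν : (inner ℝ b ν : ℝ) = 0 := by rw [real_inner_comm, hνb]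
  have ham : a ∈ normalSpace n f x := hsm e₁ e₁
  have hbm : b ∈ normalSpace n f x := hsm e₁ e₂
  have hsff : ∀ X Y : TangentSpace (𝓡 n) x, sff f x X Y = (inner ℝ X Y : ℝ) • (t⁻¹ • ν) +
      ‖a‖ • (((inner ℝ X e₁ : ℝ) * inner ℝ Y e₁ - (inner ℝ X e₂ : ℝ) * inner ℝ Y e₂) • (‖a‖⁻¹ • a) +
      ((inner ℝ X e₁ : ℝ) * inner ℝ Y e₂ + (inner ℝ X e₂ : ℝ) * inner ℝ Y e₁) •
        (‖a‖⁻¹ • (b + θ • ν))) := by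
    intro X Y
    have h1 := hexp X Y
    rw [hγ X Y, hγ11, hγ12, hγ22, sub_eq_iff_eq_add] at h1
    rw [h1]
    match_scalars <;> field_simp <;> ring
  clear_value a b θ ν t
  have hH : meanCurvatureVector n f x = t⁻¹ • ν := meanCurvatureVector_eq_of_sff hn he1 he2 he12
      hsff
  -- Since `‖b + θ ν‖² = ‖b‖² + θ² = ‖a‖²`, the ellipse is a circle of radius `‖a‖`. The vector `η₃`
  -- is orthogonal to `b + θ ν` in the plane of `b` and `ν`, and `γ₁`, `γ₂` are the components of
  -- `ν / t` in the resulting frame.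
  refine ⟨hH, ‖a‖⁻¹ • a, ‖a‖⁻¹ • (b + θ • ν), (‖a‖ * ‖b‖)⁻¹ • (θ • b - ‖b‖ ^ 2 • ν), ‖a‖,
    θ / (t * ‖a‖), -‖b‖ / (t * ‖a‖), ⟨he1, he2, he12, ?_, ?_, ?_, ?_, ?_, ?_⟩, ?_, ?_, ?_, ?_, ?_,
    hκ1.ne', ?_⟩
  · rw [real_inner_smul_left, real_inner_smul_right, haa]
    field_simp
  · simp only [real_inner_smul_left, real_inner_smul_right, inner_add_left, inner_add_right, hbb,
      hbν, hνb, hνν]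
    field_simp
    linarith
  · simp only [real_inner_smul_left, real_inner_smul_right, inner_add_right, hab, haν]
    ring
  · exact Submodule.smul_mem _ _ ham
  · exact Submodule.smul_mem _ _ (Submodule.add_mem _ hbm (Submodule.smul_mem _ _ hN))
  · intro X Y
    rw [hH]
    exact hsff X Y
  · simp only [real_inner_smul_left, real_inner_smul_right, inner_sub_left, inner_sub_right, hbb,
      hbν, hνb, hνν]
    field_simp
    linarith
  · simp only [real_inner_smul_left, real_inner_smul_right, inner_sub_right, hab, haν]
    ring
  · simp only [real_inner_smul_left, real_inner_smul_right, inner_add_left, inner_sub_right, hbb,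
      hbν, hνb, hνν]
    ring
  · exact Submodule.smul_mem _ _ (Submodule.sub_mem _ (Submodule.smul_mem _ _ hbm)
      (Submodule.smul_mem _ _ hN))
  · rw [hH]
    match_scalars
    · field_simp
      linarith
    · field_simp
      ring
  · have hden := mul_ne_zero ht.ne' hκ1.ne'
    exact mul_ne_zero (div_ne_zero hθ hden) (div_ne_zero (neg_ne_zero.2 hκ2.ne') hden)

theorem IsGaussData.isGenericWintgen_comp (hn : 2 ≤ n) (h : IsGaussData g τ)
    (hj : IsMinimalVerticalImmersion n g τ Set.univ j)
    (hfr : ∀ x : M, ∃ e₁ e₂ : TangentSpace (𝓡 n) x,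
      IsConullityFrame g τ j x e₁ e₂ ∧
      AreSemiAxes (curvatureEllipse n g τ j x) (sffInto g τ j x e₁ e₁) (sffInto g τ j x e₁ e₂) ∧
      sffInto g τ j x e₁ e₁ ≠ 0 ∧ sffInto g τ j x e₁ e₂ ≠ 0 ∧
      shapeForm g τ (j x) (jStar j x e₁) (jStar j x e₁) = 1 / τ (j x).1 ∧
      shapeForm g τ (j x) (jStar j x e₂) (jStar j x e₂) = 1 / τ (j x).1 ∧
      shapeForm g τ (j x) (jStar j x e₁) (jStar j x e₂) ^ 2
        = ‖sffInto g τ j x e₁ e₁‖ ^ 2 - ‖sffInto g τ j x e₁ e₂‖ ^ 2 ∧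
      0 < ‖sffInto g τ j x e₁ e₁‖ ^ 2 - ‖sffInto g τ j x e₁ e₂‖ ^ 2) :
    IsGenericWintgen (conformalGauss g τ ∘ j) ∧
      ∀ x, meanCurvature n (conformalGauss g τ ∘ j) x = 1 / τ (j x).1 := by
  have hf := h.isIsometricImmersion_comp hj
  have hn0 : n ≠ 0 := by omega
  refine ⟨⟨⟨hf, fun x => ?_⟩, fun x => ?_⟩, fun x => ?_⟩
  all_goals
    obtain ⟨e₁, e₂, h1, h2, h3, h4, h5, h6, h7, h8⟩ := hfr x
    obtain ⟨hν', η₁, η₂, η₃, μ, γ₁, γ₂, hw, h3, h13, h23, hm, hH, hμ, hγ⟩ :=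
      h.exists_isAdaptedFrame_comp hn0 hj h1 h2.1 h3 h4 h5 h6 h7 h8
  · exact hw.ddvv_eq hn hf
  · obtain ⟨hm3, e, η, hfr'⟩ := hw.exists_isAdaptedFrame (hf.push_injective x) h3 h13 h23 hm hH
    exact ⟨hm3, e, η, μ, γ₁, γ₂, hfr', hμ, hγ⟩
  · have hν : ‖gaussMap g τ (j x)‖ = 1 := by
      have := inner_gaussMap_self h (hj.mem_regular x (Set.mem_univ x)).1
      rw [real_inner_self_eq_norm_sq] at this
      exact (pow_eq_one_iff_of_nonneg (norm_nonneg _) two_ne_zero).1 this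
    rw [meanCurvature, hν', norm_smul, hν, mul_one, norm_inv, one_div,
      Real.norm_of_nonneg (h.radius_pos _).le]

end Converse

/-! ### The Codazzi equation and parallel mean curvature along `E` -/

section Codazzi

variable {k N : ℕ}

/-- A function dominated by the product of two functions vanishing at `z` has derivative zero
at `z`. -/
lemma fderiv_eq_zero_of_norm_mul {Y W : Type*} [NormedAddCommGroup Y] [NormedSpace ℝ Y]
    [NormedAddCommGroup W] [NormedSpace ℝ W] {u v w : Y → W} {c : Y → ℝ} {z : Y}
    (h : ∀ᶠ z' in nhds z, ‖u z'‖ * c z' = ‖v z'‖ * ‖w z'‖) (hc : ContinuousAt c z) (hcz : 0 < c z)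
    (hv : DifferentiableAt ℝ v z) (hw : DifferentiableAt ℝ w z) (hvz : v z = 0) (hwz : w z = 0) :
    fderiv ℝ u z = 0 := by
  have h1 : v =O[nhds z] fun z' => z' - z := by
    simpa [hvz] using hv.isBigO_sub
  have h2 : w =O[nhds z] fun z' => z' - z := by
    simpa [hwz] using hw.isBigO_sub
  have h3 : u =O[nhds z] fun z' => ‖v z'‖ * ‖w z'‖ := by
    refine Asymptotics.IsBigO.of_bound (2 / c z) ?_
    filter_upwards [h, hc.eventually (lt_mem_nhds (half_lt_self hcz))] with z' hz hz'
    rw [← hz, Real.norm_of_nonneg (mul_nonneg (norm_nonneg _) ((half_pos hcz).trans hz').le)]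
    have h5 : 1 ≤ 2 / c z * c z' := by
      rw [div_mul_eq_mul_div, one_le_div hcz]
      linarith
    nlinarith [norm_nonneg (u z')]
  have h4 : u =O[nhds z] fun z' => ‖z' - z‖ ^ 2 := by
    refine h3.trans ?_
    simpa [sq] using h1.norm_norm.mul h2.norm_norm
  exact (h4.hasFDerivAt (by norm_num)).fderiv

/-- The normal part of the derivative of `α - ⟨·, ·⟩ ℋ` in an umbilical direction `u`: apart from
the last term the right-hand side is symmetric in `u`, `v`, `w`. -/
lemma inner_fderiv_traceless {F ℋ : Euc k → Euc N} {z : Euc k} (hF : ContDiffAt ℝ ∞ F z)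
    (hinj : Function.Injective (fderiv ℝ F z)) (hℋ : DifferentiableAt ℝ ℋ z) {ζ : Euc N}
    (hζ : ∀ c, (inner ℝ ζ (fderiv ℝ F z c) : ℝ) = 0) {u : Euc k} (v w : Euc k)
    (hu : ∀ c, localSff F z u c = (inner ℝ (fderiv ℝ F z u) (fderiv ℝ F z c) : ℝ) • ℋ z) :
    (inner ℝ ζ (fderiv ℝ (fun z' => localSff F z' v w -
        (inner ℝ (fderiv ℝ F z' v) (fderiv ℝ F z' w) : ℝ) • ℋ z') z u) : ℝ) =
      inner ℝ ζ (fderiv ℝ (fun z' => fderiv ℝ (fderiv ℝ F) z' v w) z u)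
      - (inner ℝ (fderiv ℝ F z u) (fderiv ℝ (fderiv ℝ F) z v w)
        + inner ℝ (fderiv ℝ F z w) (fderiv ℝ (fderiv ℝ F) z u v)
        + inner ℝ (fderiv ℝ F z v) (fderiv ℝ (fderiv ℝ F) z u w)) * inner ℝ ζ (ℋ z)
      - inner ℝ (fderiv ℝ F z v) (fderiv ℝ F z w) * inner ℝ ζ (fderiv ℝ ℋ z u) := by
  have hF1 := contDiffAt_fderiv hF
  have hS := contDiffAt_fderiv_fderiv_apply hF v w
  have hΓ : DifferentiableAt ℝ (fun z' => pseudoInverse (fderiv ℝ F z')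
      (fderiv ℝ (fderiv ℝ F) z' v w)) z :=
    differentiableAt_of_smooth ((contDiffAt_pseudoInverse hF1 hinj).clm_apply hS)
  have hcong : (fun z' => localSff F z' v w -
        (inner ℝ (fderiv ℝ F z' v) (fderiv ℝ F z' w) : ℝ) • ℋ z') =ᶠ[nhds z]
      fun z' => fderiv ℝ (fderiv ℝ F) z' v w - fderiv ℝ F z' (pseudoInverse (fderiv ℝ F z')
      (fderiv ℝ (fderiv ℝ F) z' v w)) - (inner ℝ (fderiv ℝ F z' v) (fderiv ℝ F z' w) : ℝ) • ℋ z' :=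
          by
    filter_upwards [eventually_injective hF1.continuousAt hinj] with z' hz'
    rw [localSff_eq hz']
  have hv := hasFDerivAt_fderiv_apply hF (hasFDerivAt_const v z)
  have hw := hasFDerivAt_fderiv_apply hF (hasFDerivAt_const w z)
  have hd := (((differentiableAt_of_smooth hS).hasFDerivAt.sub
    (hasFDerivAt_fderiv_apply hF hΓ.hasFDerivAt)).sub ((hv.inner ℝ hw).smul hℋ.hasFDerivAt))
  rw [hcong.fderiv_eq]
  set Γ := pseudoInverse (fderiv ℝ F z) (fderiv ℝ (fderiv ℝ F) z v w) with hΓdef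
  have h1 : (inner ℝ ζ (fderiv ℝ (fderiv ℝ F) z u Γ) : ℝ) =
      inner ℝ (fderiv ℝ F z u) (fderiv ℝ (fderiv ℝ F) z v w) * inner ℝ ζ (ℋ z) := by
    have h2 := inner_normalProj_of_normal F z (fderiv ℝ (fderiv ℝ F) z u Γ) hζ
    have h3 : normalProj F z (fderiv ℝ (fderiv ℝ F) z u Γ) = _ := hu Γ
    rw [h3, real_inner_smul_left, real_inner_comm (fderiv ℝ F z Γ),
      inner_apply_pseudoInverse hinj, real_inner_comm ζ, real_inner_comm ζ,
      real_inner_comm (fderiv ℝ F z u)] at h2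
    exact h2.symm
  refine (congrArg (fun A : Euc k →L[ℝ] Euc N => (inner ℝ ζ (A u) : ℝ)) hd.fderiv).trans ?_
  simp only [sub_apply, add_apply, smul_apply, ContinuousLinearMap.comp_apply,
    ContinuousLinearMap.flip_apply, ContinuousLinearMap.smulRight_apply, inner_sub_right,
    inner_add_right, real_inner_smul_right, hζ, h1]
  simp [fderivInnerCLM_apply]
  rw [real_inner_comm (fderiv ℝ F z w) (fderiv ℝ (fderiv ℝ F) z u v)]
  ring

lemma contDiffAt_traceless {F ℋ : Euc k → Euc N} {z : Euc k} (hF : ContDiffAt ℝ ∞ F z)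
    (hinj : Function.Injective (fderiv ℝ F z)) (hℋ : ContDiffAt ℝ ∞ ℋ z) (v w : Euc k) :
    ContDiffAt ℝ ∞ (fun z' => localSff F z' v w -
        (inner ℝ (fderiv ℝ F z' v) (fderiv ℝ F z' w) : ℝ) • ℋ z') z := by
  have hF1 := contDiffAt_fderiv hF
  have h1 : ContDiffAt ℝ ∞ (fun z' => localSff F z' v w) z :=
    contDiffAt_normalProj hF hinj (contDiffAt_fderiv_fderiv_apply hF v w)
  exact h1.sub (((hF1.clm_apply contDiffAt_const).inner ℝ (hF1.clm_apply contDiffAt_const)).smul hℋ)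

variable {n : ℕ} {M : Type*} [TopologicalSpace M] [ChartedSpace (Euc n) M]
  [RiemannianBundle (fun x : M => TangentSpace (𝓡 n) x)]
  {f : M → Euc N} {x : M} {e₁ e₂ : TangentSpace (𝓡 n) x} {η₁ η₂ : Euc N} {μ : ℝ}

lemma HasWintgenForm.norm_sq_traceless (h : HasWintgenForm f x e₁ e₂ η₁ η₂ μ)
    (X Y : TangentSpace (𝓡 n) x) :
    ‖sff f x X Y - (inner ℝ X Y : ℝ) • meanCurvatureVector n f x‖ ^ 2 =
      μ ^ 2 * ((inner ℝ X e₁ : ℝ) ^ 2 + (inner ℝ X e₂ : ℝ) ^ 2) *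
        ((inner ℝ Y e₁ : ℝ) ^ 2 + (inner ℝ Y e₂ : ℝ) ^ 2) := by
  have h21 : (inner ℝ η₂ η₁ : ℝ) = 0 := by rw [real_inner_comm, h.inner_η]
  rw [h.sff_eq, add_sub_cancel_left, ← real_inner_self_eq_norm_sq]
  simp only [inner_add_left, inner_add_right, real_inner_smul_left, real_inner_smul_right,
    h.norm_η₁, h.norm_η₂, h.inner_η, h21]
  ring

/-- The trace-free part `β` of the second fundamental form is conformal on the plane of
`e₁, e₂`, whence `|β(X, Y)| |β(Z, Z)| = |β(X, Z)| |β(Y, Z)|`. -/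
lemma HasWintgenForm.norm_mul_norm (h : HasWintgenForm f x e₁ e₂ η₁ η₂ μ)
    (X Y Z : TangentSpace (𝓡 n) x) :
    ‖sff f x X Y - (inner ℝ X Y : ℝ) • meanCurvatureVector n f x‖ *
      ‖sff f x Z Z - (inner ℝ Z Z : ℝ) • meanCurvatureVector n f x‖ =
    ‖sff f x X Z - (inner ℝ X Z : ℝ) • meanCurvatureVector n f x‖ *
      ‖sff f x Y Z - (inner ℝ Y Z : ℝ) • meanCurvatureVector n f x‖ := by
  rw [← sq_eq_sq₀ (by positivity) (by positivity), mul_pow, mul_pow]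
  simp only [h.norm_sq_traceless]
  ring

lemma HasWintgenForm.mem_meanCurvatureDistribution (h : HasWintgenForm f x e₁ e₂ η₁ η₂ μ)
    (hμ : μ ≠ 0) {T : TangentSpace (𝓡 n) x} :
    T ∈ meanCurvatureDistribution f x ↔ (inner ℝ T e₁ : ℝ) = 0 ∧ (inner ℝ T e₂ : ℝ) = 0 := by
  constructor
  · intro hT
    have h1 := h.norm_sq_traceless T e₁
    have h21 : (inner ℝ e₁ e₂ : ℝ) = 0 := h.inner_e
    rw [hT e₁, sub_self, norm_zero, h.norm_e₁, h21] at h1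
    have h2 : (inner ℝ T e₁ : ℝ) ^ 2 + (inner ℝ T e₂ : ℝ) ^ 2 = 0 := by
      have hμ2 : μ ^ 2 ≠ 0 := pow_ne_zero 2 hμ
      apply mul_left_cancel₀ hμ2
      linarith
    constructor <;> nlinarith [sq_nonneg (inner ℝ T e₁ : ℝ), sq_nonneg (inner ℝ T e₂ : ℝ)]
  · rintro ⟨h1, h2⟩ Y
    rw [h.sff_eq, h1, h2]
    simp

variable [IsManifold (𝓡 n) ∞ M]

/-- The mean curvature vector is parallel in the normal connection along `E`. This is the Codazzi
equation for `(T, S, S)` with `S ∈ E` a nonzero vector orthogonal to `T`; it needs `dim E ≥ 2`. The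
trace-free part of the second fundamental form has vanishing derivatives on `E × E`
although `E` itself varies, because it vanishes to second order there. -/
lemma inner_push_meanCurvatureVector (hn : 4 ≤ n) (hf : IsIsometricImmersion n f)
    (hw : ∀ y : M, ∃ (e₁ e₂ : TangentSpace (𝓡 n) y) (η₁ η₂ : Euc N) (μ : ℝ),
      HasWintgenForm f y e₁ e₂ η₁ η₂ μ)
    (h : HasWintgenForm f x e₁ e₂ η₁ η₂ μ) (hμ : μ ≠ 0) {T : TangentSpace (𝓡 n) x}
    (hT : T ∈ meanCurvatureDistribution f x) {ζ : Euc N} (hζ : ζ ∈ normalSpace n f x) :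
    (inner ℝ ζ (push (𝓡 n) (meanCurvatureVector n f) x T) : ℝ) = 0 := by
  have hx := mem_extChartAt_source (I := 𝓡 n) x
  have hℋs := contMDiff_meanCurvatureVector hf
  obtain ⟨S, hS1, hS2, hS3, hS4⟩ : ∃ S : TangentSpace (𝓡 n) x, S ≠ 0 ∧ (inner ℝ S e₁ : ℝ) = 0 ∧
      (inner ℝ S e₂ : ℝ) = 0 ∧ (inner ℝ S T : ℝ) = 0 := by
    set K := Submodule.span ℝ (Set.range ![e₁, e₂, T])
    have h1 := Submodule.finrank_add_finrank_orthogonal K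
    have h2 : Module.finrank ℝ K ≤ 3 := finrank_range_le_card ![e₁, e₂, T]
    have hd : Module.finrank ℝ (TangentSpace (𝓡 n) x) = n := finrank_tangentSpace x
    have h3 : Kᗮ ≠ ⊥ := by
      intro h0
      rw [h0, finrank_bot, hd] at h1
      omega
    obtain ⟨S, hS, hS0⟩ := Submodule.exists_mem_ne_zero_of_ne_bot h3
    have h4 : ∀ i, (inner ℝ S (![e₁, e₂, T] i) : ℝ) = 0 := fun i => by
      rw [real_inner_comm]
      exact hS _ (Submodule.subset_span ⟨i, rfl⟩)
    exact ⟨S, hS0, h4 0, h4 1, h4 2⟩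
  have hSE : S ∈ meanCurvatureDistribution (n := n) f x :=
      (h.mem_meanCurvatureDistribution hμ).2 ⟨hS2, hS3⟩
  set F := chartRep (k := n) x f
  set ℋ := chartRep (k := n) x (meanCurvatureVector n f)
  set z₀ := extChartAt (𝓡 n) x x
  have hF : ContDiffAt ℝ ∞ F z₀ := contDiffAt_chartRep_apply hx hf.smooth.contMDiffAt
  have hℋ : ContDiffAt ℝ ∞ ℋ z₀ := contDiffAt_chartRep_apply hx hℋs.contMDiffAt
  have hinj : Function.Injective (fderiv ℝ F z₀) := hf.fderiv_injective hx
  -- The trace-free part of the second fundamental form, in coordinates.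
  set B : Euc n → Euc n → Euc n → Euc N := fun z a b => localSff F z a b -
    (inner ℝ (fderiv ℝ F z a) (fderiv ℝ F z b) : ℝ) • ℋ z with hB
  have hBs : ∀ a b, ContDiffAt ℝ ∞ (fun z => B z a b) z₀ := contDiffAt_traceless hF hinj hℋ
  have hBy : ∀ y ∈ (extChartAt (𝓡 n) x).source, ∀ U V : TangentSpace (𝓡 n) y,
      B (extChartAt (𝓡 n) x y) (chartDeriv x y U) (chartDeriv x y V) =
        sff f y U V - (inner ℝ U V : ℝ) • meanCurvatureVector n f y := by
    intro y hy U V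
    simp only [hB]
    rw [← sff_eq_localSff hy hf.smooth.contMDiffAt, ← push_eq_fderiv hy hf.smooth.contMDiffAt,
      ← push_eq_fderiv hy hf.smooth.contMDiffAt, hf.isometric]
    congr 2
    exact chartRep_apply _ hy
  have hnorm : ∀ᶠ z in nhds z₀, ∀ a b c, ‖B z a b‖ * ‖B z c c‖ = ‖B z a c‖ * ‖B z b c‖ := by
    filter_upwards [extChartAt_target_mem_nhds (I := 𝓡 n) x] with z hz a b c
    have hy := (extChartAt (𝓡 n) x).map_target hz
    set y := (extChartAt (𝓡 n) x).symm z
    have hzy : extChartAt (𝓡 n) x y = z := (extChartAt (𝓡 n) x).right_inv hz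
    obtain ⟨a, rfl⟩ := (chartDeriv_bijective (k := n) hy).2 a
    obtain ⟨b, rfl⟩ := (chartDeriv_bijective (k := n) hy).2 b
    obtain ⟨c, rfl⟩ := (chartDeriv_bijective (k := n) hy).2 c
    obtain ⟨_, _, _, _, _, h'⟩ := hw y
    rw [← hzy, hBy y hy, hBy y hy, hBy y hy, hBy y hy]
    exact h'.norm_mul_norm a b c
  have hzero : ∀ U ∈ meanCurvatureDistribution f x, ∀ c, B z₀ (chartDeriv x x U) c = 0 := by
    intro U hU c
    obtain ⟨c, rfl⟩ := (chartDeriv_bijective (k := n) hx).2 c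
    rw [hBy x hx, hU c, sub_self]
  have hpos : 0 < ‖B z₀ (chartDeriv x x e₁) (chartDeriv x x e₁)‖ := by
    rw [norm_pos_iff, hBy x hx]
    intro h0
    have h1 := h.norm_sq_traceless e₁ e₁
    rw [h0, norm_zero, h.norm_e₁, h.inner_e] at h1
    exact hμ (by nlinarith)
  have hder : ∀ U ∈ meanCurvatureDistribution f x, ∀ V ∈ meanCurvatureDistribution f x,
      fderiv ℝ (fun z => B z (chartDeriv x x U) (chartDeriv x x V)) z₀ = 0 := fun U hU V hV =>
    fderiv_eq_zero_of_norm_mul (hnorm.mono fun z hz => hz _ _ (chartDeriv x x e₁))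
      (hBs _ _).continuousAt.norm hpos (differentiableAt_of_smooth (hBs _ _))
      (differentiableAt_of_smooth (hBs _ _)) (hzero U hU _) (hzero V hV _)
  have humb : ∀ U ∈ meanCurvatureDistribution f x, ∀ c, localSff F z₀ (chartDeriv x x U) c =
      (inner ℝ (fderiv ℝ F z₀ (chartDeriv x x U)) (fderiv ℝ F z₀ c) : ℝ) • ℋ z₀ :=
    fun U hU c => sub_eq_zero.1 (hzero U hU c)
  have hζF : ∀ c, (inner ℝ ζ (fderiv ℝ F z₀ c) : ℝ) = 0 := by
    intro c
    obtain ⟨c, rfl⟩ := (chartDeriv_bijective (k := n) hx).2 c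
    rw [← push_eq_fderiv hx hf.smooth.contMDiffAt]
    exact mem_normalSpace.1 hζ c
  -- The normal derivatives of `β(S, S)` along `T` and of `β(T, S)` along `S` both vanish. Their
  -- expansions agree up to the terms `⟨S, S⟩ ∇^⊥_T ℋ` and `⟨T, S⟩ ∇^⊥_S ℋ = 0`.
  have h1 := inner_fderiv_traceless hF hinj (differentiableAt_of_smooth hℋ) hζF
    (chartDeriv x x S) (chartDeriv x x S) (humb T hT)
  have h2 := inner_fderiv_traceless hF hinj (differentiableAt_of_smooth hℋ) hζF
    (chartDeriv x x T) (chartDeriv x x S) (humb S hSE)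
  have h1' := hder S hSE S hSE
  have h2' := hder T hT S hSE
  simp only [hB] at h1' h2'
  rw [h1', zero_apply, inner_zero_right] at h1
  rw [h2', zero_apply, inner_zero_right] at h2
  rw [fderiv_fderiv_fderiv_symm hF, fderiv_fderiv_symm hF (chartDeriv x x S) (chartDeriv x x T),
    ← push_eq_fderiv hx hf.smooth.contMDiffAt T, ← push_eq_fderiv hx hf.smooth.contMDiffAt S,
    hf.isometric, real_inner_comm S T, hS4] at h2
  rw [← push_eq_fderiv hx hf.smooth.contMDiffAt T, ← push_eq_fderiv hx hf.smooth.contMDiffAt S,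
    hf.isometric, ← push_eq_fderiv hx hℋs.contMDiffAt T] at h1
  have hSS : (inner ℝ S S : ℝ) ≠ 0 := inner_self_ne_zero.2 hS1
  apply mul_left_cancel₀ hSS
  linarith

end Codazzi

/-! ### The focal map -/

section FocalMap

variable {n m : ℕ} {M : Type*} [TopologicalSpace M] [ChartedSpace (Euc n) M]
  [RiemannianBundle (fun x : M => TangentSpace (𝓡 n) x)] {f : M → Euc (n + m)}

/-- The focal map `h = f + ℋ / H²`. -/
def focalMap (f : M → Euc (n + m)) (x : M) : Euc (n + m) :=
  f x + (1 / meanCurvature n f x ^ 2) • meanCurvatureVector n f x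

/-- The content of an adapted frame without the vectors `e₃, …, eₙ` and `η₃, …, ηₘ`: `ℋ` is
orthogonal to `η₁`, has a nonzero component along `η₂` and a nonzero component outside the plane of
the curvature circle. -/
structure IsGenericForm (f : M → Euc (n + m)) (x : M) (e₁ e₂ : TangentSpace (𝓡 n) x)
    (η₁ η₂ : Euc (n + m)) (μ γ : ℝ) : Prop extends HasWintgenForm f x e₁ e₂ η₁ η₂ μ where
  radius_ne : μ ≠ 0
  inner_one : (inner ℝ (meanCurvatureVector n f x) η₁ : ℝ) = 0
  inner_two : (inner ℝ (meanCurvatureVector n f x) η₂ : ℝ) = γ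
  ne_zero : γ ≠ 0
  sq_lt : γ ^ 2 < meanCurvature n f x ^ 2

lemma IsAdaptedFrame.isGenericForm {x : M} (hn : 2 ≤ n) (hm : 3 ≤ m)
    {e : Fin n → TangentSpace (𝓡 n) x} {η : Fin m → Euc (n + m)} {μ γ₁ γ₂ : ℝ}
    (hinj : Function.Injective (push (𝓡 n) f x)) (h : IsAdaptedFrame f x e η μ γ₁ γ₂) (hμ : μ ≠ 0)
    (hγ : γ₁ * γ₂ ≠ 0) :
    IsGenericForm f x (e ⟨0, by omega⟩) (e ⟨1, by omega⟩) (η ⟨0, by omega⟩) (η ⟨1, by omega⟩)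
      μ γ₁ := by
  obtain ⟨h1, h2⟩ := h.hasWintgenForm hn hm hinj
  have hη := orthonormal_iff_ite.1 h.orthonormal_normal
  refine ⟨h1, hμ, ?_, ?_, left_ne_zero_of_mul hγ, ?_⟩
  · rw [h2, inner_add_left, real_inner_smul_left, real_inner_smul_left, hη, hη]
    simp
  · rw [h2, inner_add_left, real_inner_smul_left, real_inner_smul_left, hη, hη]
    simp
  · have h3 : meanCurvature n f x ^ 2 = γ₁ ^ 2 + γ₂ ^ 2 := by
      rw [meanCurvature, ← real_inner_self_eq_norm_sq, h2]
      simp only [inner_add_left, inner_add_right, real_inner_smul_left, real_inner_smul_right, hη]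
      simp
      ring
    have := right_ne_zero_of_mul hγ
    have : 0 < γ₂ ^ 2 := by positivity
    linarith

lemma IsGenericWintgen.exists_isGenericForm (hn : 2 ≤ n) (hf : IsGenericWintgen f) (x : M) :
    ∃ (e₁ e₂ : TangentSpace (𝓡 n) x) (η₁ η₂ : Euc (n + m)) (μ γ : ℝ),
      IsGenericForm f x e₁ e₂ η₁ η₂ μ γ := by
  obtain ⟨hm, e, η, μ, γ₁, γ₂, h, hμ, hγ⟩ := hf.generic x
  exact ⟨_, _, _, _, _, _, h.isGenericForm hn hm (hf.push_injective x) hμ hγ⟩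

lemma IsGenericWintgen.meanCurvature_pos (hn : 2 ≤ n) (hf : IsGenericWintgen f) (x : M) :
    0 < meanCurvature n f x := by
  obtain ⟨e₁, e₂, η₁, η₂, μ, γ, h⟩ := hf.exists_isGenericForm hn x
  have h1 := h.sq_lt
  have h2 : 0 ≤ meanCurvature n f x := norm_nonneg _
  rcases h2.eq_or_lt with h3 | h3
  · rw [← h3] at h1
    nlinarith [sq_nonneg γ]
  · exact h3

lemma inner_meanCurvatureVector_self (x : M) :
    (inner ℝ (meanCurvatureVector n f x) (meanCurvatureVector n f x) : ℝ) =
      meanCurvature n f x ^ 2 := real_inner_self_eq_norm_sq _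

variable [IsManifold (𝓡 n) ∞ M]

lemma IsGenericWintgen.contMDiff_meanCurvature (hn : 2 ≤ n) (hf : IsGenericWintgen f) :
    ContMDiff (𝓡 n) 𝓘(ℝ, ℝ) ∞ (meanCurvature n f) := by
  intro x
  have h1 : ContDiffAt ℝ ∞ (fun v : Euc (n + m) => ‖v‖) (meanCurvatureVector n f x) :=
    contDiffAt_norm ℝ (norm_pos_iff.1 (hf.meanCurvature_pos hn x))
  exact h1.contMDiffAt.comp x (contMDiff_meanCurvatureVector hf.toIsIsometricImmersion x)

lemma IsGenericWintgen.contMDiff_inv_meanCurvature (hn : 2 ≤ n) (hf : IsGenericWintgen f) :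
    ContMDiff (𝓡 n) 𝓘(ℝ, ℝ) ∞ (fun x => 1 / meanCurvature n f x) := by
  intro x
  have h1 : ContDiffAt ℝ ∞ (fun t : ℝ => 1 / t) (meanCurvature n f x) :=
    contDiffAt_const.div contDiffAt_id (hf.meanCurvature_pos hn x).ne'
  exact h1.contMDiffAt.comp x (hf.contMDiff_meanCurvature hn x)

lemma IsGenericWintgen.contMDiff_inv_meanCurvature_sq (hn : 2 ≤ n) (hf : IsGenericWintgen f) :
    ContMDiff (𝓡 n) 𝓘(ℝ, ℝ) ∞ (fun x => 1 / meanCurvature n f x ^ 2) := by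
  intro x
  have h1 : ContDiffAt ℝ ∞ (fun t : ℝ => 1 / t ^ 2) (meanCurvature n f x) :=
    contDiffAt_const.div (contDiffAt_id.pow 2) (pow_ne_zero 2 (hf.meanCurvature_pos hn x).ne')
  exact h1.contMDiffAt.comp x (hf.contMDiff_meanCurvature hn x)

lemma IsGenericWintgen.contMDiff_focalMap (hn : 2 ≤ n) (hf : IsGenericWintgen f) :
    ContMDiff (𝓡 n) 𝓘(ℝ, Euc (n + m)) ∞ (focalMap f) :=
  hf.smooth.add ((hf.contMDiff_inv_meanCurvature_sq hn).smul
    (contMDiff_meanCurvatureVector hf.toIsIsometricImmersion))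

/-- The Weingarten equation for the mean curvature vector. -/
lemma IsIsometricImmersion.inner_push_meanCurvatureVector_push (hf : IsIsometricImmersion n f)
    {x : M} (X V : TangentSpace (𝓡 n) x) :
    (inner ℝ (push (𝓡 n) (meanCurvatureVector n f) x X) (push (𝓡 n) f x V) : ℝ) =
      -inner ℝ (meanCurvatureVector n f x) (sff f x X V) := by
  rw [inner_push_of_normal hf.smooth.contMDiffAt (contMDiff_meanCurvatureVector hf).contMDiffAt
    (Filter.Eventually.of_forall fun y => ⟨hf.smooth.contMDiffAt,
      meanCurvatureVector_mem_normalSpace f y⟩), real_inner_comm,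
    ← inner_sff X V (meanCurvatureVector_mem_normalSpace f x), real_inner_comm]

lemma IsGenericWintgen.push_meanCurvature (hn : 4 ≤ n) (hf : IsGenericWintgen f) {x : M}
    {T : TangentSpace (𝓡 n) x} (hT : T ∈ meanCurvatureDistribution f x) :
    push (𝓡 n) (meanCurvature n f) x T = 0 := by
  have hℋ := contMDiff_meanCurvatureVector hf.toIsIsometricImmersion
  have hH := hf.contMDiff_meanCurvature (by omega)
  obtain ⟨e₁, e₂, η₁, η₂, μ, γ, h⟩ := hf.exists_isGenericForm (by omega) x
  have h1 := inner_push_meanCurvatureVector hn hf.toIsIsometricImmersion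
    (fun y => by
      obtain ⟨e₁, e₂, η₁, η₂, μ, γ, h⟩ := hf.exists_isGenericForm (by omega) y
      exact ⟨e₁, e₂, η₁, η₂, μ, h.toHasWintgenForm⟩) h.toHasWintgenForm h.radius_ne hT
    (meanCurvatureVector_mem_normalSpace f x)
  have h2 := push_inner (hℋ.mdifferentiableAt (by simp) (x := x))
    (hℋ.mdifferentiableAt (by simp) (x := x)) T
  rw [real_inner_comm (meanCurvatureVector n f x) (push (𝓡 n) (meanCurvatureVector n f) x T), h1,
    add_zero] at h2
  have h3 : (fun x => (inner ℝ (meanCurvatureVector n f x) (meanCurvatureVector n f x) : ℝ)) =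
      fun x => meanCurvature n f x • meanCurvature n f x := by
    funext y
    rw [inner_meanCurvatureVector_self, smul_eq_mul, sq]
  have hHd := hH.mdifferentiableAt (by simp) (x := x)
  rw [h3, push_smul hHd hHd, smul_eq_mul, smul_eq_mul] at h2
  have hpos := hf.meanCurvature_pos (by omega) x
  apply mul_left_cancel₀ hpos.ne'
  linarith

/-- Functions of the mean curvature are constant along `E`. -/
lemma IsGenericWintgen.push_comp_meanCurvature (hn : 4 ≤ n) (hf : IsGenericWintgen f) {x : M}
    {T : TangentSpace (𝓡 n) x} (hT : T ∈ meanCurvatureDistribution f x) {Φ : ℝ → ℝ}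
    (hΦ : DifferentiableAt ℝ Φ (meanCurvature n f x)) :
    push (𝓡 n) (fun y => Φ (meanCurvature n f y)) x T = 0 := by
  refine (push_comp_fderiv hΦ
    ((hf.contMDiff_meanCurvature (by omega)).mdifferentiableAt (by simp)) T).trans ?_
  rw [hf.push_meanCurvature hn hT, map_zero]

lemma IsGenericWintgen.push_inv_meanCurvature (hn : 4 ≤ n) (hf : IsGenericWintgen f) {x : M}
    {T : TangentSpace (𝓡 n) x} (hT : T ∈ meanCurvatureDistribution f x) :
    push (𝓡 n) (fun y => 1 / meanCurvature n f y) x T = 0 :=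
  hf.push_comp_meanCurvature hn hT (Φ := fun t => 1 / t)
    ((differentiableAt_const _).div differentiableAt_id (hf.meanCurvature_pos (by omega) x).ne')

lemma IsGenericWintgen.push_focalMap (hn : 2 ≤ n) (hf : IsGenericWintgen f) {x : M}
    (X : TangentSpace (𝓡 n) x) :
    push (𝓡 n) (focalMap f) x X = push (𝓡 n) f x X +
      ((1 / meanCurvature n f x ^ 2) • push (𝓡 n) (meanCurvatureVector n f) x X +
        push (𝓡 n) (fun y => 1 / meanCurvature n f y ^ 2) x X • meanCurvatureVector n f x) := by
  have h1 := (hf.contMDiff_inv_meanCurvature_sq hn).mdifferentiableAt (by simp) (x := x)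
  have h2 := (contMDiff_meanCurvatureVector hf.toIsIsometricImmersion).mdifferentiableAt (by simp)
    (x := x)
  rw [← push_smul h1 h2]
  exact push_add (hf.smooth.mdifferentiableAt (by simp))
      (((hf.contMDiff_inv_meanCurvature_sq hn).smul
    (contMDiff_meanCurvatureVector hf.toIsIsometricImmersion)).mdifferentiableAt (by simp)) X

/-- The tangential part of `h_*`. -/
lemma IsGenericForm.inner_push_focalMap (hn : 2 ≤ n) (hf : IsGenericWintgen f) {x : M}
    {e₁ e₂ : TangentSpace (𝓡 n) x} {η₁ η₂ : Euc (n + m)} {μ γ : ℝ}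
    (h : IsGenericForm f x e₁ e₂ η₁ η₂ μ γ) (X V : TangentSpace (𝓡 n) x) :
    (inner ℝ (push (𝓡 n) (focalMap f) x X) (push (𝓡 n) f x V) : ℝ) =
      -(μ * γ / meanCurvature n f x ^ 2) *
        ((inner ℝ X e₁ : ℝ) * inner ℝ V e₂ + (inner ℝ X e₂ : ℝ) * inner ℝ V e₁) := by
  have hpos := hf.meanCurvature_pos hn x
  rw [hf.push_focalMap hn, inner_add_left, inner_add_left, real_inner_smul_left,
    real_inner_smul_left, hf.inner_push_meanCurvatureVector_push, hf.isometric,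
    mem_normalSpace.1 (meanCurvatureVector_mem_normalSpace f x), h.sff_eq]
  simp only [inner_add_right, real_inner_smul_right, h.inner_one, h.inner_two,
    inner_meanCurvatureVector_self]
  field_simp
  ring

lemma IsGenericForm.mem_of_inner_push_focalMap (hn : 2 ≤ n) (hf : IsGenericWintgen f) {x : M}
    {e₁ e₂ : TangentSpace (𝓡 n) x} {η₁ η₂ : Euc (n + m)} {μ γ : ℝ}
    (h : IsGenericForm f x e₁ e₂ η₁ η₂ μ γ) {X : TangentSpace (𝓡 n) x}
    (hX : ∀ V, (inner ℝ (push (𝓡 n) (focalMap f) x X) (push (𝓡 n) f x V) : ℝ) = 0) :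
    X ∈ meanCurvatureDistribution f x := by
  have hc : -(μ * γ / meanCurvature n f x ^ 2) ≠ 0 :=
    neg_ne_zero.2 (div_ne_zero (mul_ne_zero h.radius_ne h.ne_zero)
      (pow_ne_zero 2 (hf.meanCurvature_pos hn x).ne'))
  have h1 := h.inner_push_focalMap hn hf X e₁
  have h2 := h.inner_push_focalMap hn hf X e₂
  have h21 : (inner ℝ e₂ e₁ : ℝ) = 0 := by rw [real_inner_comm, h.inner_e]
  rw [hX, h.norm_e₁, h.inner_e, mul_zero, mul_one, zero_add] at h1
  rw [hX, h.norm_e₂, h21, mul_zero, mul_one, add_zero] at h2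
  exact (h.mem_meanCurvatureDistribution h.radius_ne).2
    ⟨(mul_eq_zero.1 h2.symm).resolve_left hc, (mul_eq_zero.1 h1.symm).resolve_left hc⟩

/-- The kernel of `h_*` is `E`. -/
lemma IsGenericWintgen.push_focalMap_eq_zero_iff (hn : 4 ≤ n) (hf : IsGenericWintgen f) {x : M}
    {T : TangentSpace (𝓡 n) x} :
    push (𝓡 n) (focalMap f) x T = 0 ↔ T ∈ meanCurvatureDistribution f x := by
  obtain ⟨e₁, e₂, η₁, η₂, μ, γ, h⟩ := hf.exists_isGenericForm (by omega) x
  have hpos := hf.meanCurvature_pos (by omega) x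
  constructor
  · intro h0
    exact h.mem_of_inner_push_focalMap (by omega) hf fun V => by rw [h0, inner_zero_left]
  · intro hT
    have hr : push (𝓡 n) (fun y => 1 / meanCurvature n f y ^ 2) x T = 0 :=
      hf.push_comp_meanCurvature hn hT (Φ := fun t => 1 / t ^ 2)
        ((differentiableAt_const _).div (differentiableAt_id.pow 2) (pow_ne_zero 2 hpos.ne'))
    have hweak : ∀ y, ∃ (e₁ e₂ : TangentSpace (𝓡 n) y) (η₁ η₂ : Euc (n + m)) (μ : ℝ),
        HasWintgenForm f y e₁ e₂ η₁ η₂ μ := fun y => by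
      obtain ⟨e₁, e₂, η₁, η₂, μ, γ, h⟩ := hf.exists_isGenericForm (by omega) y
      exact ⟨e₁, e₂, η₁, η₂, μ, h.toHasWintgenForm⟩
    have hpush := hf.push_focalMap (by omega) T
    rw [hr, zero_smul, add_zero] at hpush
    -- `h_* T` is orthogonal to the tangent space by the Weingarten equation, and to the normal
    -- space by the Codazzi equation.
    have h1 : push (𝓡 n) (focalMap f) x T ∈ normalSpace n f x := by
      rw [mem_normalSpace]
      intro V
      obtain ⟨hT1, hT2⟩ := (h.mem_meanCurvatureDistribution h.radius_ne).1 hT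
      rw [h.inner_push_focalMap (by omega) hf, hT1, hT2]
      ring
    have h2 : ∀ ζ ∈ normalSpace n f x, (inner ℝ ζ (push (𝓡 n) (focalMap f) x T) : ℝ) = 0 := by
      intro ζ hζ
      rw [hpush, inner_add_right, mem_normalSpace.1 hζ, real_inner_smul_right,
        inner_push_meanCurvatureVector hn hf.toIsIsometricImmersion hweak h.toHasWintgenForm
          h.radius_ne hT hζ, mul_zero, add_zero]
    exact inner_self_eq_zero.1 (h2 _ h1)

end FocalMap

/-! ### Factorization through the conformal Gauss parametrization -/

section UnitMeanCurvature

variable {n m : ℕ} {M : Type*} [TopologicalSpace M] [ChartedSpace (Euc n) M]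

lemma sff_congr {N : ℕ} {f f' : M → Euc N} {x : M} (h : f =ᶠ[nhds x] f')
    (X Y : TangentSpace (𝓡 n) x) : sff f x X Y = sff f' x X Y := by
  have h1 : chartRep x f =ᶠ[nhds (extChartAt (𝓡 n) x x)] chartRep x f' := by
    rw [← extChartAt_to_inv (I := 𝓡 n) x] at h
    exact (continuousAt_extChartAt_symm (I := 𝓡 n) x).eventually h
  have h2 : secondDeriv f x X Y = secondDeriv f' x X Y :=
    congrArg (fun A : Euc n →L[ℝ] Euc n →L[ℝ] Euc N => A X Y) h1.fderiv.fderiv_eq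
  have h3 : normalSpace n f x = normalSpace n f' x := by
    ext ξ
    simp only [mem_normalSpace, push_congr h]
  unfold sff
  rw [h2]
  exact starProjection_congr h3 _

variable [RiemannianBundle (fun x : M => TangentSpace (𝓡 n) x)] {f : M → Euc (n + m)}

/-- The unit normal field `ℋ / H`. -/
def unitMeanCurvature (f : M → Euc (n + m)) (x : M) : Euc (n + m) :=
  (1 / meanCurvature n f x) • meanCurvatureVector n f x

lemma unitMeanCurvature_mem_normalSpace (x : M) : unitMeanCurvature f x ∈ normalSpace n f x :=
  Submodule.smul_mem _ _ (meanCurvatureVector_mem_normalSpace f x)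

lemma IsGenericWintgen.inner_unitMeanCurvature_self (hn : 2 ≤ n) (hf : IsGenericWintgen f) (x : M) :
    (inner ℝ (unitMeanCurvature f x) (unitMeanCurvature f x) : ℝ) = 1 := by
  have hpos := hf.meanCurvature_pos hn x
  rw [unitMeanCurvature, real_inner_smul_left, real_inner_smul_right,
      inner_meanCurvatureVector_self]
  field_simp

lemma IsGenericWintgen.meanCurvatureVector_eq_smul (hn : 2 ≤ n) (hf : IsGenericWintgen f) (x : M) :
    meanCurvatureVector n f x = meanCurvature n f x • unitMeanCurvature f x := by
  rw [unitMeanCurvature, smul_smul, mul_one_div_cancel (hf.meanCurvature_pos hn x).ne', one_smul]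

/-- The part of the second fundamental form orthogonal to `ℋ` has the same nullity `E` as
`α - ⟨·, ·⟩ ℋ`, because `ℋ` does not lie in the plane of the curvature circle. -/
lemma IsGenericForm.mem_meanCurvatureDistribution_iff (hn : 2 ≤ n) (hf : IsGenericWintgen f) {x : M}
    {e₁ e₂ : TangentSpace (𝓡 n) x} {η₁ η₂ : Euc (n + m)} {μ γ : ℝ}
    (h : IsGenericForm f x e₁ e₂ η₁ η₂ μ γ) {T : TangentSpace (𝓡 n) x} :
    T ∈ meanCurvatureDistribution f x ↔ ∀ Y, sff f x T Y -
      (inner ℝ (unitMeanCurvature f x) (sff f x T Y) : ℝ) • unitMeanCurvature f x = 0 := by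
  have hpos := hf.meanCurvature_pos hn x
  have hνν := hf.inner_unitMeanCurvature_self hn x
  have hℋ := hf.meanCurvatureVector_eq_smul hn x
  have h1 : (inner ℝ (unitMeanCurvature f x) η₁ : ℝ) = 0 := by
    rw [unitMeanCurvature, real_inner_smul_left, h.inner_one, mul_zero]
  have h2 : (inner ℝ (unitMeanCurvature f x) η₂ : ℝ) = γ / meanCurvature n f x := by
    rw [unitMeanCurvature, real_inner_smul_left, h.inner_two]
    ring
  constructor
  · intro hT Y
    rw [hT Y, hℋ, real_inner_smul_right, real_inner_smul_right, hνν]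
    module
  · intro hT
    rw [h.mem_meanCurvatureDistribution h.radius_ne]
    have h3 := hT e₁
    have hlt := h.sq_lt
    have hμ := h.radius_ne
    rw [h.sff_eq, hℋ, h.norm_e₁, h.inner_e] at h3
    set ν := unitMeanCurvature f x
    set H := meanCurvature n f x
    set a : ℝ := inner ℝ T e₁
    set b : ℝ := inner ℝ T e₂
    have h21 : (inner ℝ η₂ η₁ : ℝ) = 0 := by rw [real_inner_comm, h.inner_η]
    have hη1 : (inner ℝ η₁ ν : ℝ) = 0 := by rw [real_inner_comm, h1]
    have hη2 : (inner ℝ η₂ ν : ℝ) = γ / H := by rw [real_inner_comm, h2]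
    have h4 := congrArg (fun v => (inner ℝ η₁ v : ℝ)) h3
    have h5 := congrArg (fun v => (inner ℝ η₂ v : ℝ)) h3
    simp only [inner_add_right, inner_sub_right, real_inner_smul_right, h.norm_η₁, h.norm_η₂,
      h.inner_η, h21, hη1, hη2, h1, h2, hνν, inner_zero_right] at h4 h5
    have ha : a = 0 := by
      have : μ * a = 0 := by linarith
      exact (mul_eq_zero.1 this).resolve_left hμ
    have hb : μ * b * (H ^ 2 - γ ^ 2) = 0 := by
      field_simp at h5
      linarith
    exact ⟨ha, (mul_eq_zero.1 ((mul_eq_zero.1 hb).resolve_right (by linarith))).resolve_left hμ⟩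

variable [IsManifold (𝓡 n) ∞ M]

lemma IsGenericWintgen.contMDiff_unitMeanCurvature (hn : 2 ≤ n) (hf : IsGenericWintgen f) :
    ContMDiff (𝓡 n) 𝓘(ℝ, Euc (n + m)) ∞ (unitMeanCurvature f) :=
  (hf.contMDiff_inv_meanCurvature hn).smul (contMDiff_meanCurvatureVector hf.toIsIsometricImmersion)

/-- `⟨ℋ / H, h_* X⟩ = X(1 / H)`, since `h = f + (1 / H) (ℋ / H)` with `ℋ / H` a unit normal
field. -/
lemma IsGenericWintgen.inner_unitMeanCurvature_push_focalMap (hn : 2 ≤ n) (hf : IsGenericWintgen f)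
    {x : M} (X : TangentSpace (𝓡 n) x) :
    (inner ℝ (unitMeanCurvature f x) (push (𝓡 n) (focalMap f) x X) : ℝ) =
      push (𝓡 n) (fun y => 1 / meanCurvature n f y) x X := by
  have hν := (hf.contMDiff_unitMeanCurvature hn).mdifferentiableAt (by simp) (x := x)
  have hr := (hf.contMDiff_inv_meanCurvature hn).mdifferentiableAt (by simp) (x := x)
  have h1 : focalMap f = f + fun y => (1 / meanCurvature n f y) • unitMeanCurvature f y := by
    funext y
    rw [Pi.add_apply, focalMap, unitMeanCurvature, smul_smul]
    congr 2
    ring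
  have h2 := push_inner hν hν X
  simp only [hf.inner_unitMeanCurvature_self hn] at h2
  rw [push_const, real_inner_comm (unitMeanCurvature f x)
    (push (𝓡 n) (unitMeanCurvature f) x X)] at h2
  have h3 : (inner ℝ (unitMeanCurvature f x) (push (𝓡 n) (unitMeanCurvature f) x X) : ℝ) = 0 := by
    linarith
  have hrν : MDifferentiableAt (𝓡 n) 𝓘(ℝ, Euc (n + m))
      (fun y => (1 / meanCurvature n f y) • unitMeanCurvature f y) x := hr.smul hν
  rw [h1, push_add (hf.smooth.mdifferentiableAt (by simp)) hrν, push_smul hr hν,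
    inner_add_right, inner_add_right, real_inner_smul_right, real_inner_smul_right, h3,
    mem_normalSpace.1 (unitMeanCurvature_mem_normalSpace x), hf.inner_unitMeanCurvature_self hn]
  ring

end UnitMeanCurvature

section Factorization

variable {n m : ℕ} {M : Type*} [TopologicalSpace M] [ChartedSpace (Euc n) M]
  [RiemannianBundle (fun x : M => TangentSpace (𝓡 n) x)]
  {L : Type*} [TopologicalSpace L] [ChartedSpace (Euc 2) L]
  {f : M → Euc (n + m)} {U : Set M} {pr : M → L} {g : L → Euc (n + m)} {τ : L → ℝ}

lemma IsFocalSurface.contMDiffAt_proj (hs : IsFocalSurface f U pr g τ) (hU : IsOpen U) {x : M}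
    (hx : x ∈ U) : ContMDiffAt (𝓡 n) (𝓡 2) ∞ pr x :=
  hs.smooth_proj.contMDiffAt (hU.mem_nhds hx)

lemma IsFocalSurface.push_surface (hs : IsFocalSurface f U pr g τ) (hU : IsOpen U) {x : M}
    (hx : x ∈ U) (X : TangentSpace (𝓡 n) x) :
    push (𝓡 2) g (pr x) (mfderiv (𝓡 n) (𝓡 2) pr x X) = push (𝓡 n) (focalMap f) x X := by
  rw [← push_comp (hs.smooth_surface.mdifferentiableAt (by simp))
    ((hs.contMDiffAt_proj hU hx).mdifferentiableAt (by simp))]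
  refine push_congr ?_ X
  filter_upwards [hU.mem_nhds hx] with y hy
  exact hs.focal y hy

lemma IsFocalSurface.push_radius (hs : IsFocalSurface f U pr g τ) (hU : IsOpen U) {x : M}
    (hx : x ∈ U) (X : TangentSpace (𝓡 n) x) :
    push (𝓡 2) τ (pr x) (mfderiv (𝓡 n) (𝓡 2) pr x X) =
      push (𝓡 n) (fun y => 1 / meanCurvature n f y) x X := by
  rw [← push_comp (hs.smooth_radius.mdifferentiableAt (by simp))
    ((hs.contMDiffAt_proj hU hx).mdifferentiableAt (by simp))]
  refine push_congr ?_ X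
  filter_upwards [hU.mem_nhds hx] with y hy
  exact hs.radius y hy

variable [IsManifold (𝓡 n) ∞ M] [IsManifold (𝓡 2) ∞ L]

/-- The tangential part of `ℋ / H` along the focal surface is `g_* ∇τ`. -/
lemma IsFocalSurface.sub_pushGradient_mem_normalSpace (hn : 2 ≤ n) (hf : IsGenericWintgen f)
    (hs : IsFocalSurface f U pr g τ) (hU : IsOpen U) {x : M} (hx : x ∈ U) :
    unitMeanCurvature f x - pushGradient g τ (pr x) ∈ normalSpace 2 g (pr x) := by
  rw [mem_normalSpace]
  intro b
  obtain ⟨X, rfl⟩ := hs.submersion x hx b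
  rw [inner_sub_left, inner_pushGradient hs.smooth_surface hs.immersion hs.smooth_radius,
    hs.push_surface hU hx, hs.push_radius hU hx, hf.inner_unitMeanCurvature_push_focalMap hn,
    sub_self]

lemma IsFocalSurface.inner_sub_pushGradient_self (hn : 2 ≤ n) (hf : IsGenericWintgen f)
    (hs : IsFocalSurface f U pr g τ) (hU : IsOpen U) {x : M} (hx : x ∈ U) :
    (inner ℝ (unitMeanCurvature f x - pushGradient g τ (pr x))
      (unitMeanCurvature f x - pushGradient g τ (pr x)) : ℝ) =
      1 - ‖pushGradient g τ (pr x)‖ ^ 2 := by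
  have h1 : (inner ℝ (unitMeanCurvature f x - pushGradient g τ (pr x))
      (pushGradient g τ (pr x)) : ℝ) = 0 :=
    mem_normalSpace.1 (hs.sub_pushGradient_mem_normalSpace hn hf hU hx) _
  have h2 := hf.inner_unitMeanCurvature_self hn x
  have h3 := real_inner_self_eq_norm_sq (pushGradient g τ (pr x))
  rw [inner_sub_left] at h1
  rw [inner_sub_right, inner_sub_left, inner_sub_left, h2, ← h3,
    real_inner_comm (unitMeanCurvature f x) (pushGradient g τ (pr x))]
  linarith

/-- `‖∇τ‖ < 1`: otherwise `ℋ / H` would be tangent to the focal surface, but only `h_* E = 0` is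
normal to `f`. -/
lemma IsFocalSurface.isGaussData (hn : 4 ≤ n) (hf : IsGenericWintgen f)
    (hs : IsFocalSurface f U pr g τ) (hU : IsOpen U) : IsGaussData g τ := by
  have hsurj : ∀ y, ∃ x ∈ U, pr x = y := fun y => by
    have : y ∈ pr '' U := by
      rw [hs.surjective]
      trivial
    exact this
  refine ⟨hs.smooth_surface, hs.immersion, hs.smooth_radius, fun y => ?_, fun y => ?_⟩
  · obtain ⟨x, hx, rfl⟩ := hsurj y
    rw [hs.radius x hx]
    exact one_div_pos.2 (hf.meanCurvature_pos (by omega) x)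
  · obtain ⟨x, hx, rfl⟩ := hsurj y
    have h1 := hs.inner_sub_pushGradient_self (by omega) hf hU hx
    obtain ⟨e₁, e₂, η₁, η₂, μ, γ, h⟩ := hf.exists_isGenericForm (by omega) x
    have hne : unitMeanCurvature f x - pushGradient g τ (pr x) ≠ 0 := by
      intro h0
      rw [sub_eq_zero] at h0
      obtain ⟨X, hX⟩ := hs.submersion x hx (surfaceGradient g τ (pr x))
      have h2 : push (𝓡 n) (focalMap f) x X = unitMeanCurvature f x := by
        rw [← hs.push_surface hU hx, hX, h0]
        rfl
      have h3 : X ∈ meanCurvatureDistribution f x :=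
        h.mem_of_inner_push_focalMap (by omega) hf fun V => by
          rw [h2, mem_normalSpace.1 (unitMeanCurvature_mem_normalSpace x)]
      rw [(hf.push_focalMap_eq_zero_iff hn).2 h3] at h2
      have h8 := hf.inner_unitMeanCurvature_self (by omega) x
      rw [← h2, inner_zero_left] at h8
      exact zero_ne_one h8
    have h2 := real_inner_self_pos.2 hne
    rw [h1] at h2
    nlinarith [norm_nonneg (pushGradient g τ (pr x))]

/-- The lift `(π, w)` of `f` to the unit normal bundle of its focal surface, where `w` is the
normalized component of `ℋ / H` normal to the surface. -/
def focalLift (f : M → Euc (n + m)) (pr : M → L) (g : L → Euc (n + m)) (τ : L → ℝ) (x : M) :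
    L × Euc (n + m) :=
  (pr x, (1 / Real.sqrt (1 - ‖pushGradient g τ (pr x)‖ ^ 2)) •
    (unitMeanCurvature f x - pushGradient g τ (pr x)))

lemma IsFocalSurface.focalLift_mem (hn : 4 ≤ n) (hf : IsGenericWintgen f)
    (hs : IsFocalSurface f U pr g τ) (hU : IsOpen U) {x : M} (hx : x ∈ U) :
    focalLift f pr g τ x ∈ unitNormalBundle g := by
  have hρ := one_sub_norm_sq_pos ((hs.isGaussData hn hf hU).norm_gradient_lt (pr x))
  refine ⟨Submodule.smul_mem _ _ (hs.sub_pushGradient_mem_normalSpace (by omega) hf hU hx), ?_⟩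
  have h1 := hs.inner_sub_pushGradient_self (by omega) hf hU hx
  rw [real_inner_self_eq_norm_sq] at h1
  have h2 : ‖unitMeanCurvature f x - pushGradient g τ (pr x)‖ =
      Real.sqrt (1 - ‖pushGradient g τ (pr x)‖ ^ 2) := by
    rw [← h1, Real.sqrt_sq (norm_nonneg _)]
  have h3 : (focalLift f pr g τ x).2 = (1 / Real.sqrt (1 - ‖pushGradient g τ (pr x)‖ ^ 2)) •
    (unitMeanCurvature f x - pushGradient g τ (pr x)) := rfl
  rw [h3, norm_smul, h2, Real.norm_of_nonneg (by positivity),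
    one_div_mul_cancel (Real.sqrt_pos.2 hρ).ne']

lemma IsFocalSurface.gaussMap_focalLift (hn : 4 ≤ n) (hf : IsGenericWintgen f)
    (hs : IsFocalSurface f U pr g τ) (hU : IsOpen U) (x : M) :
    gaussMap g τ (focalLift f pr g τ x) = unitMeanCurvature f x := by
  have hρ := one_sub_norm_sq_pos ((hs.isGaussData hn hf hU).norm_gradient_lt (pr x))
  simp only [gaussMap, focalLift]
  rw [smul_smul, mul_one_div_cancel (Real.sqrt_pos.2 hρ).ne', one_smul, add_sub_cancel]

lemma IsFocalSurface.conformalGauss_focalLift (hn : 4 ≤ n) (hf : IsGenericWintgen f)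
    (hs : IsFocalSurface f U pr g τ) (hU : IsOpen U) {x : M} (hx : x ∈ U) :
    conformalGauss g τ (focalLift f pr g τ x) = f x := by
  have h1 : conformalGauss g τ (focalLift f pr g τ x) =
      g (pr x) - τ (pr x) • gaussMap g τ (focalLift f pr g τ x) := rfl
  rw [h1, hs.gaussMap_focalLift hn hf hU, hs.focal x hx, hs.radius x hx, unitMeanCurvature,
      smul_smul,
    one_div_mul_one_div, ← sq, add_sub_cancel_right]

lemma IsFocalSurface.contMDiffAt_focalLift (hn : 4 ≤ n) (hf : IsGenericWintgen f)
    (hs : IsFocalSurface f U pr g τ) (hU : IsOpen U) {x : M} (hx : x ∈ U) :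
    ContMDiffAt (𝓡 n) ((𝓡 2).prod 𝓘(ℝ, Euc (n + m))) ∞ (focalLift f pr g τ) x := by
  have hd := hs.isGaussData hn hf hU
  have hρ := one_sub_norm_sq_pos (hd.norm_gradient_lt (pr x))
  have h1 := hs.contMDiffAt_proj hU hx
  have h2 : ContMDiffAt (𝓡 n) 𝓘(ℝ, Euc (n + m)) ∞ (fun x => pushGradient g τ (pr x)) x :=
    (hd.contMDiff_gradient (pr x)).comp x h1
  have h3 : ContDiffAt ℝ ∞ (fun a : Euc (n + m) => 1 / Real.sqrt (1 - ‖a‖ ^ 2))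
      (pushGradient g τ (pr x)) :=
    contDiffAt_const.div (contDiffAt_sqrt_one_sub (hd.norm_gradient_lt (pr x)))
      (Real.sqrt_pos.2 hρ).ne'
  have h4 : ContMDiffAt (𝓡 n) 𝓘(ℝ, ℝ) ∞
      (fun x => 1 / Real.sqrt (1 - ‖pushGradient g τ (pr x)‖ ^ 2)) x :=
    contMDiffAt_comp_vectorSpace (Φ := fun a : Euc (n + m) => 1 / Real.sqrt (1 - ‖a‖ ^ 2))
      (γ := fun x => pushGradient g τ (pr x)) h3 h2
  exact h1.prodMk (h4.smul ((hf.contMDiff_unitMeanCurvature (by omega) x).sub h2))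

lemma IsFocalSurface.tangentFst_jStar (hn : 4 ≤ n) (hf : IsGenericWintgen f)
    (hs : IsFocalSurface f U pr g τ) (hU : IsOpen U) {x : M} (hx : x ∈ U)
    (X : TangentSpace (𝓡 n) x) :
    tangentFst (focalLift f pr g τ x) (jStar (focalLift f pr g τ) x X) =
      mfderiv (𝓡 n) (𝓡 2) pr x X := by
  have h1 := (hs.contMDiffAt_focalLift hn hf hU hx).mdifferentiableAt (by simp)
  have h2 := mfderiv_comp x (mdifferentiableAt_fst (I := 𝓡 2) (I' := 𝓘(ℝ, Euc (n + m)))) h1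
  rw [mfderiv_fst] at h2
  exact (congrArg (fun A : Euc n →L[ℝ] Euc 2 => A X) h2).symm

lemma IsFocalSurface.push_jStar (hn : 4 ≤ n) (hf : IsGenericWintgen f)
    (hs : IsFocalSurface f U pr g τ) (hU : IsOpen U) {x : M} (hx : x ∈ U)
    (X : TangentSpace (𝓡 n) x) :
    push ((𝓡 2).prod 𝓘(ℝ, Euc (n + m))) (conformalGauss g τ) (focalLift f pr g τ x)
      (jStar (focalLift f pr g τ) x X) = push (𝓡 n) f x X := by
  rw [← push_comp_jStar (hs.isGaussData hn hf hU).contMDiff_conformalGauss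
    (hs.contMDiffAt_focalLift hn hf hU hx)]
  refine push_congr ?_ X
  filter_upwards [hU.mem_nhds hx] with y hy
  exact hs.conformalGauss_focalLift hn hf hU hy

/-- A vector in the kernel of `Ψ_*` differs from some `j_* X` by a vertical vector of `Λ`, which
`Ψ_*` maps to a normal vector of the focal surface. So `f_* X` is normal to the surface, whence
`X ∈ E`, and the given vector is vertical itself; but `Ψ_*` is injective on vertical vectors. -/
lemma IsFocalSurface.focalLift_mem_regularSet (hn : 4 ≤ n) (hf : IsGenericWintgen f)
    (hs : IsFocalSurface f U pr g τ) (hU : IsOpen U) {x : M} (hx : x ∈ U) :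
    focalLift f pr g τ x ∈ regularSet g τ := by
  have hd := hs.isGaussData hn hf hU
  have hρ := Real.sqrt_pos.2 (one_sub_norm_sq_pos (hd.norm_gradient_lt (pr x)))
  have hτ := hd.radius_pos (pr x)
  have hmem : ∀ᶠ x' in nhds x, focalLift f pr g τ x' ∈ unitNormalBundle g := by
    filter_upwards [hU.mem_nhds hx] with y hy
    exact hs.focalLift_mem hn hf hU hy
  have hjx := hs.focalLift_mem hn hf hU hx
  have hfst := hs.tangentFst_jStar hn hf hU hx
  have hpush := hs.push_jStar hn hf hU hx
  have hjs := hs.contMDiffAt_focalLift hn hf hU hx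
  set j := focalLift f pr g τ
  refine ⟨hjx, fun V hV h0 => ?_⟩
  obtain ⟨X, hX⟩ := hs.submersion x hx (tangentFst (j x) V)
  have hW := Submodule.sub_mem _ hV
    (jStar_mem hs.smooth_surface hjs hmem X)
  have hW0 : tangentFst (j x) (V - jStar j x X) = 0 := by
    rw [map_sub, hfst, hX, sub_self]
  obtain ⟨h1', h1⟩ := hd.push_of_vertical hW0
  rw [h1', map_sub, h0, hpush, zero_sub, neg_inj, smul_smul] at h1
  have h2 : ∀ b, (inner ℝ (push (𝓡 n) f x X) (push (𝓡 2) g (pr x) b) : ℝ) = 0 := by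
    intro b
    have h3 := (mem_tangentUnitNormalBundle.1 hW).2 b
    have h4 : secondDeriv g (j x).1 (tangentFst (j x) (V - jStar j x X)) b = 0 := by
      rw [hW0]
      simpa using secondDeriv_smul_left g (j x).1 0 (0 : TangentSpace (𝓡 2) (j x).1) b
    rw [h4, inner_zero_right, add_zero] at h3
    rw [h1, real_inner_smul_left]
    exact mul_eq_zero_of_right _ h3
  have hXE : X ∈ meanCurvatureDistribution f x := by
    obtain ⟨e₁, e₂, η₁, η₂, μ, γ, h⟩ := hf.exists_isGenericForm (by omega) x
    -- The form `⟨h_* X, f_* Y⟩` is symmetric.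
    refine h.mem_of_inner_push_focalMap (by omega) hf fun Y => ?_
    have h4 := h.inner_push_focalMap (by omega) hf Y X
    rw [← hs.push_surface hU hx, real_inner_comm, h2] at h4
    rw [h.inner_push_focalMap (by omega) hf, h4]
    ring
  have hV1 : tangentFst (j x) V = 0 := by
    rw [← hX]
    exact (hs.ker_proj x hx X).2 hXE
  obtain ⟨h3', h3⟩ := hd.push_of_vertical hV1
  rw [h0, h3', smul_smul] at h3
  have hV2 : tangentSnd (j x) V = 0 :=
    (smul_eq_zero.1 (neg_eq_zero.1 h3.symm)).resolve_left (mul_ne_zero hτ.ne' hρ.ne')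
  exact Prod.ext hV1 hV2

lemma IsFocalSurface.sff_focalLift (hn : 4 ≤ n) (hf : IsGenericWintgen f)
    (hs : IsFocalSurface f U pr g τ) (hU : IsOpen U) {x : M} (hx : x ∈ U)
    (X Y : TangentSpace (𝓡 n) x) :
    sff (conformalGauss g τ ∘ focalLift f pr g τ) x X Y = sff f x X Y := by
  refine sff_congr ?_ X Y
  filter_upwards [hU.mem_nhds hx] with y hy
  exact hs.conformalGauss_focalLift hn hf hU hy

lemma IsFocalSurface.sffInto_focalLift (hn : 4 ≤ n) (hf : IsGenericWintgen f)
    (hs : IsFocalSurface f U pr g τ) (hU : IsOpen U) {x : M} (hx : x ∈ U)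
    (X Y : TangentSpace (𝓡 n) x) :
    sffInto g τ (focalLift f pr g τ) x X Y = sff f x X Y -
      (inner ℝ (unitMeanCurvature f x) (sff f x X Y) : ℝ) • unitMeanCurvature f x := by
  have hmem : ∀ᶠ x' in nhds x, focalLift f pr g τ x' ∈ unitNormalBundle g := by
    filter_upwards [hU.mem_nhds hx] with y hy
    exact hs.focalLift_mem hn hf hU hy
  rw [(hs.isGaussData hn hf hU).sffInto_eq (hs.contMDiffAt_focalLift hn hf hU hx) hmem
    (hs.focalLift_mem_regularSet hn hf hU hx), hs.sff_focalLift hn hf hU hx,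
    hs.gaussMap_focalLift hn hf hU]

lemma IsFocalSurface.shapeForm_focalLift (hn : 4 ≤ n) (hf : IsGenericWintgen f)
    (hs : IsFocalSurface f U pr g τ) (hU : IsOpen U) {x : M} (hx : x ∈ U)
    (X Y : TangentSpace (𝓡 n) x) :
    shapeForm g τ (focalLift f pr g τ x) (jStar (focalLift f pr g τ) x X)
      (jStar (focalLift f pr g τ) x Y) = inner ℝ (unitMeanCurvature f x) (sff f x X Y) := by
  rw [(hs.isGaussData hn hf hU).shapeForm_eq, hs.sff_focalLift hn hf hU hx,
    hs.gaussMap_focalLift hn hf hU]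
  · filter_upwards [hU.mem_nhds hx] with y hy
    exact hs.contMDiffAt_focalLift hn hf hU hy
  · filter_upwards [hU.mem_nhds hx] with y hy
    exact hs.focalLift_mem hn hf hU hy

lemma IsFocalSurface.relativeNullity_focalLift (hn : 4 ≤ n) (hf : IsGenericWintgen f)
    (hs : IsFocalSurface f U pr g τ) (hU : IsOpen U) {x : M} (hx : x ∈ U) :
    relativeNullity n g τ (focalLift f pr g τ) x = meanCurvatureDistribution f x := by
  obtain ⟨e₁, e₂, η₁, η₂, μ, γ, h⟩ := hf.exists_isGenericForm (by omega) x
  ext T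
  rw [h.mem_meanCurvatureDistribution_iff (by omega) hf]
  simp only [relativeNullity, Set.mem_ofPred_eq, hs.sffInto_focalLift hn hf hU hx]

theorem IsFocalSurface.factorsThroughConformalGauss (hn : 4 ≤ n) (hf : IsGenericWintgen f)
    (hs : IsFocalSurface f U pr g τ) (hU : IsOpen U) :
    FactorsThroughConformalGauss f U pr g τ := by
  refine ⟨(hs.isGaussData hn hf hU).norm_gradient_lt, focalLift f pr g τ,
    ⟨fun x hx => (hs.contMDiffAt_focalLift hn hf hU hx).contMDiffWithinAt,
      fun x hx => hs.focalLift_mem_regularSet hn hf hU hx, fun x hx v w => ?_, fun x hx => ?_,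
      fun x hx T hT => ?_⟩,
    fun x hx => ⟨rfl, (hs.conformalGauss_focalLift hn hf hU hx).symm,
      hs.relativeNullity_focalLift hn hf hU hx, fun e η μ γ₁ γ₂ h => ?_⟩⟩
  · rw [hs.push_jStar hn hf hU hx, hs.push_jStar hn hf hU hx, hf.isometric]
  -- The trace of `α_f` is `n ℋ`, which has no component orthogonal to `ℋ`.
  · simp only [hs.sffInto_focalLift hn hf hU hx, Finset.sum_sub_distrib, ← Finset.sum_smul,
      ← inner_sum]
    rw [sum_sff_tangentBasis (by omega), hf.meanCurvatureVector_eq_smul (by omega) x,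
      real_inner_smul_right, real_inner_smul_right,
      hf.inner_unitMeanCurvature_self (by omega) x]
    module
  · rw [hs.relativeNullity_focalLift hn hf hU hx] at hT
    exact (hs.tangentFst_jStar hn hf hU hx T).trans ((hs.ker_proj x hx T).2 hT)
  · obtain ⟨hm, -⟩ := hf.generic x
    obtain ⟨hw, hℋ⟩ := h.hasWintgenForm (by omega) hm (hf.push_injective x)
    have hpos := hf.meanCurvature_pos (by omega) x
    have hη := orthonormal_iff_ite.1 h.orthonormal_normal
    have hνν := hf.inner_unitMeanCurvature_self (by omega) x
    have h1 : (inner ℝ (unitMeanCurvature f x) (η ⟨0, by omega⟩) : ℝ) = 0 := by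
      rw [unitMeanCurvature, hℋ, real_inner_smul_left, inner_add_left, real_inner_smul_left,
        real_inner_smul_left, hη, hη]
      simp
    have h2 : (inner ℝ (unitMeanCurvature f x) (η ⟨1, by omega⟩) : ℝ) =
        γ₁ / meanCurvature n f x := by
      rw [unitMeanCurvature, hℋ, real_inner_smul_left, inner_add_left, real_inner_smul_left,
        real_inner_smul_left, hη, hη]
      simp
      ring
    have hshape : ∀ X Y : TangentSpace (𝓡 n) x,
        (inner ℝ (unitMeanCurvature f x) (sff f x X Y) : ℝ) =
        inner ℝ X Y * meanCurvature n f x + μ * γ₁ / meanCurvature n f x *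
          ((inner ℝ X (e ⟨0, by omega⟩) : ℝ) * inner ℝ Y (e ⟨1, by omega⟩) +
            (inner ℝ X (e ⟨1, by omega⟩) : ℝ) * inner ℝ Y (e ⟨0, by omega⟩)) := by
      intro X Y
      rw [hw.sff_eq, hf.meanCurvatureVector_eq_smul (by omega) x]
      simp only [inner_add_right, real_inner_smul_right, h1, h2, hνν]
      ring
    have h21 : (inner ℝ (e ⟨1, by omega⟩) (e ⟨0, by omega⟩) : ℝ) = 0 := by
      rw [real_inner_comm, hw.inner_e]
    refine ⟨fun i hi => ?_, fun i k hi hk => ?_⟩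
    · rw [hs.shapeForm_focalLift hn hf hU hx, hshape, hs.radius x hx, one_div_one_div]
      obtain hi | hi : (i : ℕ) = 0 ∨ (i : ℕ) = 1 := by omega
      · rw [show e i = e ⟨0, by omega⟩ from congrArg e (Fin.ext hi), hw.norm_e₁, hw.inner_e]
        ring
      · rw [show e i = e ⟨1, by omega⟩ from congrArg e (Fin.ext hi), hw.norm_e₂, h21]
        ring
    · rw [show e i = e ⟨0, by omega⟩ from congrArg e (Fin.ext hi),
        show e k = e ⟨1, by omega⟩ from congrArg e (Fin.ext hk),
        hs.shapeForm_focalLift hn hf hU hx, hshape, hs.radius x hx, hw.norm_e₁, hw.norm_e₂,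
        hw.inner_e, h21]
      ring

end Factorization

/-! ### Maps of constant rank two -/

section RankTwo

variable {n : ℕ} {Y : Type*} [NormedAddCommGroup Y] [NormedSpace ℝ Y]

lemma exists_surjective_comp [FiniteDimensional ℝ Y] {A : Euc n →L[ℝ] Y}
    (hA : Module.finrank ℝ (LinearMap.range A.toLinearMap) = 2) :
    ∃ P : Y →L[ℝ] Euc 2, Function.Surjective (P ∘L A) := by
  let e : LinearMap.range A.toLinearMap ≃ₗ[ℝ] Euc 2 :=
    LinearEquiv.ofFinrankEq _ _ (by rw [hA, finrank_euclideanSpace_fin])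
  obtain ⟨p, hp⟩ := LinearMap.exists_extend e.toLinearMap
  refine ⟨LinearMap.toContinuousLinearMap p, fun b => ?_⟩
  obtain ⟨a, ha⟩ := e.surjective b
  obtain ⟨u, hu⟩ := a.2
  refine ⟨u, ?_⟩
  have h1 := congrArg (fun l => l a) hp
  refine Eq.trans ?_ (h1.trans ha)
  exact congrArg p hu

lemma apply_eq_zero_iff_of_surjective_comp {A : Euc n →L[ℝ] Y} {P : Y →L[ℝ] Euc 2}
    (hA : Module.finrank ℝ (LinearMap.range A.toLinearMap) = 2)
    (hP : Function.Surjective (P ∘L A)) (u : Euc n) : P (A u) = 0 ↔ A u = 0 := by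
  refine ⟨fun h => ?_, fun h => by rw [h, map_zero]⟩
  have hsurj : Function.Surjective (P.toLinearMap.domRestrict (LinearMap.range A.toLinearMap)) := by
    intro b
    obtain ⟨v, hv⟩ := hP b
    exact ⟨⟨A v, v, rfl⟩, hv⟩
  have hinj := (LinearMap.injective_iff_surjective_of_finrank_eq_finrank
    (by rw [hA, finrank_euclideanSpace_fin])).2 hsurj
  have h1 : (⟨A u, u, rfl⟩ : LinearMap.range A.toLinearMap) = 0 := by
    apply hinj
    rw [map_zero]
    exact h
  exact congrArg Subtype.val h1

/-- If `G_*` kills the kernel of the first component of the chart `e`, then `G ∘ e⁻¹` does not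
depend on the second variable. -/
lemma comp_symm_eq_of_ker {K : Submodule ℝ (Euc n)} {G : Euc n → Y}
    {e : OpenPartialHomeomorph (Euc n) (Euc 2 × K)}
    (hG : ∀ z ∈ e.source, DifferentiableAt ℝ G z) (he : ∀ z ∈ e.source, DifferentiableAt ℝ e z)
    (hes : ∀ p ∈ e.target, DifferentiableAt ℝ e.symm p)
    (hker : ∀ z ∈ e.source, ∀ u, (fderiv ℝ e z u).1 = 0 → fderiv ℝ G z u = 0)
    {a : Euc 2} {b₀ : K} {r : ℝ} (hball : ∀ b ∈ Metric.ball b₀ r, (a, b) ∈ e.target)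
    {b b' : K} (hb : b ∈ Metric.ball b₀ r) (hb' : b' ∈ Metric.ball b₀ r) :
    G (e.symm (a, b)) = G (e.symm (a, b')) := by
  have hγ : ∀ b ∈ Metric.ball b₀ r, DifferentiableAt ℝ (fun b => e.symm (a, b)) b := fun b hb =>
    DifferentiableAt.comp (f := fun b : K => (a, b)) b (hes _ (hball b hb))
      ((differentiableAt_const a).prodMk differentiableAt_id)
  have hGd : ∀ b ∈ Metric.ball b₀ r, DifferentiableAt ℝ G (e.symm (a, b)) := fun b hb =>
    hG _ (e.map_target (hball b hb))
  refine Metric.isOpen_ball.is_const_of_fderiv_eq_zero (𝕜 := ℝ) (f := fun b => G (e.symm (a, b)))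
    (convex_ball b₀ r).isPreconnected
    (fun b hb => ((hGd b hb).comp b (hγ b hb)).differentiableWithinAt) (fun b hb => ?_) hb hb'
  have hs := e.map_target (hball b hb)
  have h1 : (fun b => e (e.symm (a, b))) =ᶠ[nhds b] fun b => (a, b) := by
    filter_upwards [Metric.isOpen_ball.mem_nhds hb] with b' hb'
    exact e.right_inv (hball b' hb')
  have h2 := ((he _ hs).hasFDerivAt.comp b (hγ b hb).hasFDerivAt).fderiv
  have h3 : fderiv ℝ (fun b : K => (a, b)) b =
      (0 : K →L[ℝ] Euc 2).prod (ContinuousLinearMap.id ℝ K) :=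
    ((hasFDerivAt_const a b).prodMk (hasFDerivAt_id b)).fderiv
  ext v
  have h4 := ((hGd b hb).hasFDerivAt.comp b (hγ b hb).hasFDerivAt).fderiv
  refine (congrArg (fun l : K →L[ℝ] Y => l v) h4).trans ?_
  refine hker _ hs _ ?_
  have h5 := h2.symm.trans (h1.fderiv_eq.trans h3)
  exact congrArg (fun l : K →L[ℝ] Euc 2 × K => (l v).1) h5

variable [FiniteDimensional ℝ Y]

/-- A map of constant rank two has, near each point, a chart whose first component has the same
kernel as the map. -/
lemma exists_chart_of_rank_two {G : Euc n → Y} {O : Set (Euc n)} (hO : IsOpen O)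
    (hG : ∀ z ∈ O, ContDiffAt ℝ ∞ G z)
    (hrank : ∀ z ∈ O, Module.finrank ℝ (LinearMap.range (fderiv ℝ G z).toLinearMap) = 2)
    {z₀ : Euc n} (hz₀ : z₀ ∈ O) :
    ∃ (K : Submodule ℝ (Euc n)) (e : OpenPartialHomeomorph (Euc n) (Euc 2 × K)),
      z₀ ∈ e.source ∧ e.source ⊆ O ∧ ∀ z ∈ e.source, ContDiffAt ℝ ∞ e z ∧
        (∃ A : Euc n ≃L[ℝ] Euc 2 × K, HasFDerivAt e (A : Euc n →L[ℝ] Euc 2 × K) z) ∧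
        ∀ u, (fderiv ℝ e z u).1 = 0 ↔ fderiv ℝ G z u = 0 := by
  obtain ⟨P, hP⟩ := exists_surjective_comp (hrank z₀ hz₀)
  set K := LinearMap.ker (P ∘L fderiv ℝ G z₀).toLinearMap
  -- `P ∘ G` is a submersion at `z₀`; the projection onto the kernel of its differential
  -- completes it to a chart.
  let Q : Euc n →L[ℝ] K := K.orthogonalProjectionOnto
  let Φ : Euc n → Euc 2 × K := fun z => (P (G z), Q z)
  have hΦ : ∀ z ∈ O, ContDiffAt ℝ ∞ Φ z := fun z hz =>
    (P.contDiff.contDiffAt.comp z (hG z hz)).prodMk Q.contDiff.contDiffAt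
  have hΦ' : ∀ z ∈ O, HasFDerivAt Φ ((P ∘L fderiv ℝ G z).prod Q) z := fun z hz =>
    (P.hasFDerivAt.comp z (differentiableAt_of_smooth (hG z hz)).hasFDerivAt).prodMk Q.hasFDerivAt
  have hinj : Function.Injective ((P ∘L fderiv ℝ G z₀).prod Q) := by
    rw [injective_iff_map_eq_zero]
    intro u hu
    have h1 : (P ∘L fderiv ℝ G z₀) u = 0 := congrArg Prod.fst hu
    have h2 : Q u = 0 := congrArg Prod.snd hu
    have h3 := K.orthogonalProjectionOnto_mem_subspace_eq_self ⟨u, h1⟩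
    exact congrArg Subtype.val (h3.symm.trans h2)
  have hdim : Module.finrank ℝ (Euc n) = Module.finrank ℝ (Euc 2 × K) := by
    have h1 := LinearMap.finrank_range_add_finrank_ker (P ∘L fderiv ℝ G z₀).toLinearMap
    have h2 : LinearMap.range (P ∘L fderiv ℝ G z₀).toLinearMap = ⊤ := LinearMap.range_eq_top.2 hP
    rw [h2, finrank_top] at h1
    rw [Module.finrank_prod, ← h1]
  let A₀ : Euc n ≃L[ℝ] Euc 2 × K := (LinearMap.linearEquivOfInjective
    ((P ∘L fderiv ℝ G z₀).prod Q).toLinearMap hinj hdim).toContinuousLinearEquiv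
  have hA₀ : (A₀ : Euc n →L[ℝ] Euc 2 × K) = (P ∘L fderiv ℝ G z₀).prod Q := by
    ext u
    all_goals rfl
  have hd₀ : HasFDerivAt Φ (A₀ : Euc n →L[ℝ] Euc 2 × K) z₀ := by
    rw [hA₀]
    exact hΦ' z₀ hz₀
  -- The differential stays invertible near `z₀`, so the inverse chart is smooth on its domain.
  have hev : ∀ᶠ z in nhds z₀, fderiv ℝ Φ z ∈
      Set.range (ContinuousLinearEquiv.toContinuousLinearMap : (Euc n ≃L[ℝ] Euc 2 × K) → _) := by
    refine (contDiffAt_fderiv (hΦ z₀ hz₀)).continuousAt ?_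
    rw [hd₀.fderiv]
    exact ContinuousLinearEquiv.nhds A₀
  obtain ⟨S, hS, hSo, hzS⟩ := mem_nhds_iff.1 (hev.and (hO.mem_nhds hz₀))
  let e₀ := (hΦ z₀ hz₀).toOpenPartialHomeomorph Φ hd₀ (by simp)
  have he₀ : (e₀ : Euc n → Euc 2 × K) = Φ := ContDiffAt.toOpenPartialHomeomorph_coe _ _ _
  let e := e₀.restrOpen S hSo
  have he : (e : Euc n → Euc 2 × K) = Φ := he₀
  have hsrc : e.source = e₀.source ∩ S := e₀.restrOpen_source S hSo
  refine ⟨K, e, ?_, ?_, ?_⟩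
  · rw [hsrc]
    exact ⟨ContDiffAt.mem_toOpenPartialHomeomorph_source _ _ _, hzS⟩
  · rw [hsrc]
    exact fun z hz => (hS hz.2).2
  · intro z hz
    rw [hsrc] at hz
    obtain ⟨⟨A, hA⟩, hzO⟩ := hS hz.2
    rw [he]
    refine ⟨hΦ z hzO, ⟨A, ?_⟩, fun u => ?_⟩
    · rw [hA]
      exact (hΦ' z hzO).differentiableAt.hasFDerivAt
    · rw [(hΦ' z hzO).fderiv] at hA ⊢
      refine apply_eq_zero_iff_of_surjective_comp (hrank z hzO) (fun b => ?_) u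
      refine ⟨A.symm (b, 0), ?_⟩
      have h1 := A.apply_symm_apply (b, 0)
      have h2 := congrArg (fun l : Euc n →L[ℝ] Euc 2 × K => l (A.symm (b, 0))) hA
      exact congrArg Prod.fst (h2.symm.trans h1)

/-- A map of constant rank two factors near each point through a submersion onto the plane. -/
lemma exists_factorization_of_rank_two {G : Euc n → Y} {O : Set (Euc n)} (hO : IsOpen O)
    (hG : ∀ z ∈ O, ContDiffAt ℝ ∞ G z)
    (hrank : ∀ z ∈ O, Module.finrank ℝ (LinearMap.range (fderiv ℝ G z).toLinearMap) = 2)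
    {z₀ : Euc n} (hz₀ : z₀ ∈ O) :
    ∃ V ⊆ O, IsOpen V ∧ z₀ ∈ V ∧ ∃ (q : Euc n → Euc 2) (Γ : Euc 2 → Y),
      (∀ z ∈ V, ContDiffAt ℝ ∞ q z) ∧ q '' V = Set.univ ∧
      (∀ z ∈ V, Function.Surjective (fderiv ℝ q z)) ∧
      (∀ z ∈ V, ∀ u, fderiv ℝ q z u = 0 ↔ fderiv ℝ G z u = 0) ∧
      ContDiff ℝ ∞ Γ ∧ ∀ z ∈ V, Γ (q z) = G z := by
  obtain ⟨K, e, hz, hsub, he⟩ := exists_chart_of_rank_two hO hG hrank hz₀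
  have hsymm : ∀ p ∈ e.target, ContDiffAt ℝ ∞ e.symm p := by
    intro p hp
    obtain ⟨h1, ⟨A, hA⟩, -⟩ := he _ (e.map_target hp)
    exact e.contDiffAt_symm hp hA h1
  obtain ⟨r, hr, hball⟩ := Metric.isOpen_iff.1 e.open_target (e z₀) (e.map_source hz)
  rw [← Prod.mk.eta (p := e z₀), ← ball_prod_same] at hball
  set a₀ := (e z₀).1
  set b₀ := (e z₀).2
  have hb₀ : b₀ ∈ Metric.ball b₀ r := Metric.mem_ball_self hr
  have hk : ∀ z ∈ e.source, HasFDerivAt (fun z => (e z).1)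
      (ContinuousLinearMap.fst ℝ (Euc 2) K ∘L fderiv ℝ e z) z := fun z hz =>
    hasFDerivAt_fst.comp z (differentiableAt_of_smooth (he z hz).1).hasFDerivAt
  have hksurj : ∀ z ∈ e.source, Function.Surjective fun u => (fderiv ℝ e z u).1 := by
    intro z hz b
    obtain ⟨-, ⟨A, hA⟩, -⟩ := he z hz
    refine ⟨A.symm (b, 0), ?_⟩
    rw [hA.fderiv]
    exact congrArg Prod.fst (A.apply_symm_apply (b, 0))
  have hconst : ∀ a ∈ Metric.ball a₀ r, ∀ b ∈ Metric.ball b₀ r,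
      G (e.symm (a, b)) = G (e.symm (a, b₀)) := fun a ha b hb =>
    comp_symm_eq_of_ker (fun z hz => differentiableAt_of_smooth (hG z (hsub hz)))
      (fun z hz => differentiableAt_of_smooth (he z hz).1)
      (fun p hp => differentiableAt_of_smooth (hsymm p hp)) (fun z hz u => ((he z hz).2.2 u).1)
      (fun b hb => hball ⟨ha, hb⟩) hb hb₀
  -- A diffeomorphism of the plane onto the ball makes the quotient the whole plane.
  let β := OpenPartialHomeomorph.univBall a₀ r
  have hβ : ContDiff ℝ ∞ β := OpenPartialHomeomorph.contDiff_univBall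
  have hβs : β.source = Set.univ := OpenPartialHomeomorph.univBall_source a₀ r
  have hβt : β.target = Metric.ball a₀ r := OpenPartialHomeomorph.univBall_target a₀ hr
  have hβm : ∀ y, β y ∈ Metric.ball a₀ r := fun y => by
    rw [← hβt]
    exact β.map_source (by rw [hβs]; trivial)
  let V := e.source ∩ e ⁻¹' (Metric.ball a₀ r ×ˢ Metric.ball b₀ r)
  have hVo : IsOpen V := e.isOpen_inter_preimage (Metric.isOpen_ball.prod Metric.isOpen_ball)
  have hq : ∀ z ∈ V, ContDiffAt ℝ ∞ (fun z => β.symm (e z).1) z := fun z hz =>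
    ContDiffAt.comp z (OpenPartialHomeomorph.contDiffOn_univBall_symm.contDiffAt
      (Metric.isOpen_ball.mem_nhds hz.2.1)) (he z hz.1).1.fst
  have hqd : ∀ z ∈ V, ∀ u, fderiv ℝ β (β.symm (e z).1) (fderiv ℝ (fun z => β.symm (e z).1) z u) =
      (fderiv ℝ e z u).1 := by
    intro z hz u
    have h1 : (fun z => β (β.symm (e z).1)) =ᶠ[nhds z] fun z => (e z).1 := by
      filter_upwards [hVo.mem_nhds hz] with z' hz'
      exact β.right_inv (by rw [hβt]; exact hz'.2.1)
    have h2 := ((hβ.differentiable (by simp) _).hasFDerivAt.comp z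
      (differentiableAt_of_smooth (hq z hz)).hasFDerivAt).fderiv
    have h3 := h2.symm.trans (h1.fderiv_eq.trans (hk z hz.1).fderiv)
    exact congrArg (fun l : Euc n →L[ℝ] Euc 2 => l u) h3
  have hβinj : ∀ z ∈ V, Function.Injective (fderiv ℝ β (β.symm (e z).1)) := by
    intro z hz
    refine (LinearMap.injective_iff_surjective
      (f := (fderiv ℝ β (β.symm (e z).1)).toLinearMap)).2 fun b => ?_
    obtain ⟨u, hu⟩ := hksurj z hz.1 b
    exact ⟨_, (hqd z hz u).trans hu⟩
  refine ⟨V, fun z hz => hsub hz.1, hVo, ⟨hz, Metric.mem_ball_self hr, hb₀⟩,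
    fun z => β.symm (e z).1, fun y => G (e.symm (β y, b₀)), hq, ?_, ?_, ?_, ?_, ?_⟩
  · rw [Set.eq_univ_iff_forall]
    intro y
    have ht : (β y, b₀) ∈ e.target := hball ⟨hβm y, hb₀⟩
    refine ⟨e.symm (β y, b₀), ⟨e.map_target ht, ?_⟩, ?_⟩
    · rw [Set.mem_preimage, e.right_inv ht]
      exact ⟨hβm y, hb₀⟩
    · simp only [e.right_inv ht]
      exact β.left_inv (by rw [hβs]; trivial)
  · intro z hz b
    obtain ⟨u, hu⟩ := hksurj z hz.1 (fderiv ℝ β (β.symm (e z).1) b)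
    exact ⟨u, hβinj z hz ((hqd z hz u).trans hu)⟩
  · intro z hz u
    rw [← (he z hz.1).2.2 u, ← hqd z hz u]
    exact ⟨fun h => by rw [h, map_zero], fun h => hβinj z hz (h.trans (map_zero _).symm)⟩
  · rw [contDiff_iff_contDiffAt]
    intro y
    have ht : (β y, b₀) ∈ e.target := hball ⟨hβm y, hb₀⟩
    have h1 : ContDiffAt ℝ ∞ (fun y => e.symm (β y, b₀)) y :=
      ContDiffAt.comp (f := fun y => (β y, b₀)) y (hsymm _ ht)
        (hβ.contDiffAt.prodMk contDiffAt_const)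
    exact ContDiffAt.comp y (hG _ (hsub (e.map_target ht))) h1
  · intro z hz
    have h1 : β (β.symm (e z).1) = (e z).1 := β.right_inv (by rw [hβt]; exact hz.2.1)
    simp only [h1]
    rw [← hconst _ hz.2.1 _ hz.2.2, Prod.mk.eta, e.left_inv hz.1]

end RankTwo

/-! ### Local existence of the focal surface -/

section LocalExistence

variable {n m : ℕ} {M : Type*} [TopologicalSpace M] [ChartedSpace (Euc n) M]
  [IsManifold (𝓡 n) ∞ M] [RiemannianBundle (fun x : M => TangentSpace (𝓡 n) x)]
  {f : M → Euc (n + m)}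

/-- The focal map together with the radius `1 / H`. -/
def focalPair (f : M → Euc (n + m)) (x : M) : Euc (n + m) × ℝ :=
  (focalMap f x, 1 / meanCurvature n f x)

lemma IsGenericWintgen.contMDiff_focalPair (hn : 2 ≤ n) (hf : IsGenericWintgen f) :
    ContMDiff (𝓡 n) 𝓘(ℝ, Euc (n + m) × ℝ) ∞ (focalPair f) :=
  (hf.contMDiff_focalMap hn).prodMk_space (hf.contMDiff_inv_meanCurvature hn)

lemma IsGenericWintgen.push_focalPair (hn : 2 ≤ n) (hf : IsGenericWintgen f) (x : M)
    (X : TangentSpace (𝓡 n) x) :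
    push (𝓡 n) (focalPair f) x X =
      (push (𝓡 n) (focalMap f) x X, push (𝓡 n) (fun y => 1 / meanCurvature n f y) x X) :=
  push_prodMk ((hf.contMDiff_focalMap hn).mdifferentiableAt (by simp))
    ((hf.contMDiff_inv_meanCurvature hn).mdifferentiableAt (by simp)) X

lemma IsGenericWintgen.push_focalPair_eq_zero_iff (hn : 4 ≤ n) (hf : IsGenericWintgen f) {x : M}
    {T : TangentSpace (𝓡 n) x} :
    push (𝓡 n) (focalPair f) x T = 0 ↔ T ∈ meanCurvatureDistribution f x := by
  rw [hf.push_focalPair (by omega), ← hf.push_focalMap_eq_zero_iff hn]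
  refine ⟨fun h => congrArg Prod.fst h, fun h => Prod.ext h ?_⟩
  exact hf.push_inv_meanCurvature hn ((hf.push_focalMap_eq_zero_iff hn).1 h)

lemma IsGenericWintgen.finrank_range_push_focalPair (hn : 4 ≤ n) (hf : IsGenericWintgen f) (x : M) :
    Module.finrank ℝ (LinearMap.range (push (𝓡 n) (focalPair f) x).toLinearMap) = 2 := by
  obtain ⟨e₁, e₂, η₁, η₂, μ, γ, h⟩ := hf.exists_isGenericForm (by omega) x
  have hker : LinearMap.ker (push (𝓡 n) (focalPair f) x).toLinearMap =
      (Submodule.span ℝ (Set.range ![e₁, e₂]))ᗮ := by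
    ext T
    have h1 : T ∈ LinearMap.ker (push (𝓡 n) (focalPair f) x).toLinearMap ↔
        (inner ℝ T e₁ : ℝ) = 0 ∧ (inner ℝ T e₂ : ℝ) = 0 :=
      (hf.push_focalPair_eq_zero_iff hn).trans (h.mem_meanCurvatureDistribution h.radius_ne)
    rw [h1, Submodule.mem_orthogonal']
    refine ⟨fun hT u hu => ?_, fun hT => ⟨hT _ (Submodule.subset_span ⟨0, rfl⟩),
      hT _ (Submodule.subset_span ⟨1, rfl⟩)⟩⟩
    induction hu using Submodule.span_induction with
    | mem u hu =>
      obtain ⟨i, rfl⟩ := hu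
      fin_cases i
      exacts [hT.1, hT.2]
    | zero => exact inner_zero_right _
    | add u v _ _ hu hv => rw [inner_add_right, hu, hv, add_zero]
    | smul c u _ hu => rw [real_inner_smul_right, hu, mul_zero]
  have h1 := LinearMap.finrank_range_add_finrank_ker (push (𝓡 n) (focalPair f) x).toLinearMap
  have h2 := Submodule.finrank_add_finrank_orthogonal (Submodule.span ℝ (Set.range ![e₁, e₂]))
  have h3 : Module.finrank ℝ (Submodule.span ℝ (Set.range ![e₁, e₂])) = 2 :=
    finrank_span_eq_card (orthonormal_pair h.norm_e₁ h.norm_e₂ h.inner_e).linearIndependent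
  rw [hker] at h1
  omega

theorem IsGenericWintgen.exists_isFocalSurface (hn : 4 ≤ n) (hf : IsGenericWintgen f) (p : M) :
    ∃ U : Set M, IsOpen U ∧ p ∈ U ∧ ∃ (pr : M → Euc 2) (g : Euc 2 → Euc (n + m)) (τ : Euc 2 → ℝ),
      IsFocalSurface f U pr g τ := by
  set φ := extChartAt (𝓡 n) p
  set G := chartRep (k := n) p (focalPair f)
  have hpair := hf.contMDiff_focalPair (by omega)
  have hG : ∀ z ∈ φ.target, ContDiffAt ℝ ∞ G z := fun z hz =>
    contDiffAt_chartRep hz hpair.contMDiffAt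
  have hpush : ∀ x ∈ φ.source, ∀ X : TangentSpace (𝓡 n) x, push (𝓡 n) (focalPair f) x X =
      fderiv ℝ G (φ x) (chartDeriv p x X) := fun x hx X => push_eq_fderiv hx hpair.contMDiffAt X
  have hrank : ∀ z ∈ φ.target,
      Module.finrank ℝ (LinearMap.range (fderiv ℝ G z).toLinearMap) = 2 := by
    intro z hz
    have hx := φ.map_target hz
    rw [← hf.finrank_range_push_focalPair hn (φ.symm z)]
    have h1 : LinearMap.range (fderiv ℝ G z).toLinearMap =
        LinearMap.range (push (𝓡 n) (focalPair f) (φ.symm z)).toLinearMap := by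
      ext v
      constructor
      · rintro ⟨u, rfl⟩
        obtain ⟨X, rfl⟩ := (chartDeriv_bijective (k := n) hx).2 u
        refine ⟨X, (hpush _ hx X).trans ?_⟩
        rw [φ.right_inv hz]
        rfl
      · rintro ⟨X, rfl⟩
        refine ⟨chartDeriv p (φ.symm z) X, Eq.trans ?_ (hpush _ hx X).symm⟩
        rw [φ.right_inv hz]
        rfl
    rw [h1]
  obtain ⟨V, hVsub, hVo, hpV, q, Γ, hq, hqV, hqs, hqk, hΓ, hΓq⟩ :=
    exists_factorization_of_rank_two (isOpen_extChartAt_target (I := 𝓡 n) p) hG hrank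
      (mem_extChartAt_target (I := 𝓡 n) p)
  have hφ : ∀ x ∈ φ.source, ContMDiffAt (𝓡 n) 𝓘(ℝ, Euc n) ∞ φ x := fun x hx =>
    contMDiffAt_extChartAt' (by simpa [φ] using hx)
  set U := φ.source ∩ φ ⁻¹' V
  have hUo : IsOpen U := (continuousOn_extChartAt (I := 𝓡 n) p).isOpen_inter_preimage
    (isOpen_extChartAt_source (I := 𝓡 n) p) hVo
  have hpr : ∀ x ∈ U, ∀ X : TangentSpace (𝓡 n) x,
      mfderiv (𝓡 n) (𝓡 2) (q ∘ φ) x X = fderiv ℝ q (φ x) (chartDeriv p x X) := fun x hx X =>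
    push_comp_fderiv (differentiableAt_of_smooth (hq _ hx.2))
      ((hφ x hx.1).mdifferentiableAt (by simp)) X
  have hΓ1 : ContDiff ℝ ∞ fun y => (Γ y).1 := hΓ.fst
  have hfac : ∀ x ∈ U, Γ (q (φ x)) = focalPair f x := fun x hx =>
    (hΓq _ hx.2).trans (chartRep_apply _ hx.1)
  refine ⟨U, hUo, ⟨mem_extChartAt_source p, hpV⟩, q ∘ φ, fun y => (Γ y).1, fun y => (Γ y).2,
    ⟨fun x hx => ?_, ?_, fun x hx => ?_, fun x hx T => ?_, hΓ1.contMDiff, fun y => ?_,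
      hΓ.snd.contMDiff, fun x hx => congrArg Prod.fst (hfac x hx),
      fun x hx => congrArg Prod.snd (hfac x hx)⟩⟩
  · exact (contMDiffAt_comp_vectorSpace (hq _ hx.2) (hφ x hx.1)).contMDiffWithinAt
  · rw [← hqV]
    ext y
    constructor
    · rintro ⟨x, hx, rfl⟩
      exact ⟨φ x, hx.2, rfl⟩
    · rintro ⟨z, hz, rfl⟩
      have h1 : φ (φ.symm z) = z := φ.right_inv (hVsub hz)
      refine ⟨φ.symm z, ⟨φ.map_target (hVsub hz), ?_⟩, congrArg q h1⟩
      rw [Set.mem_preimage, h1]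
      exact hz
  · intro b
    obtain ⟨u, hu⟩ := hqs _ hx.2 b
    obtain ⟨X, rfl⟩ := (chartDeriv_bijective (k := n) hx.1).2 u
    exact ⟨X, (hpr x hx X).trans hu⟩
  · rw [hpr x hx, ← hf.push_focalPair_eq_zero_iff hn, hpush x hx.1]
    exact hqk _ hx.2 _
  · rw [injective_iff_map_eq_zero]
    intro b hb
    obtain ⟨z, hz, rfl⟩ : y ∈ q '' V := by
      rw [hqV]
      trivial
    obtain ⟨u, rfl⟩ := hqs z hz b
    have hzx := φ.map_target (hVsub hz)
    have hz' : φ (φ.symm z) = z := φ.right_inv (hVsub hz)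
    obtain ⟨X, rfl⟩ := (chartDeriv_bijective (k := n) hzx).2 u
    -- The first component of `G_* X` vanishes, hence so does `G_* X`.
    have h1 : (fun z' => Γ (q z')) =ᶠ[nhds z] G := by
      filter_upwards [hVo.mem_nhds hz] with z' hz'
      exact hΓq z' hz'
    have h2 : fderiv ℝ Γ (q z) (fderiv ℝ q z (chartDeriv p (φ.symm z) X)) =
        fderiv ℝ G z (chartDeriv p (φ.symm z) X) := by
      rw [← h1.fderiv_eq]
      exact congrArg (fun l : Euc n →L[ℝ] _ => l (chartDeriv p (φ.symm z) X))
        (((hΓ.differentiable (by simp) _).hasFDerivAt.comp z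
          (differentiableAt_of_smooth (hq z hz)).hasFDerivAt).fderiv.symm)
    have h3 : (fderiv ℝ Γ (q z) (fderiv ℝ q z (chartDeriv p (φ.symm z) X))).1 = 0 := by
      have h4 : fderiv ℝ (fun y => (Γ y).1) (q z) (fderiv ℝ q z (chartDeriv p (φ.symm z) X)) = 0 :=
          by
        rw [← push_vectorSpace]
        exact hb
      rw [← h4]
      exact congrArg (fun l : Euc 2 →L[ℝ] _ => l (fderiv ℝ q z (chartDeriv p (φ.symm z) X)))
        (hasFDerivAt_fst.comp (q z) (hΓ.differentiable (by simp) (q z)).hasFDerivAt).fderiv.symm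
    have h5 : push (𝓡 n) (focalPair f) (φ.symm z) X = fderiv ℝ G z (chartDeriv p (φ.symm z) X) := by
      rw [hpush _ hzx, hz']
    rw [h2, ← h5, hf.push_focalPair (by omega)] at h3
    refine (hqk z hz _).2 ?_
    rw [← h5]
    exact (hf.push_focalPair_eq_zero_iff hn).2 ((hf.push_focalMap_eq_zero_iff hn).1 h3)

end LocalExistence

end Wintgen

end

open Wintgen in
theorem mainTheorem1 {n m : ℕ} (hn : 4 ≤ n)
    {M : Type*} [TopologicalSpace M] [ChartedSpace (Euc n) M] [IsManifold (𝓡 n) ∞ M]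
    [RiemannianBundle (fun x : M => TangentSpace (𝓡 n) x)]
    [IsContMDiffRiemannianBundle (𝓡 n) ∞ (Euc n) (fun x : M => TangentSpace (𝓡 n) x)] :
    (∀ f : M → Euc (n + m), IsGenericWintgen f →
      (∀ p : M, ∃ U : Set M, IsOpen U ∧ p ∈ U ∧
        ∃ (L : Type) (_ : TopologicalSpace L) (_ : T2Space L) (_ : SecondCountableTopology L)
          (_ : ConnectedSpace L) (_ : ChartedSpace (Euc 2) L) (_ : IsManifold (𝓡 2) ∞ L)
          (pr : M → L) (g : L → Euc (n + m)) (τ : L → ℝ),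
          IsFocalSurface f U pr g τ ∧ FactorsThroughConformalGauss f U pr g τ) ∧
      (∀ (L : Type*) [TopologicalSpace L] [ChartedSpace (Euc 2) L] [IsManifold (𝓡 2) ∞ L]
        (U : Set M) (pr : M → L) (g : L → Euc (n + m)) (τ : L → ℝ),
        IsOpen U → IsFocalSurface f U pr g τ → FactorsThroughConformalGauss f U pr g τ)) ∧
    (∀ (L : Type*) [TopologicalSpace L] [ChartedSpace (Euc 2) L] [IsManifold (𝓡 2) ∞ L]
      (g : L → Euc (n + m)) (τ : L → ℝ) (j : M → L × Euc (n + m)),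
      ContMDiff (𝓡 2) 𝓘(ℝ, Euc (n + m)) ∞ g →
      (∀ y, Function.Injective (push (𝓡 2) g y)) →
      ContMDiff (𝓡 2) 𝓘(ℝ, ℝ) ∞ τ →
      (∀ y, 0 < τ y) →
      (∀ y, ‖pushGradient g τ y‖ < 1) →
      IsMinimalVerticalImmersion n g τ Set.univ j →
      (∀ x : M, ∃ e₁ e₂ : TangentSpace (𝓡 n) x,
        IsConullityFrame g τ j x e₁ e₂ ∧
        AreSemiAxes (curvatureEllipse n g τ j x) (sffInto g τ j x e₁ e₁) (sffInto g τ j x e₁ e₂) ∧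
        sffInto g τ j x e₁ e₁ ≠ 0 ∧ sffInto g τ j x e₁ e₂ ≠ 0 ∧
        shapeForm g τ (j x) (jStar j x e₁) (jStar j x e₁) = 1 / τ (j x).1 ∧
        shapeForm g τ (j x) (jStar j x e₂) (jStar j x e₂) = 1 / τ (j x).1 ∧
        shapeForm g τ (j x) (jStar j x e₁) (jStar j x e₂) ^ 2
          = ‖sffInto g τ j x e₁ e₁‖ ^ 2 - ‖sffInto g τ j x e₁ e₂‖ ^ 2 ∧
        0 < ‖sffInto g τ j x e₁ e₁‖ ^ 2 - ‖sffInto g τ j x e₁ e₂‖ ^ 2) →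
      IsGenericWintgen (conformalGauss g τ ∘ j) ∧
      ∀ x, meanCurvature n (conformalGauss g τ ∘ j) x = 1 / τ (j x).1) := by
  refine ⟨fun f hf => ⟨fun p => ?_, fun L _ _ _ U pr g τ hU hs =>
    hs.factorsThroughConformalGauss hn hf hU⟩, ?_⟩
  · obtain ⟨U, hU, hp, pr, g, τ, hs⟩ := hf.exists_isFocalSurface hn p
    exact ⟨U, hU, hp, Euc 2, inferInstance, inferInstance, inferInstance, inferInstance,
      inferInstance, inferInstance, pr, g, τ, hs, hs.factorsThroughConformalGauss hn hf hU⟩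
  · intro L _ _ _ g τ j hg hinj hτ hpos hlt hj hfr
    exact IsGaussData.isGenericWintgen_comp (by omega) ⟨hg, hinj, hτ, hpos, hlt⟩ hj hfr
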